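/- **Notation.** Let $V=\{v_0,v_1,v_2,\ldots\}$, graded by $\operatorname{wt}(v_0)=1$ and $\operatorname{wt}(v_i)=i$ for $i\ge1$. Let $\mathbb{Q}\langle V\rangle$ be the free associative algebra on $V$ (with basis the words in $V$, unit $\mathbf 1$ the empty word, and the induced weight grading), $\operatorname{Lie}(V)$ the free Lie algebra over $\mathbb{Q}$, with enveloping algebra $\mathbb{Q}\langle V\rangle$, and $M(V)$ the free magma on $V$ with operation $\star$; let $M(V)_{\mathbb Q}\to \operatorname{Lie}(V)$ be the surjection induced by $a\star b\mapsto[a,b]$. Let $\Delta_{\sqcup\!\sqcup}$ be the shuffle coproduct (the algebra morphism with $v\mapsto v\otimes \mathbf 1+\mathbf 1\otimes v$ for $v\in V$), for which Sweedler's notation $A_{(1)}\otimes A_{(2)}$ is used, $\sqcup\!\sqcup$ the shuffle product, $S(v_{k_1}\cdots v_{k_d})=(-1)^d v_{k_d}\cdots v_{k_1}$, and $(\cdot\mid\cdot)$ the pairing on $\mathbb{Q}\langle V\rangle$ for which the words are orthonormal. For $\mathbf k,\mathbf l\in\mathbb{Z}_{\ge0}^d$ put $|\mathbf k|=\sum_i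 k_i$ and $m_{\mathbf k,\mathbf l}=(-1)^{|\mathbf k|+|\mathbf l|}\prod_i\binom{k_i-1}{l_i-1}$, where $\binom{k-1}{l-1}$ is $1$ if $k=l=0$ and $0$ if exactly one of $k,l$ is $0$; the empty product is $1$. For $t\in M(V)$ with letters $v_{k_1},\ldots,v_{k_d}$ from left to right write $t=t(\mathbf k)$, and let $t(\mathbf l)$ be the result of replacing these letters by $v_{l_1},\ldots,v_{l_d}$; similarly, $A=A(\mathbf k)=v_{k_1}\cdots v_{k_d}$ and $A(\mathbf l)$ for words. Define a bilinear map $\triangleright_a$ on $M(V)_{\mathbb Q}$ by $$t(\mathbf k)\triangleright_a v_0=0,\qquad t(\mathbf k)\triangleright_a v_s=\sum_{\mathbf l}m_{\mathbf k,\mathbf l}\; v_{s+|\mathbf k|-|\mathbf l|}\star t(\mathbf l)\quad(s\ge1),$$ and by requiring that $t\,\triangleright_a$ is a derivation for $\star$. **Theorem.** (1) The map $\triangleright_a$ descends to $\operatorname{Lie}(V)$, and $(\operatorname{Lie}(V),[\cdot,\cdot],\triangleright_a)$ is a post-Lie algebra, i.e. $x\triangleright[y,z]=[x\triangleright y,z]+[y,x\triangleright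 z]$ and $[x,y]\triangleright z=x\triangleright(y\triangleright z)-(x\triangleright y)\triangleright z-y\triangleright(x\triangleright z)+(y\triangleright x)\triangleright z$. It is graded by the weight, with finite-dimensional homogeneous parts. (2) There is a unique bilinear extension of $\triangleright_a$ to $\mathbb{Q}\langle V\rangle$ such that $x\triangleright_a\mathbf 1=0$, $\mathbf 1\triangleright_a A=A$, $xA\triangleright_a y=x\triangleright_a(A\triangleright_a y)-(x\triangleright_a A)\triangleright_a y$ and $A\triangleright_a BC=(A_{(1)}\triangleright_a B)(A_{(2)}\triangleright_a C)$ for all $x,y\in\operatorname{Lie}(V)$ and $A,B,C\in\mathbb{Q}\langle V\rangle$. Define the Grossman–Larson product by $A\circledast_a B=A_{(1)}(A_{(2)}\triangleright_a B)$. (3) There is a unique linear map $\Delta_a:\mathbb{Q}\langle V\rangle\to\mathbb{Q}\langle V\rangle\otimes\mathbb{Q}\langle V\rangle$ with $(A\circledast_a B\mid C)=(A\otimes B\mid\Delta_a(C))$ for all $A,B,C$. (4) With unit $\mathbf 1$ and with the coefficient of the empty word as counit, $(\mathbb{Q}\langle V\rangle,\sqcup\!\sqcup,\Delta_a)$ and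 $(\mathbb{Q}\langle V\rangle,\circledast_a,\Delta_{\sqcup\!\sqcup})$ are Hopf algebras graded by the weight, with finite-dimensional homogeneous parts. They are graded dual to each other: $(\cdot\mid\cdot)$ is non-degenerate, parts of different weights are orthogonal, and under $(\cdot\mid\cdot)$ the product, unit, coproduct, counit and antipode of either one are dual to the coproduct, counit, product, unit and antipode of the other. (5) For every word $A$ and every word $w=w_1v_{i_1}w_2\cdots w_dv_{i_d}w_{d+1}$ with $i_1,\ldots,i_d\ge1$ and all $w_j\in\{v_0^m\mid m\ge0\}$, $$A\circledast_a w=\sum_{\mathbf l_2,\ldots,\mathbf l_{2d+1}}\ \prod_{j=2}^{2d+1}m_{\mathbf k_j,\mathbf l_j}\;A_{(1)}w_1\prod_{j=1}^{d}\Big(S\big(A_{(2j)}(\mathbf l_{2j})\big)\,v_{i_j+|\mathbf k_{2j}|+|\mathbf k_{2j+1}|-|\mathbf l_{2j}|-|\mathbf l_{2j+1}|}\,A_{(2j+1)}(\mathbf l_{2j+1})\,w_{j+1}\Big),$$ where $A_{(1)}\otimes\cdots\otimes A_{(2d+1)}$ is the iterated shuffle coproduct of $A$ (summation over its word summands is understood),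 $A_{(j)}=A_{(j)}(\mathbf k_j)$, and the factors of the last product are ordered by increasing $j$. (6) For all $d\ge0$ and $k_1,\ldots,k_d\ge0$, $$\Delta_a(v_{k_1}\cdots v_{k_d})=\sum\ \prod_{p}m_{k_p+l_p,\,k_p}\ \Big(v_{k_1}\cdots v_{k_{i_1}}\sqcup\!\sqcup\mathop{\sqcup\!\sqcup}_{s=1}^{n}\big(S(v_{k_{i_s+1}+l_{i_s+1}}\cdots v_{k_{j_s-1}+l_{j_s-1}})\sqcup\!\sqcup v_{k_{j_s+1}+l_{j_s+1}}\cdots v_{k_{i_{s+1}}+l_{i_{s+1}}}\big)\Big)\otimes v_{k_{j_1}-|\mathbf l_1|}\cdots v_{k_{j_n}-|\mathbf l_n|}.$$ Here the sum runs over all $0\le n\le d$, all $0\le i_1<j_1\le i_2<j_2\le\cdots\le i_n<j_n\le d$ (with $i_{n+1}=d$), and all tuples $\mathbf l_s=(l_{i_s+1},\ldots,\widehat{l_{j_s}},\ldots,l_{i_{s+1}})$ of non-negative integers, $1\le s\le n$, such that $\mathbf l_s=\emptyset$ or $|\mathbf l_s|\le k_{j_s}-1$; the product runs over the positions $p>i_1$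 different from $j_1,\ldots,j_n$. -/

import Mathlib

open scoped TensorProduct

namespace AriHopf

noncomputable section

attribute [local instance] LieRing.ofAssociativeRing LieAlgebra.ofAssociativeAlgebra

/-! ### Indices and multiplicities

The letters `v_0, v_1, v_2, …` are encoded by natural numbers, a word `v_{k_1} ⋯ v_{k_d}` and its
index `(k_1, …, k_d)` by the list `[k_1, …, k_d]`. -/

/-- `wt v_0 = 1` and `wt v_i = i` for `i ≥ 1`. -/
def letterWt (i : ℕ) : ℕ := if i = 0 then 1 else i

/-- The weight of a word. -/
def wordWt (w : List ℕ) : ℕ := (w.map letterWt).sum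

/-- The multiplicity `m_{k,l} = (-1)^(k+l) * binom (k-1) (l-1)` of two single indices, where the
binomial coefficient is `1` for `k = l = 0` and `0` if exactly one of `k, l` is zero. -/
def mult₁ (k l : ℕ) : ℚ :=
  if k = 0 ∧ l = 0 then 1
  else if k = 0 ∨ l = 0 then 0
  else (-1) ^ (k + l) * ((k - 1).choose (l - 1) : ℚ)

/-- The ari multiplicity `m_{𝐤,𝐥}` of two indices of the same length. -/
def mult (k l : List ℕ) : ℚ := (List.zipWith mult₁ k l).prod

/-- The finitely many indices `𝐥 ≤ 𝐤` (componentwise, same length), each listed once. -/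
def below : List ℕ → List (List ℕ)
  | [] => [[]]
  | k :: ks => (List.range (k + 1)).flatMap fun l => (below ks).map fun ls => l :: ls

/-- The componentwise sum of two indices of the same length. -/
def addIdx (k l : List ℕ) : List ℕ := List.zipWith (· + ·) k l

/-! ### The magmatic triangle map -/

/-- `M(V)_ℚ`: the `ℚ`-vector space on the free magma generated by `V`. -/
abbrev MQ : Type := FreeNonUnitalNonAssocAlgebra ℚ ℕ

/-- An element of the free magma, as a basis vector of `M(V)_ℚ`. -/
def tree (t : FreeMagma ℕ) : MQ := MonoidAlgebra.single t 1

/-- The index `𝐤` of `t = t(𝐤)`: the letters of `t` from left to right. -/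
def leaves : FreeMagma ℕ → List ℕ
  | .of k => [k]
  | .mul t u => leaves t ++ leaves u

/-- `relabel t 𝐥 = t(𝐥)`: replace the letters of `t`, from left to right, by the entries of `𝐥`. -/
def relabel : FreeMagma ℕ → List ℕ → FreeMagma ℕ
  | .of _, l => .of (l.headD 0)
  | .mul t u, l =>
      .mul (relabel t (l.take (leaves t).length)) (relabel u (l.drop (leaves t).length))

/-- `t(𝐤) ▷ u` for elements `t, u` of the free magma:
`t(𝐤) ▷ v_0 = 0`, `t(𝐤) ▷ v_s = ∑_𝐥 m_{𝐤,𝐥} v_{s + |𝐤 - 𝐥|} ⋆ t(𝐥)` for `s ≥ 1`, and `t ▷` is a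
derivation for `⋆`. -/
def triTree (t : FreeMagma ℕ) : FreeMagma ℕ → MQ
  | .of s =>
      if s = 0 then 0
      else ((below (leaves t)).map fun l =>
        mult (leaves t) l •
          tree (.mul (.of (s + ((leaves t).sum - l.sum))) (relabel t l))).sum
  | .mul u v => triTree t u * tree v + tree u * triTree t v

/-- The bilinear map `▷_a` on `M(V)_ℚ`. -/
def triMagma : MQ →ₗ[ℚ] MQ →ₗ[ℚ] MQ :=
  (MonoidAlgebra.basis (FreeMagma ℕ) ℚ).constr ℚ fun t =>
    (MonoidAlgebra.basis (FreeMagma ℕ) ℚ).constr ℚ fun u => triTree t u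

/-! ### The free Lie algebra and its grading -/

/-- `Lie(V)`: the free Lie algebra on `v_0, v_1, …` over `ℚ`. -/
abbrev LieV : Type := FreeLieAlgebra ℚ ℕ

/-- The canonical surjection `M(V)_ℚ → Lie(V)`, `v_i ↦ v_i`, `a ⋆ b ↦ [a, b]`. -/
def toLie (x : MQ) : LieV := FreeLieAlgebra.mk ℚ x

/-- The span of the Lie monomials of weight `n`. -/
def lieGrade (n : ℕ) : Submodule ℚ LieV :=
  Submodule.span ℚ {x | ∃ t : FreeMagma ℕ, wordWt (leaves t) = n ∧ x = toLie (tree t)}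

/-- `(L, [·,·], ▷)` is a post-Lie algebra. -/
structure IsPostLie {L : Type} [LieRing L] [LieAlgebra ℚ L] (tri : L →ₗ[ℚ] L →ₗ[ℚ] L) :
    Prop where
  tri_lie : ∀ x y z : L, tri x ⁅y, z⁆ = ⁅tri x y, z⁆ + ⁅y, tri x z⁆
  lie_tri : ∀ x y z : L,
    tri ⁅x, y⁆ z = tri x (tri y z) - tri (tri x y) z - tri y (tri x z) + tri (tri y x) z

/-- `(L, [·,·], ▷)` is a post-Lie algebra, graded by `L = ⨁ G n` with finite-dimensional pieces. -/
structure IsGradedPostLie {L : Type} [LieRing L] [LieAlgebra ℚ L] (tri : L →ₗ[ℚ] L →ₗ[ℚ] L)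
    (G : ℕ → Submodule ℚ L) : Prop extends IsPostLie tri where
  internal : DirectSum.IsInternal G
  finite : ∀ n, Module.Finite ℚ (G n)
  lie_mem : ∀ {m n : ℕ} {x y : L}, x ∈ G m → y ∈ G n → ⁅x, y⁆ ∈ G (m + n)
  tri_mem : ∀ {m n : ℕ} {x y : L}, x ∈ G m → y ∈ G n → tri x y ∈ G (m + n)

/-! ### The free associative algebra -/

/-- `ℚ⟨V⟩`: its multiplication `*` is concatenation of words. -/
abbrev QV : Type := MonoidAlgebra ℚ (FreeMonoid ℕ)

/-- The word `v_{k_1} ⋯ v_{k_d}` in `ℚ⟨V⟩`. -/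
def word (k : List ℕ) : QV := MonoidAlgebra.single (FreeMonoid.ofList k) 1

/-- The basis of `ℚ⟨V⟩` consisting of all words. -/
def wordBasis : Module.Basis (FreeMonoid ℕ) ℚ QV := MonoidAlgebra.basis (FreeMonoid ℕ) ℚ

/-- The weight grading on `ℚ⟨V⟩`. -/
def wtGrade (n : ℕ) : Submodule ℚ QV := Submodule.span ℚ {x | ∃ w, wordWt w = n ∧ x = word w}

/-- `Lie(V) → ℚ⟨V⟩`, `v_i ↦ v_i`, `[x, y] ↦ xy - yx`; it presents `ℚ⟨V⟩` as the universal
enveloping algebra of `Lie(V)`. -/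
def lieToQV : LieV →ₗ⁅ℚ⁆ QV := FreeLieAlgebra.lift ℚ fun i => word [i]

/-- The shuffle coproduct: the algebra morphism with `co v_i = v_i ⊗ 1 + 1 ⊗ v_i`. -/
def co : QV →ₐ[ℚ] QV ⊗[ℚ] QV :=
  MonoidAlgebra.lift ℚ (QV ⊗[ℚ] QV) (FreeMonoid ℕ)
    (FreeMonoid.lift fun i => word [i] ⊗ₜ[ℚ] 1 + 1 ⊗ₜ[ℚ] word [i])

/-- The coefficient of the empty word. -/
def counit : QV →ₗ[ℚ] ℚ := wordBasis.coord 1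

/-- `(-1)^d v_{k_d} ⋯ v_{k_1}`: the value at `v_{k_1} ⋯ v_{k_d}` of the antipode `S` of the Hopf
algebra `ℚ⟨V⟩` with concatenation and shuffle coproduct. -/
def antiWord (k : List ℕ) : QV := (-1 : ℚ) ^ k.length • word k.reverse

/-- The shuffle of two words. -/
def shuffleWord : List ℕ → List ℕ → QV
  | [], w => word w
  | a :: u, [] => word (a :: u)
  | a :: u, b :: v =>
      word [a] * shuffleWord u (b :: v) + word [b] * shuffleWord (a :: u) v

/-- The shuffle product on `ℚ⟨V⟩`. -/
def shuffle : QV →ₗ[ℚ] QV →ₗ[ℚ] QV :=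
  wordBasis.constr ℚ fun u => wordBasis.constr ℚ fun v => shuffleWord u.toList v.toList

/-- The pairing `(A ∣ B)` for which the words are orthonormal. -/
def pairing : QV →ₗ[ℚ] QV →ₗ[ℚ] ℚ := wordBasis.constr ℚ fun w => wordBasis.coord w

/-- The pairing `(a₁ ⊗ a₂ ∣ b₁ ⊗ b₂) = (a₁ ∣ b₁) (a₂ ∣ b₂)` on tensor squares. -/
def tensorPairing {M N : Type} [AddCommGroup M] [Module ℚ M] [AddCommGroup N] [Module ℚ N]
    (B : M →ₗ[ℚ] N →ₗ[ℚ] ℚ) : M ⊗[ℚ] M →ₗ[ℚ] N ⊗[ℚ] N →ₗ[ℚ] ℚ :=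
  TensorProduct.dualDistrib ℚ N N ∘ₗ TensorProduct.map B B

/-! ### The extended post-Lie product and the Grossman-Larson product -/

/-- `A ↦ f(A₍₁₎) g(A₍₂₎)` in Sweedler's notation for the shuffle coproduct. -/
def conv (f g : QV →ₗ[ℚ] QV) : QV →ₗ[ℚ] QV :=
  LinearMap.mul' ℚ QV ∘ₗ TensorProduct.map f g ∘ₗ co.toLinearMap

/-- `ext` is an extension of the post-Lie product `tri` on `Lie(V)` to `U(Lie(V)) = ℚ⟨V⟩`:
for `x, y` in `Lie(V)` and `A, B, C` in `ℚ⟨V⟩`, it extends `tri` and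
`x ▷ 1 = 0`, `1 ▷ A = A`, `xA ▷ y = x ▷ (A ▷ y) - (x ▷ A) ▷ y`,
`A ▷ BC = (A₍₁₎ ▷ B) (A₍₂₎ ▷ C)`. -/
structure IsExtension (tri : LieV →ₗ[ℚ] LieV →ₗ[ℚ] LieV) (ext : QV →ₗ[ℚ] QV →ₗ[ℚ] QV) :
    Prop where
  ext_lie : ∀ x y : LieV, ext (lieToQV x) (lieToQV y) = lieToQV (tri x y)
  ext_one : ∀ x : LieV, ext (lieToQV x) 1 = 0
  one_ext : ∀ A : QV, ext 1 A = A
  mul_ext : ∀ (x : LieV) (A : QV) (y : LieV), ext (lieToQV x * A) (lieToQV y) =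
    ext (lieToQV x) (ext A (lieToQV y)) - ext (ext (lieToQV x) A) (lieToQV y)
  ext_mul : ∀ A B C : QV, ext A (B * C) = conv (ext.flip B) (ext.flip C) A

/-- The Grossman-Larson product `A ⊛ B = A₍₁₎ (A₍₂₎ ▷ B)`. -/
def glp (ext : QV →ₗ[ℚ] QV →ₗ[ℚ] QV) : QV →ₗ[ℚ] QV →ₗ[ℚ] QV :=
  LinearMap.mk₂ ℚ (fun A B => conv LinearMap.id (ext.flip B) A)
    (fun A A' B => map_add _ A A') (fun c A B => map_smul _ c A)
    (fun A B B' => by simp [conv, TensorProduct.map_add_right, LinearMap.add_comp,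
      LinearMap.comp_add])
    (fun c A B => by simp [conv, TensorProduct.map_smul_right, LinearMap.smul_comp])

/-! ### Explicit formulas -/

/-- The pairs `(u, v)`, with repetitions, of complementary subwords of `w`:
`co w = ∑ u ⊗ v`, see `co_word`. -/
def splits : List ℕ → List (List ℕ × List ℕ)
  | [] => [([], [])]
  | a :: w => (splits w).map (fun p => (a :: p.1, p.2)) ++ (splits w).map (fun p => (p.1, a :: p.2))

theorem word_cons (a : ℕ) (w : List ℕ) : word (a :: w) = word [a] * word w := by
  simp only [word, MonoidAlgebra.single_mul_single, mul_one]
  rfl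

theorem co_letter (a : ℕ) : co (word [a]) = word [a] ⊗ₜ[ℚ] 1 + 1 ⊗ₜ[ℚ] word [a] := by
  rw [co, word, MonoidAlgebra.lift_single, one_smul]
  exact FreeMonoid.lift_eval_of _ a

theorem co_word (w : List ℕ) :
    co (word w) = ((splits w).map fun p => word p.1 ⊗ₜ[ℚ] word p.2).sum := by
  induction w with
  | nil =>
    have h : word [] = 1 := rfl
    simp only [splits, List.map_cons, List.map_nil, List.sum_singleton, h, map_one]
    rfl
  | cons a w ih =>
    have h : ∀ u, word [a] * word u = word (a :: u) := fun u => (word_cons a u).symm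
    rw [word_cons, map_mul, ih, co_letter, add_mul, ← List.sum_map_mul_left,
      ← List.sum_map_mul_left]
    simp only [splits, List.map_append, List.sum_append, List.map_map, Function.comp_def,
      Algebra.TensorProduct.tmul_mul_tmul, one_mul, h]

/-- The summands `A₍₁₎ ⊗ ⋯ ⊗ A₍ₙ₊₁₎` of the `n`-fold iterated shuffle coproduct of a word. -/
def sweedler : ℕ → List ℕ → List (List (List ℕ))
  | 0, w => [[w]]
  | n + 1, w => (splits w).flatMap fun p => (sweedler n p.2).map fun t => p.1 :: t

/-- The word `v_0^{m_0} v_{i_1} v_0^{m_1} ⋯ v_{i_d} v_0^{m_d}` given by `m_0` and the list of the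
pairs `(i_j, m_j)`. -/
def blockWord (m₀ : ℕ) (b : List (ℕ × ℕ)) : List ℕ :=
  List.replicate m₀ 0 ++ b.flatMap fun p => p.1 :: List.replicate p.2 0

/-- The product over `j = 1, …, d` of
`S(l_{2j}) v_{i_j + |k_{2j} + k_{2j+1}| - |l_{2j} + l_{2j+1}|} l_{2j+1} v_0^{m_j}`, where
`K = [k_2, …, k_{2d+1}]` and `L = [l_2, …, l_{2d+1}]`. -/
def glpBlocks : List (ℕ × ℕ) → List (List ℕ) → List (List ℕ) → QV
  | p :: b, k :: k' :: K, l :: l' :: L =>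
      antiWord l * word [p.1 + ((k.sum + k'.sum) - (l.sum + l'.sum))] * word l' *
        word (List.replicate p.2 0) * glpBlocks b K L
  | _, _, _ => 1

/-- The explicit expression for the Grossman-Larson product of the word `A` with the word
`v_0^{m_0} v_{i_1} v_0^{m_1} ⋯ v_{i_d} v_0^{m_d}`: the sum over the summands
`A₍₁₎ ⊗ ⋯ ⊗ A₍₂d₊₁₎` of the iterated coproduct of `A`, with `A₍ⱼ₎ = A₍ⱼ₎(k_j)`, and over all
`l_2 ≤ k_2, …, l_{2d+1} ≤ k_{2d+1}`, of `∏ m_{k_j,l_j}` times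
`A₍₁₎ v_0^{m_0} S(A₍₂₎(l_2)) v_{i_1 + |k_2+k_3| - |l_2+l_3|} A₍₃₎(l_3) v_0^{m_1} ⋯`. -/
def glpFormula (A : List ℕ) (m₀ : ℕ) (b : List (ℕ × ℕ)) : QV :=
  ((sweedler (2 * b.length) A).map fun t =>
    ((t.tail.map below).sections.map fun L =>
      (List.zipWith mult t.tail L).prod •
        (word (t.headD []) * word (List.replicate m₀ 0) * glpBlocks b t.tail L)).sum).sum

/-- All ways to cut a word into a (possibly empty) sequence of nonempty words. -/
def blockings : List ℕ → List (List (List ℕ))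
  | [] => [[]]
  | a :: w => (blockings w).flatMap fun B =>
      match B with
      | [] => [[[a]]]
      | u :: B' => [[a] :: u :: B', (a :: u) :: B']

/-- All ways `(P, c, Q)` to mark a letter `c` of a word: `w = P c Q`. -/
def marked : List ℕ → List (List ℕ × ℕ × List ℕ)
  | [] => []
  | a :: w => ([], a, w) :: (marked w).map fun p => (a :: p.1, p.2)

/-- All decompositions of a word as `A₀ (P_1 c_1 Q_1) ⋯ (P_n c_n Q_n)` with words `A₀, P_s, Q_s` and
letters `c_s`. For the word `v_{k_1} ⋯ v_{k_d}`, these correspond to the sequences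
`0 ≤ i_1 < j_1 ≤ i_2 < j_2 ≤ ⋯ ≤ i_n < j_n ≤ d`: `A₀` has the letters at positions `1, …, i_1`, `P_s`
those at `i_s + 1, …, j_s - 1`, `c_s` is at position `j_s`, and `Q_s` has those at
`j_s + 1, …, i_{s+1}`, where `i_{n+1} = d`. -/
def decompositions (w : List ℕ) : List (List ℕ × List (List ℕ × ℕ × List ℕ)) :=
  (List.range (w.length + 1)).flatMap fun i =>
    (blockings (w.drop i)).flatMap fun B => ((B.map marked).sections).map fun D => (w.take i, D)

/-- The indices `𝐥_s = (p, q)` allowed for a block `P c Q`: the entries of `p` and `q` correspond to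
the letters of `P` and `Q`, and `𝐥_s` is empty or `|𝐥_s| ≤ c - 1` in `ℤ`. -/
def shifts (D : List ℕ × ℕ × List ℕ) : List (List ℕ × List ℕ) :=
  (below (List.replicate D.1.length D.2.1) ×ˢ below (List.replicate D.2.2.length D.2.1)).filter
    fun l => (D.1 = [] ∧ D.2.2 = []) ∨ l.1.sum + l.2.sum + 1 ≤ D.2.1

/-- The product of the multiplicities `m_{P_s + p_s, P_s} m_{Q_s + q_s, Q_s}`. -/
def coprodCoeff (D : List (List ℕ × ℕ × List ℕ)) (L : List (List ℕ × List ℕ)) : ℚ :=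
  (List.zipWith (fun d l => mult (addIdx d.1 l.1) d.1 * mult (addIdx d.2.2 l.2) d.2.2) D L).prod

/-- The left tensor factor: the shuffle product of `A₀` and of all `S(P_s + p_s)`, `Q_s + q_s`. -/
def coprodLeft (A₀ : List ℕ) (D : List (List ℕ × ℕ × List ℕ)) (L : List (List ℕ × List ℕ)) : QV :=
  (List.zipWith (fun d l => shuffle (antiWord (addIdx d.1 l.1)) (word (addIdx d.2.2 l.2)))
    D L).foldl (fun x y => shuffle x y) (word A₀)

/-- The right tensor factor: the word with the letters `v_{c_s - |𝐥_s|}`. -/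
def coprodRight (D : List (List ℕ × ℕ × List ℕ)) (L : List (List ℕ × List ℕ)) : QV :=
  word (List.zipWith (fun d l => d.2.1 - (l.1.sum + l.2.sum)) D L)

/-- The explicit expression for the coproduct of a word. -/
def coprodFormula (w : List ℕ) : QV ⊗[ℚ] QV :=
  ((decompositions w).map fun D =>
    ((D.2.map shifts).sections.map fun L =>
      coprodCoeff D.2 L • (coprodLeft D.1 D.2 L ⊗ₜ[ℚ] coprodRight D.2 L)).sum).sum

/-! ### Graded Hopf algebras and graded duality -/

/-- The operations of a Hopf algebra on a given vector space (without laws, see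
`HopfOps.IsHopfAlgebra`). -/
structure HopfOps (M : Type) [AddCommGroup M] [Module ℚ M] where
  mul : M →ₗ[ℚ] M →ₗ[ℚ] M
  one : M
  comul : M →ₗ[ℚ] M ⊗[ℚ] M
  counit : M →ₗ[ℚ] ℚ
  antipode : M →ₗ[ℚ] M

variable {M N : Type} [AddCommGroup M] [Module ℚ M] [AddCommGroup N] [Module ℚ N]

/-- The given operations make `M` a Hopf algebra over `ℚ`. -/
def HopfOps.IsHopfAlgebra (H : HopfOps M) : Prop :=
  ∃ (A : Type) (_ : Ring A) (_ : HopfAlgebra ℚ A) (e : A ≃ₗ[ℚ] M),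
    (∀ a b : A, e (a * b) = H.mul (e a) (e b)) ∧
    e 1 = H.one ∧
    (∀ a : A, H.comul (e a) = TensorProduct.map e.toLinearMap e.toLinearMap
      (Coalgebra.comul (R := ℚ) a)) ∧
    (∀ a : A, H.counit (e a) = Coalgebra.counit (R := ℚ) a) ∧
    (∀ a : A, H.antipode (e a) = e (HopfAlgebra.antipode ℚ a))

/-- The degree `n` part `∑_{i+j=n} G_i ⊗ G_j` of the tensor square of a graded vector space. -/
def tensorGrade (G : ℕ → Submodule ℚ M) (n : ℕ) : Submodule ℚ (M ⊗[ℚ] M) :=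
  ⨆ (i : ℕ) (j : ℕ) (_ : i + j = n),
    LinearMap.range (TensorProduct.map (G i).subtype (G j).subtype)

/-- The given operations make `M` a Hopf algebra graded by `M = ⨁ G n`. -/
structure HopfOps.IsGradedHopfAlgebra (H : HopfOps M) (G : ℕ → Submodule ℚ M) : Prop where
  isHopf : H.IsHopfAlgebra
  internal : DirectSum.IsInternal G
  mul_mem : ∀ {m n : ℕ} {x y : M}, x ∈ G m → y ∈ G n → H.mul x y ∈ G (m + n)
  one_mem : H.one ∈ G 0
  comul_mem : ∀ {n : ℕ} {x : M}, x ∈ G n → H.comul x ∈ tensorGrade G n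
  counit_eq_zero : ∀ {n : ℕ} {x : M}, n ≠ 0 → x ∈ G n → H.counit x = 0
  antipode_mem : ∀ {n : ℕ} {x : M}, x ∈ G n → H.antipode x ∈ G n

/-- `B` is a graded duality pairing of `(M, G)` and `(N, G')` (a non-degenerate pairing of graded
vector spaces with finite-dimensional pieces, for which pieces of different degrees are orthogonal),
and the operations of `H` and `H'` are dual to each other with respect to `B`. -/
structure IsGradedDual (B : M →ₗ[ℚ] N →ₗ[ℚ] ℚ) (G : ℕ → Submodule ℚ M) (G' : ℕ → Submodule ℚ N)
    (H : HopfOps M) (H' : HopfOps N) : Prop where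
  finite_left : ∀ n, Module.Finite ℚ (G n)
  finite_right : ∀ n, Module.Finite ℚ (G' n)
  separatingLeft : B.SeparatingLeft
  separatingRight : B.SeparatingRight
  orthogonal : ∀ {m n : ℕ} {x : M} {y : N}, m ≠ n → x ∈ G m → y ∈ G' n → B x y = 0
  mul_comul : ∀ (x y : M) (z : N), B (H.mul x y) z = tensorPairing B (x ⊗ₜ[ℚ] y) (H'.comul z)
  comul_mul : ∀ (x : M) (y z : N), B x (H'.mul y z) = tensorPairing B (H.comul x) (y ⊗ₜ[ℚ] z)
  one_counit : ∀ z : N, B H.one z = H'.counit z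
  counit_one : ∀ x : M, B x H'.one = H.counit x
  antipode : ∀ (x : M) (z : N), B (H.antipode x) z = B x (H'.antipode z)

end

end AriHopf

open AriHopf

/-!
If `v_k` with `k ≥ 1` is read as the monomial `x^{k-1}`, then the multiplicities `m_{𝐤,𝐥}` are the
coefficients of the translation `x ↦ x - X` in all letters of a word. It is an algebra morphism
`shift : ℚ⟨V⟩ → ℚ⟨V⟩[X]`. With `shift A = ∑ A_j X^j`, the product on letters is
`A ▷ v_0 = ε(A) v_0` and `A ▷ v_s = ∑_j S(A_{j,(1)}) v_{s+j} A_{j,(2)}` for `s ≥ 1`, where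
`S(A₍₁₎) B A₍₂₎` is the right adjoint action `adj A B`; for a Lie monomial `A` this is the definition
on the magma (`lieToQV_toLie_triTree`). Distributing over the letters of a word with the shuffle
coproduct gives a bilinear map `triExt` on all of `ℚ⟨V⟩`, for which the rule
`xA ▷ B = x ▷ (A ▷ B) - (x ▷ A) ▷ B` (`triExt_lie_mul`) is the only one that is not immediate.

On letters, this rule holds because `shift` is multiplicative, `adj` is a right action, and the
derivation `x ▷` commutes with the coefficients of `shift`. In characteristic zero, these
coefficients are the divided powers of the derivation `shiftDer : v_k ↦ -(k-1) v_{k-1}`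
(`coeffMap_shift`), so that only `shiftDer (A ▷ B) = A ▷ shiftDer B` (`shiftDer_triExt`) is needed.
Both sides of the rule are then compared on products of letters.

Since `x ▷` is a derivation that preserves Lie elements, it preserves the filtration of `ℚ⟨V⟩` by
the number of Lie factors. Induction along this filtration (`lie_filtration_induction`) gives the
uniqueness of the extension, the associativity of the Grossman-Larson product and its compatibility
with the shuffle coproduct. The Dynkin operator shows that `Lie(V)` embeds into `ℚ⟨V⟩`
(`lieToQV_injective`), and so the post-Lie structure is the restriction of `triExt`.

The antipode of the Grossman-Larson Hopf algebra is a geometric series in a convolution algebra.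
As the weight pieces are spanned by finitely many words, the coproduct `Δ_a` and the other antipode
are transposes, and the laws of the second Hopf algebra are dual to those of the first
(`HopfOps.Laws.dual`).

The formula for the Grossman-Larson product comes from expanding `shift` and `adj` on words. For the
coproduct, the adjoint of the action on a letter is computed (`letterAdjoint`): lowering letters is
adjoint to raising them (`sum_below_eq_sum_raise`), inserting a letter between two words is adjoint
to marking a letter, and unshuffling is adjoint to the shuffle product. The action on a word is a
convolution of actions on letters, whose adjoint is deconcatenation followed by the shuffle product
(`pairing_conv`); this produces the sum over decompositions into blocks.
-/

namespace AriHopf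

noncomputable section

attribute [local instance] LieRing.ofAssociativeRing LieAlgebra.ofAssociativeAlgebra

/-! ### Words and convolution -/

theorem word_nil : word [] = 1 := rfl

theorem word_append (u v : List ℕ) : word (u ++ v) = word u * word v := by
  simp only [word, MonoidAlgebra.single_mul_single, mul_one]
  rfl

theorem wordBasis_apply (w : FreeMonoid ℕ) : wordBasis w = word w.toList :=
  MonoidAlgebra.basis_apply _ _

theorem linearMap_ext_word {N : Type*} [AddCommMonoid N] [Module ℚ N] {f g : QV →ₗ[ℚ] N}
    (h : ∀ w : List ℕ, f (word w) = g (word w)) : f = g :=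
  wordBasis.ext fun w => by rw [wordBasis_apply]; exact h _

theorem word_induction {p : QV → Prop} (word : ∀ w, p (word w))
    (add : ∀ A B, p A → p B → p (A + B)) (smul : ∀ (c : ℚ) A, p A → p (c • A)) (A : QV) : p A := by
  have h0 : p 0 := by simpa using smul 0 _ (word [])
  have hA : A ∈ Submodule.span ℚ (Set.range wordBasis) := by
    rw [wordBasis.span_eq]; trivial
  induction hA using Submodule.span_induction with
  | mem x hx => obtain ⟨w, rfl⟩ := hx; rw [wordBasis_apply]; exact word _
  | zero => exact h0
  | add x y _ _ hx hy => exact add x y hx hy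
  | smul c x _ hx => exact smul c x hx

theorem letter_induction {p : QV → Prop} (one : p 1)
    (letter_mul : ∀ a A, p A → p (word [a] * A))
    (add : ∀ A B, p A → p B → p (A + B)) (smul : ∀ (c : ℚ) A, p A → p (c • A)) (A : QV) : p A := by
  refine word_induction (fun w => ?_) add smul A
  induction w with
  | nil => exact one
  | cons a w ih => rw [word_cons]; exact letter_mul a _ ih

theorem wordBasis_repr_word (w : List ℕ) (u : FreeMonoid ℕ) :
    wordBasis.repr (word w) u = if w = u.toList then 1 else 0 := by
  have h : word w = wordBasis (FreeMonoid.ofList w) := (wordBasis_apply _).symm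
  classical
  rw [h, Module.Basis.repr_self, Finsupp.single_apply]
  exact if_congr Iff.rfl rfl rfl

theorem counit_word (w : List ℕ) : counit (word w) = if w = [] then 1 else 0 :=
  wordBasis_repr_word w 1

theorem counit_one : counit 1 = 1 := by
  rw [← word_nil, counit_word, if_pos rfl]

theorem counit_letter_mul (a : ℕ) (A : QV) : counit (word [a] * A) = 0 := by
  induction A using word_induction with
  | word w => rw [← word_cons, counit_word, if_neg (List.cons_ne_nil _ _)]
  | add A B hA hB => rw [mul_add, map_add, hA, hB, add_zero]
  | smul c A hA => rw [mul_smul_comm, map_smul, hA, smul_zero]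

theorem counit_letter (a : ℕ) : counit (word [a]) = 0 := by
  simpa using counit_letter_mul a 1

theorem counit_mul (A B : QV) : counit (A * B) = counit A * counit B := by
  induction A using letter_induction with
  | one => rw [one_mul, counit_one, one_mul]
  | letter_mul a A _ => rw [mul_assoc, counit_letter_mul, counit_letter_mul, zero_mul]
  | add A B hA hB => rw [add_mul, map_add, hA, hB, map_add, add_mul]
  | smul c A hA => rw [smul_mul_assoc, map_smul, hA, map_smul, smul_mul_assoc]

theorem length_of_mem_splits {w : List ℕ} {p : List ℕ × List ℕ} (hp : p ∈ splits w) :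
    p.1.length + p.2.length = w.length := by
  induction w generalizing p with
  | nil =>
    rw [splits, List.mem_singleton] at hp
    rw [hp]; rfl
  | cons a w ih =>
    simp only [splits, List.mem_append, List.mem_map] at hp
    rcases hp with ⟨q, hq, rfl⟩ | ⟨q, hq, rfl⟩ <;>
      simp only [List.length_cons] <;> have := ih hq <;> omega

section Conv

variable (f f' g g' h : QV →ₗ[ℚ] QV)

theorem conv_add_left : conv (f + f') g = conv f g + conv f' g := by
  simp [conv, TensorProduct.map_add_left, LinearMap.add_comp, LinearMap.comp_add]

theorem conv_add_right : conv f (g + g') = conv f g + conv f g' := by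
  simp [conv, TensorProduct.map_add_right, LinearMap.add_comp, LinearMap.comp_add]

theorem conv_smul_left (c : ℚ) : conv (c • f) g = c • conv f g := by
  simp [conv, TensorProduct.map_smul_left, LinearMap.smul_comp, LinearMap.comp_smul]

theorem conv_smul_right (c : ℚ) : conv f (c • g) = c • conv f g := by
  simp [conv, TensorProduct.map_smul_right, LinearMap.smul_comp, LinearMap.comp_smul]

theorem conv_sub_left : conv (f - f') g = conv f g - conv f' g :=
  eq_sub_of_add_eq (by rw [← conv_add_left, sub_add_cancel])

theorem conv_sub_right : conv f (g - g') = conv f g - conv f g' :=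
  eq_sub_of_add_eq (by rw [← conv_add_right, sub_add_cancel])

theorem conv_word (w : List ℕ) :
    conv f g (word w) = ((splits w).map fun p => f (word p.1) * g (word p.2)).sum := by
  rw [conv, LinearMap.comp_apply, LinearMap.comp_apply, AlgHom.toLinearMap_apply, co_word,
    map_list_sum, map_list_sum, List.map_map, List.map_map]
  rfl

theorem conv_one : conv f g 1 = f 1 * g 1 := by
  rw [← word_nil, conv_word]; simp [splits]

/-- The primitive elements of the shuffle coproduct. -/
def IsPrimitive (x : QV) : Prop := co x = x ⊗ₜ[ℚ] 1 + 1 ⊗ₜ[ℚ] x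

variable {f g}

theorem isPrimitive_letter (a : ℕ) : IsPrimitive (word [a]) := co_letter a

/-- The coproduct rule for left multiplication by a primitive element. -/
theorem conv_primitive_mul {x : QV} (hx : IsPrimitive x) (A : QV) :
    conv f g (x * A) =
      conv (f ∘ₗ LinearMap.mulLeft ℚ x) g A + conv f (g ∘ₗ LinearMap.mulLeft ℚ x) A := by
  simp only [conv, LinearMap.comp_apply, AlgHom.toLinearMap_apply, map_mul]
  rw [show co x = _ from hx]
  induction co A using TensorProduct.induction_on with
  | zero => simp
  | tmul u v => simp [add_mul, Algebra.TensorProduct.tmul_mul_tmul]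
  | add s t hs ht =>
    rw [mul_add, map_add, map_add, hs, ht]
    simp only [map_add]
    abel

theorem conv_primitive {x : QV} (hx : IsPrimitive x) : conv f g x = f x * g 1 + f 1 * g x := by
  have h := conv_primitive_mul (f := f) (g := g) hx 1
  simpa [conv_one] using h

variable (f g)

/-- Coassociativity of the shuffle coproduct, in terms of convolution. -/
theorem conv_assoc : conv (conv f g) h = conv f (conv g h) := by
  refine LinearMap.ext fun A => ?_
  induction A using letter_induction generalizing f g h with
  | one => simp only [conv_one, mul_assoc]
  | letter_mul a A ih =>
    have key : ∀ f g : QV →ₗ[ℚ] QV, conv f g ∘ₗ LinearMap.mulLeft ℚ (word [a]) =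
        conv (f ∘ₗ LinearMap.mulLeft ℚ (word [a])) g +
          conv f (g ∘ₗ LinearMap.mulLeft ℚ (word [a])) := fun f g =>
      LinearMap.ext fun B => conv_primitive_mul (isPrimitive_letter a) B
    rw [conv_primitive_mul (isPrimitive_letter a), conv_primitive_mul (isPrimitive_letter a), key,
      key, conv_add_left, conv_add_right, LinearMap.add_apply, LinearMap.add_apply, ih, ih, ih,
      add_assoc]
  | add A B hA hB => rw [map_add, hA, hB, map_add]
  | smul c A hA => rw [map_smul, hA, map_smul]

/-- `A ↦ ε(A) 1`, the unit for `conv`. -/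
def counitOne : QV →ₗ[ℚ] QV := counit.smulRight 1

theorem counitOne_apply (A : QV) : counitOne A = counit A • 1 := rfl

theorem counitOne_comp_letter (a : ℕ) : counitOne ∘ₗ LinearMap.mulLeft ℚ (word [a]) = 0 := by
  refine LinearMap.ext fun A => ?_
  simp [counitOne_apply, counit_letter_mul]

theorem conv_zero_left : conv 0 g = 0 := by simp [conv]

theorem conv_zero_right : conv f 0 = 0 := by simp [conv]

theorem counitOne_conv : conv counitOne g = g := by
  refine LinearMap.ext fun A => ?_
  induction A using letter_induction generalizing g with
  | one => simp [conv_one, counitOne_apply, counit_one]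
  | letter_mul a A ih =>
    rw [conv_primitive_mul (isPrimitive_letter a), counitOne_comp_letter, conv_zero_left, ih]
    simp
  | add A B hA hB => rw [map_add, hA, hB, map_add]
  | smul c A hA => rw [map_smul, hA, map_smul]

theorem conv_counitOne : conv f counitOne = f := by
  refine LinearMap.ext fun A => ?_
  induction A using letter_induction generalizing f with
  | one => simp [conv_one, counitOne_apply, counit_one]
  | letter_mul a A ih =>
    rw [conv_primitive_mul (isPrimitive_letter a), counitOne_comp_letter, conv_zero_right, ih]
    simp
  | add A B hA hB => rw [map_add, hA, hB, map_add]
  | smul c A hA => rw [map_smul, hA, map_smul]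

end Conv

/-! ### Lie elements -/

/-- The Lie elements of `ℚ⟨V⟩`: the image of `Lie(V)`. -/
def lieElements : LieSubalgebra ℚ QV := lieToQV.range

theorem lieToQV_mem (x : LieV) : lieToQV x ∈ lieElements := ⟨x, rfl⟩

theorem toLie_of (i : ℕ) : toLie (tree (.of i)) = FreeLieAlgebra.of ℚ i := rfl

theorem tree_mul (t u : FreeMagma ℕ) : tree (.mul t u) = tree t * tree u := by
  simp only [tree, MonoidAlgebra.single_mul_single, mul_one]
  rfl

theorem toLie_mul (x y : MQ) : toLie (x * y) = ⁅toLie x, toLie y⁆ := rfl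

/-- `M(V)_ℚ → Lie(V)` as a linear map. -/
def toLieLinear : MQ →ₗ[ℚ] LieV where
  toFun := toLie
  map_add' _ _ := rfl
  map_smul' _ _ := rfl

theorem toLie_surjective (x : LieV) : ∃ y, toLie y = x := Quot.exists_rep x

theorem tree_induction {p : MQ → Prop} (tree : ∀ t, p (tree t))
    (add : ∀ A B, p A → p B → p (A + B)) (smul : ∀ (c : ℚ) A, p A → p (c • A)) (A : MQ) : p A := by
  have hA : A ∈ Submodule.span ℚ (Set.range (MonoidAlgebra.basis (FreeMagma ℕ) ℚ)) := by
    rw [Module.Basis.span_eq]; trivial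
  induction hA using Submodule.span_induction with
  | mem x hx => obtain ⟨w, rfl⟩ := hx; rw [MonoidAlgebra.basis_apply]; exact tree _
  | zero => simpa using smul 0 _ (tree (.of 0))
  | add x y _ _ hx hy => exact add x y hx hy
  | smul c x _ hx => exact smul c x hx

theorem lie_tree_induction {p : LieV → Prop} (tree : ∀ t, p (toLie (tree t)))
    (add : ∀ A B, p A → p B → p (A + B)) (smul : ∀ (c : ℚ) A, p A → p (c • A)) (x : LieV) :
    p x := by
  obtain ⟨y, rfl⟩ := toLie_surjective x
  induction y using tree_induction with
  | tree t => exact tree t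
  | add A B hA hB => exact add _ _ hA hB
  | smul c A hA => exact smul _ _ hA

theorem lie_induction {p : LieV → Prop} (of : ∀ i, p (FreeLieAlgebra.of ℚ i))
    (lie : ∀ x y, p x → p y → p ⁅x, y⁆)
    (add : ∀ A B, p A → p B → p (A + B)) (smul : ∀ (c : ℚ) A, p A → p (c • A)) (x : LieV) :
    p x := by
  refine lie_tree_induction (fun t => ?_) add smul x
  induction t using FreeMagma.rec with
  | of i => exact of i
  | mul t u ht hu => rw [tree_mul, toLie_mul]; exact lie _ _ ht hu

theorem lieToQV_of (i : ℕ) : lieToQV (FreeLieAlgebra.of ℚ i) = word [i] :=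
  FreeLieAlgebra.lift_of_apply _ _

theorem lieToQV_lie (x y : LieV) :
    lieToQV ⁅x, y⁆ = lieToQV x * lieToQV y - lieToQV y * lieToQV x := by
  rw [LieHom.map_lie, LieRing.of_associative_ring_bracket]

theorem letter_mem_lieElements (i : ℕ) : word [i] ∈ lieElements := ⟨_, lieToQV_of i⟩

theorem commutator_mem_lieElements {x y : QV} (hx : x ∈ lieElements) (hy : y ∈ lieElements) :
    x * y - y * x ∈ lieElements := by
  rw [← LieRing.of_associative_ring_bracket]; exact lieElements.lie_mem hx hy

theorem isPrimitive_of_mem {x : QV} (hx : x ∈ lieElements) : IsPrimitive x := by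
  obtain ⟨x, rfl⟩ := hx
  change IsPrimitive (lieToQV x)
  unfold IsPrimitive
  induction x using lie_induction with
  | of i => rw [lieToQV_of]; exact co_letter i
  | lie x y hx hy =>
    rw [lieToQV_lie, map_sub, map_mul, map_mul, hx, hy]
    simp only [add_mul, mul_add, Algebra.TensorProduct.tmul_mul_tmul, mul_one, one_mul,
      TensorProduct.sub_tmul, TensorProduct.tmul_sub]
    abel
  | add x y hx hy =>
    rw [map_add, map_add, hx, hy, TensorProduct.add_tmul, TensorProduct.tmul_add]; abel
  | smul c x hx =>
    rw [map_smul, map_smul, hx, smul_add, TensorProduct.smul_tmul', TensorProduct.tmul_smul]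

theorem counit_of_mem {x : QV} (hx : x ∈ lieElements) : counit x = 0 := by
  obtain ⟨x, rfl⟩ := hx
  change counit (lieToQV x) = 0
  induction x using lie_induction with
  | of i => rw [lieToQV_of, counit_letter]
  | lie x y hx hy => rw [lieToQV_lie, map_sub, counit_mul, counit_mul, hx, hy]; simp
  | add x y hx hy => rw [map_add, map_add, hx, hy, add_zero]
  | smul c x hx => rw [map_smul, map_smul, hx, smul_zero]

/-! ### Translation of letters -/

open Polynomial in
/-- The image `∑_l m_{k,l} v_l X^{k-l}` of the letter `v_k` under translation by `X`. -/
def shiftLetter (k : ℕ) : QV[X] :=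
  ∑ l ∈ Finset.range (k + 1), mult₁ k l • monomial (k - l) (word [l])

open Polynomial in
/-- The algebra morphism `ℚ⟨V⟩ → ℚ⟨V⟩[X]`, `v_k ↦ ∑_l m_{k,l} v_l X^{k-l}`. If `v_k` with `k ≥ 1` is
read as the monomial `x^{k-1}`, then it is the substitution `x ↦ x - X` in every letter. -/
def shift : QV →ₐ[ℚ] QV[X] :=
  MonoidAlgebra.lift ℚ QV[X] (FreeMonoid ℕ) (FreeMonoid.lift shiftLetter)

theorem shift_letter (k : ℕ) : shift (word [k]) = shiftLetter k := by
  rw [shift, word, MonoidAlgebra.lift_single, one_smul]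
  exact FreeMonoid.lift_eval_of _ k

/-- The map `ℚ⟨V⟩[X] → ℚ⟨V⟩[X]` which applies a linear map to every coefficient. -/
def coeffMap (d : QV →ₗ[ℚ] QV) : Polynomial QV →ₗ[ℚ] Polynomial QV :=
  Polynomial.lsum fun j => (Polynomial.monomial j).restrictScalars ℚ ∘ₗ d

theorem coeffMap_monomial (d : QV →ₗ[ℚ] QV) (j : ℕ) (A : QV) :
    coeffMap d (Polynomial.monomial j A) = Polynomial.monomial j (d A) := by
  simp [coeffMap, Polynomial.lsum, Polynomial.sum_monomial_index]

theorem coeff_coeffMap (d : QV →ₗ[ℚ] QV) (P : Polynomial QV) (j : ℕ) :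
    (coeffMap d P).coeff j = d (P.coeff j) := by
  induction P using Polynomial.induction_on' with
  | add P Q hP hQ => rw [map_add, Polynomial.coeff_add, hP, hQ, Polynomial.coeff_add, map_add]
  | monomial n A =>
    rw [coeffMap_monomial, Polynomial.coeff_monomial, Polynomial.coeff_monomial]
    split_ifs <;> simp

theorem coeff_zero_shift (A : QV) : (shift A).coeff 0 = A := by
  induction A using letter_induction with
  | one => simp
  | letter_mul k A ih =>
    rw [map_mul, Polynomial.mul_coeff_zero, ih, shift_letter, shiftLetter,
      Polynomial.finsetSum_coeff, Finset.sum_eq_single k]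
    · rcases k with _ | k <;> simp [mult₁, ← two_mul]
    · intro l hl hlk
      have : k - l ≠ 0 := by have := Finset.mem_range.mp hl; omega
      simp [Polynomial.coeff_monomial, this]
    · simp
  | add A B hA hB => rw [map_add, Polynomial.coeff_add, hA, hB]
  | smul c A hA => rw [map_smul, Polynomial.coeff_smul, hA]

/-- The derivation `v_k ↦ -(k-1) v_{k-1}` (and `v_0, v_1 ↦ 0`), which generates the translations. -/
def shiftDer : QV →ₗ[ℚ] QV where
  toFun A := (shift A).coeff 1
  map_add' A B := by simp
  map_smul' c A := by simp

theorem shiftDer_apply (A : QV) : shiftDer A = (shift A).coeff 1 := rfl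

theorem shiftDer_mul (A B : QV) : shiftDer (A * B) = shiftDer A * B + A * shiftDer B := by
  rw [shiftDer_apply, map_mul, Polynomial.mul_coeff_one, coeff_zero_shift, coeff_zero_shift,
    add_comm]
  rfl

theorem shiftDer_letter_zero : shiftDer (word [0]) = 0 := by
  simp [shiftDer_apply, shift_letter, shiftLetter]

theorem shiftDer_letter_succ (k : ℕ) : shiftDer (word [k + 1]) = -(k : ℚ) • word [k] := by
  rw [shiftDer_apply, shift_letter, shiftLetter, Polynomial.finsetSum_coeff,
    Finset.sum_eq_single k]
  · have h : k + 1 - k = 1 := by omega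
    rw [h, Polynomial.coeff_smul, Polynomial.coeff_monomial, if_pos rfl]
    congr 1
    rcases k with _ | k
    · simp [mult₁]
    · simp only [mult₁, Nat.succ_ne_zero, and_self, or_self, if_false, Nat.add_sub_cancel]
      rw [show k + 1 + 1 + (k + 1) = 2 * (k + 1) + 1 by ring, pow_succ, pow_mul]
      simp
  · intro l hl hlk
    have : k + 1 - l ≠ 1 := by have := Finset.mem_range.mp hl; omega
    simp [Polynomial.coeff_monomial, this]
  · simp

/-- The recursion of the multiplicities that makes `∂/∂X` of a translate the translate of the
derivation `shiftDer`. -/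
theorem mult₁_derivative {k l : ℕ} (h : l ≤ k) :
    mult₁ (k + 1) l * ((k + 1 - l : ℕ) : ℚ) = -(k : ℚ) * mult₁ k l := by
  rcases l with _ | l
  · rcases k with _ | k <;> simp [mult₁]
  · obtain ⟨k, rfl⟩ : ∃ m, k = m + 1 := ⟨k - 1, by omega⟩
    have h1 : ((k + 1).choose l : ℚ) * ((k + 1 - l : ℕ) : ℚ) = (k + 1) * k.choose l := by
      rw [mul_comm ((k : ℚ) + 1)]
      exact_mod_cast (Nat.choose_mul_succ_eq k l).symm
    simp only [mult₁, Nat.succ_ne_zero, and_self, or_self, if_false, Nat.add_sub_cancel,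
      Nat.add_sub_add_right]
    rw [mul_assoc, h1, show k + 1 + 1 + (l + 1) = (k + 1 + (l + 1)) + 1 by ring, pow_succ]
    push_cast
    ring

theorem derivative_shift_letter (k : ℕ) :
    Polynomial.derivative (shift (word [k])) = shift (shiftDer (word [k])) := by
  rcases k with _ | k
  · rw [shiftDer_letter_zero, shift_letter, shiftLetter]; simp
  · rw [shiftDer_letter_succ, map_smul, shift_letter, shift_letter, shiftLetter, shiftLetter,
      Finset.sum_range_succ, Finset.smul_sum, map_add, map_sum]
    have h0 : Polynomial.derivative (mult₁ (k + 1) (k + 1) •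
        Polynomial.monomial (k + 1 - (k + 1)) (word [k + 1])) = 0 := by simp
    rw [h0, add_zero]
    refine Finset.sum_congr rfl fun l hl => ?_
    have hl' : l ≤ k := Nat.lt_succ_iff.mp (Finset.mem_range.mp hl)
    have e : (word [l] * ((k + 1 - l : ℕ) : QV)) = ((k + 1 - l : ℕ) : ℚ) • word [l] := by
      rw [← nsmul_eq_mul', Nat.cast_smul_eq_nsmul]
    rw [Polynomial.derivative_smul, Polynomial.derivative_monomial, e, smul_smul,
      ← mult₁_derivative hl', mul_smul, show k + 1 - l - 1 = k - l by omega,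
      Polynomial.smul_monomial, Polynomial.smul_monomial,
      Polynomial.smul_monomial]

/-- The translations form the one-parameter family generated by `shiftDer`. -/
theorem derivative_shift (A : QV) : Polynomial.derivative (shift A) = shift (shiftDer A) := by
  induction A using letter_induction with
  | one =>
    have : shiftDer 1 = 0 := by simp [shiftDer_apply, Polynomial.coeff_one]
    simp [this]
  | letter_mul k A ih =>
    rw [map_mul, Polynomial.derivative_mul, ih, shiftDer_mul, map_add, map_mul, map_mul,
      derivative_shift_letter]
  | add A B hA hB => rw [map_add, map_add, map_add, hA, hB, map_add]
  | smul c A hA =>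
    rw [map_smul shift, Polynomial.derivative_smul, hA, map_smul shiftDer, map_smul shift]

/-- A linear map that commutes with the generator of the translations commutes with them. -/
theorem coeffMap_shift {d : QV →ₗ[ℚ] QV} (hd : ∀ A, shiftDer (d A) = d (shiftDer A)) (A : QV) :
    coeffMap d (shift A) = shift (d A) := by
  -- over `ℚ`, this recursion determines the coefficients of a translate
  have key : ∀ (A : QV) (j : ℕ), ((j : ℚ) + 1) • (shift A).coeff (j + 1) =
      (shift (shiftDer A)).coeff j := fun A j => by
    rw [← derivative_shift, Polynomial.coeff_derivative]
    have e : ((j : QV) + 1) = ((j + 1 : ℕ) : QV) := by push_cast; rfl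
    rw [e, ← nsmul_eq_mul', ← Nat.cast_smul_eq_nsmul ℚ]
    push_cast
    rfl
  ext1 j
  rw [coeff_coeffMap]
  induction j generalizing A with
  | zero => rw [coeff_zero_shift, coeff_zero_shift]
  | succ j ih =>
    have hj : (j : ℚ) + 1 ≠ 0 := by positivity
    refine smul_right_injective QV hj ?_
    change ((j : ℚ) + 1) • d _ = ((j : ℚ) + 1) • _
    rw [← map_smul, key, key, hd, ih]

/-! ### The right adjoint action -/

/-- The algebra morphism `ℚ⟨V⟩ → End(ℚ⟨V⟩)ᵒᵖ` which sends a letter `v` to `B ↦ B v - v B`. -/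
def adjHom : QV →ₐ[ℚ] (Module.End ℚ QV)ᵐᵒᵖ :=
  MonoidAlgebra.lift ℚ _ (FreeMonoid ℕ) (FreeMonoid.lift fun k =>
    MulOpposite.op (LinearMap.mulRight ℚ (word [k]) - LinearMap.mulLeft ℚ (word [k])))

/-- The right adjoint action `adj A B = S(A₍₁₎) B A₍₂₎` of `ℚ⟨V⟩` on itself. -/
def adj : QV →ₗ[ℚ] QV →ₗ[ℚ] QV :=
  (MulOpposite.opLinearEquiv ℚ).symm.toLinearMap ∘ₗ adjHom.toLinearMap

theorem adj_one (B : QV) : adj 1 B = B := by simp [adj]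

theorem adj_mul (A A' B : QV) : adj (A * A') B = adj A' (adj A B) := by simp [adj]

theorem adj_letter (k : ℕ) (B : QV) : adj (word [k]) B = B * word [k] - word [k] * B := by
  have h : adjHom (word [k]) = MulOpposite.op
      (LinearMap.mulRight ℚ (word [k]) - LinearMap.mulLeft ℚ (word [k])) := by
    rw [adjHom, word, MonoidAlgebra.lift_single, one_smul]
    exact FreeMonoid.lift_eval_of _ k
  simp [adj, h]

/-- Lie elements act by commutators. -/
theorem adj_of_mem {x : QV} (hx : x ∈ lieElements) (B : QV) : adj x B = B * x - x * B := by
  obtain ⟨x, rfl⟩ := hx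
  change adj (lieToQV x) B = B * lieToQV x - lieToQV x * B
  induction x using lie_induction generalizing B with
  | of i => rw [lieToQV_of, adj_letter]
  | lie x y hx hy =>
    rw [lieToQV_lie, map_sub, LinearMap.sub_apply, adj_mul, adj_mul, hx, hy, hx, hy]
    noncomm_ring
  | add x y hx hy => rw [map_add, map_add, LinearMap.add_apply, hx, hy]; noncomm_ring
  | smul c x hx =>
    rw [map_smul, map_smul, LinearMap.smul_apply, hx, mul_smul_comm, smul_mul_assoc, smul_sub]

theorem adj_mem {x : QV} (hx : x ∈ lieElements) (A : QV) : adj A x ∈ lieElements := by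
  induction A using letter_induction generalizing x with
  | one => rwa [adj_one]
  | letter_mul a A ih =>
    rw [adj_mul, adj_letter]
    exact ih (commutator_mem_lieElements hx (letter_mem_lieElements a))
  | add A B hA hB => rw [map_add]; exact add_mem (hA hx) (hB hx)
  | smul c A hA => rw [map_smul]; exact SMulMemClass.smul_mem c (hA hx)

/-- `∑ⱼ A_j X^j ↦ ∑ⱼ adj A_j (f j)`: the adjoint action of a translate on a sequence, in which the
power `X^j` selects the term `f j`. -/
def twist (f : ℕ → QV) : Polynomial QV →ₗ[ℚ] QV := Polynomial.lsum fun j => adj.flip (f j)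

theorem twist_monomial (f : ℕ → QV) (j : ℕ) (A : QV) :
    twist f (Polynomial.monomial j A) = adj A (f j) := by
  simp [twist, Polynomial.lsum, Polynomial.sum_monomial_index]

theorem twist_one (f : ℕ → QV) : twist f 1 = f 0 := by
  rw [← Polynomial.monomial_zero_one, twist_monomial, adj_one]

/-- As `adj` is a right action, so is `twist`, on sequences. -/
theorem twist_mul (f : ℕ → QV) (P Q : Polynomial QV) :
    twist f (P * Q) = twist (fun j => twist (fun i => f (i + j)) P) Q := by
  induction Q using Polynomial.induction_on' with
  | add Q R hQ hR => rw [mul_add, map_add, hQ, hR, map_add]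
  | monomial j B =>
    rw [twist_monomial]
    induction P using Polynomial.induction_on' with
    | add P R hP hR => rw [add_mul, map_add, hP, hR, map_add, map_add]
    | monomial i A => rw [Polynomial.monomial_mul_monomial, twist_monomial, twist_monomial, adj_mul]

theorem twist_mem {f : ℕ → QV} (hf : ∀ j, f j ∈ lieElements) (P : Polynomial QV) :
    twist f P ∈ lieElements := by
  induction P using Polynomial.induction_on' with
  | add P Q hP hQ => rw [map_add]; exact add_mem hP hQ
  | monomial j A => rw [twist_monomial]; exact adj_mem (hf j) A

/-! ### Lie derivations -/

/-- A derivation of `ℚ⟨V⟩` which maps the letters, and hence `Lie(V)`, to Lie elements. -/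
structure IsLieDerivation (d : QV →ₗ[ℚ] QV) : Prop where
  leibniz : ∀ A B, d (A * B) = d A * B + A * d B
  letter_mem : ∀ a, d (word [a]) ∈ lieElements

namespace IsLieDerivation

variable {d : QV →ₗ[ℚ] QV} (hd : IsLieDerivation d)
include hd

theorem map_one : d 1 = 0 := by
  have h := hd.leibniz 1 1
  simpa using h

theorem map_mem {x : QV} (hx : x ∈ lieElements) : d x ∈ lieElements := by
  obtain ⟨x, rfl⟩ := hx
  change d (lieToQV x) ∈ lieElements
  induction x using lie_induction with
  | of i => rw [lieToQV_of]; exact hd.letter_mem i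
  | lie x y hx hy =>
    rw [lieToQV_lie, map_sub, hd.leibniz, hd.leibniz]
    have h1 := commutator_mem_lieElements hx (lieToQV_mem y)
    have h2 := commutator_mem_lieElements (lieToQV_mem x) hy
    convert add_mem h1 h2 using 1
    abel
  | add x y hx hy => rw [map_add, map_add]; exact add_mem hx hy
  | smul c x hx => rw [map_smul, map_smul]; exact SMulMemClass.smul_mem c hx

theorem eq_of_letters {d' : QV →ₗ[ℚ] QV} (hd' : IsLieDerivation d')
    (h : ∀ a, d (word [a]) = d' (word [a])) : d = d' := by
  refine LinearMap.ext fun A => ?_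
  induction A using letter_induction with
  | one => rw [hd.map_one, hd'.map_one]
  | letter_mul a A ih => rw [hd.leibniz, hd'.leibniz, h, ih]
  | add A B hA hB => rw [map_add, hA, hB, map_add]
  | smul c A hA => rw [map_smul, hA, map_smul]

theorem counit_eq_zero (A : QV) : counit (d A) = 0 := by
  induction A using letter_induction with
  | one => rw [hd.map_one, map_zero]
  | letter_mul a A ih =>
    rw [hd.leibniz, map_add, counit_mul, counit_mul, ih, counit_of_mem (hd.letter_mem a)]; simp
  | add A B hA hB => rw [map_add, map_add, hA, hB, add_zero]
  | smul c A hA => rw [map_smul, map_smul, hA, smul_zero]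

/-- Lie derivations are derivations of the adjoint action. -/
theorem map_adj (A B : QV) : d (adj A B) = adj A (d B) + adj (d A) B := by
  induction A using letter_induction generalizing B with
  | one => rw [adj_one, adj_one, hd.map_one, map_zero, LinearMap.zero_apply, add_zero]
  | letter_mul a A ih =>
    rw [adj_mul, ih, hd.leibniz, map_add, LinearMap.add_apply, adj_mul, adj_mul, adj_mul,
      adj_letter, adj_letter, adj_of_mem (hd.letter_mem a), map_sub, hd.leibniz, hd.leibniz]
    simp only [map_add, map_sub]
    abel
  | add A A' hA hB => simp only [map_add, LinearMap.add_apply, hA, hB]; abel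
  | smul c A hA => simp only [map_smul, LinearMap.smul_apply, hA, smul_add]

theorem map_twist (f : ℕ → QV) (P : Polynomial QV) :
    d (twist f P) = twist (fun j => d (f j)) P + twist f (coeffMap d P) := by
  induction P using Polynomial.induction_on' with
  | add P Q hP hQ => simp only [map_add, hP, hQ]; abel
  | monomial j A => rw [twist_monomial, twist_monomial, coeffMap_monomial, twist_monomial,
      hd.map_adj]

/-- The coderivation property of Lie derivations, in terms of convolution. -/
theorem conv_map (f g : QV →ₗ[ℚ] QV) (A : QV) :
    conv f g (d A) = conv (f ∘ₗ d) g A + conv f (g ∘ₗ d) A := by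
  induction A using letter_induction generalizing f g with
  | one => simp [hd.map_one, conv_one]
  | letter_mul a A ih =>
    have key : ∀ f : QV →ₗ[ℚ] QV, (f ∘ₗ d) ∘ₗ LinearMap.mulLeft ℚ (word [a]) =
        f ∘ₗ LinearMap.mulLeft ℚ (d (word [a])) + (f ∘ₗ LinearMap.mulLeft ℚ (word [a])) ∘ₗ d :=
      fun f => LinearMap.ext fun B => by simp [hd.leibniz]
    rw [hd.leibniz, map_add, conv_primitive_mul (isPrimitive_of_mem (hd.letter_mem a)),
      conv_primitive_mul (isPrimitive_letter a), conv_primitive_mul (isPrimitive_letter a),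
      conv_primitive_mul (isPrimitive_letter a), ih, ih, key, key, conv_add_left, conv_add_right]
    simp only [LinearMap.add_apply]
    abel
  | add A B hA hB => simp only [map_add, hA, hB]; abel
  | smul c A hA => simp only [map_smul, hA, smul_add]

theorem map_conv (f g : QV →ₗ[ℚ] QV) (A : QV) :
    d (conv f g A) = conv (d ∘ₗ f) g A + conv f (d ∘ₗ g) A := by
  induction A using letter_induction generalizing f g with
  | one => simp [hd.leibniz, conv_one]
  | letter_mul a A ih =>
    simp only [conv_primitive_mul (isPrimitive_letter a), map_add, ih, LinearMap.comp_assoc]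
    abel
  | add A B hA hB => simp only [map_add, hA, hB]; abel
  | smul c A hA => simp only [map_smul, hA, smul_add]

/-- Lie derivations preserve the filtration by the number of Lie factors. -/
theorem map_pow_mem (n : ℕ) {A : QV} (hA : A ∈ lieElements.toSubmodule ^ n) :
    d A ∈ lieElements.toSubmodule ^ n := by
  induction n generalizing A with
  | zero =>
    rw [pow_zero, Submodule.mem_one] at hA
    obtain ⟨c, rfl⟩ := hA
    rw [Algebra.algebraMap_eq_smul_one, map_smul, hd.map_one, smul_zero]
    exact zero_mem _
  | succ n ih =>
    rw [pow_succ'] at hA ⊢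
    induction hA using Submodule.mul_induction_on' with
    | mem_mul_mem x hx B hB =>
      rw [hd.leibniz]
      exact add_mem (Submodule.mul_mem_mul (hd.map_mem hx) hB) (Submodule.mul_mem_mul hx (ih hB))
    | add x _ y _ hx hy => rw [map_add]; exact add_mem hx hy

end IsLieDerivation

theorem isLieDerivation_shiftDer : IsLieDerivation shiftDer where
  leibniz := shiftDer_mul
  letter_mem a := by
    rcases a with _ | a
    · rw [shiftDer_letter_zero]; exact zero_mem _
    · rw [shiftDer_letter_succ]; exact SMulMemClass.smul_mem _ (letter_mem_lieElements a)

/-- Induction along the filtration of `ℚ⟨V⟩` by the number of Lie factors: as a derivation `d x`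
preserves this number, the hypothesis on `d x A` is harmless. -/
theorem lie_filtration_induction {d : QV → QV →ₗ[ℚ] QV}
    (hd : ∀ x ∈ lieElements, IsLieDerivation (d x)) {p : QV → Prop} (one : p 1)
    (add : ∀ A B, p A → p B → p (A + B)) (smul : ∀ (c : ℚ) A, p A → p (c • A))
    (lie_mul : ∀ x ∈ lieElements, ∀ A, p A → p (d x A) → p (x * A)) (A : QV) : p A := by
  have key : ∀ n : ℕ, ∀ A ∈ lieElements.toSubmodule ^ n, p A := by
    intro n
    induction n with
    | zero =>
      intro A hA
      rw [pow_zero, Submodule.mem_one] at hA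
      obtain ⟨c, rfl⟩ := hA
      rw [Algebra.algebraMap_eq_smul_one]
      exact smul c 1 one
    | succ n ih =>
      intro A hA
      rw [pow_succ'] at hA
      induction hA using Submodule.mul_induction_on' with
      | mem_mul_mem x hx B hB =>
        exact lie_mul x hx B (ih B hB) (ih _ ((hd x hx).map_pow_mem n hB))
      | add x _ y _ hx hy => exact add x y hx hy
  refine word_induction (fun w => key w.length _ ?_) add smul A
  induction w with
  | nil => rw [word_nil]; exact Submodule.one_le.mp le_rfl
  | cons a w ih =>
    rw [word_cons, List.length_cons, pow_succ']
    exact Submodule.mul_mem_mul (letter_mem_lieElements a) ih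

/-! ### The extended post-Lie product -/

/-- The action `A ↦ A ▷ v_s` on a letter: `A ▷ v_0 = ε(A) v_0` and
`A ▷ v_s = ∑ⱼ adj A_j v_{s+j}` for `s ≥ 1`, where `∑ⱼ A_j X^j` is the translate of `A`. -/
def triLetter (s : ℕ) : QV →ₗ[ℚ] QV :=
  if s = 0 then counit.smulRight (word [0])
  else twist (fun j => word [s + j]) ∘ₗ shift.toLinearMap

theorem triLetter_zero (A : QV) : triLetter 0 A = counit A • word [0] := rfl

theorem triLetter_succ (s : ℕ) (A : QV) :
    triLetter (s + 1) A = twist (fun j => word [s + 1 + j]) (shift A) := rfl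

theorem triLetter_mem (s : ℕ) (A : QV) : triLetter s A ∈ lieElements := by
  rcases s with _ | s
  · exact SMulMemClass.smul_mem _ (letter_mem_lieElements 0)
  · exact twist_mem (fun j => letter_mem_lieElements _) _

/-- The action `A ↦ A ▷ w` on a word, distributed over the letters by the shuffle coproduct. -/
def triWord : List ℕ → QV →ₗ[ℚ] QV
  | [] => counitOne
  | s :: w => conv (triLetter s) (triWord w)

/-- The extension of `▷_a` to `ℚ⟨V⟩`. -/
def triExt : QV →ₗ[ℚ] QV →ₗ[ℚ] QV :=
  (wordBasis.constr ℚ fun w => triWord w.toList).flip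

theorem triExt_word (A : QV) (w : List ℕ) : triExt A (word w) = triWord w A := by
  have h : word w = wordBasis (FreeMonoid.ofList w) := (wordBasis_apply _).symm
  rw [triExt, LinearMap.flip_apply, h, Module.Basis.constr_basis]
  rfl

theorem triExt_flip_word (w : List ℕ) : triExt.flip (word w) = triWord w :=
  LinearMap.ext fun A => triExt_word A w

theorem triExt_one (A : QV) : triExt A 1 = counit A • 1 := triExt_word A []

theorem triWord_letter (s : ℕ) : triWord [s] = triLetter s := conv_counitOne _

theorem triExt_letter (A : QV) (s : ℕ) : triExt A (word [s]) = triLetter s A := by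
  rw [triExt_word, triWord_letter]

theorem triWord_append (u v : List ℕ) : triWord (u ++ v) = conv (triWord u) (triWord v) := by
  induction u with
  | nil => exact (counitOne_conv _).symm
  | cons a u ih => rw [List.cons_append, triWord, triWord, ih, conv_assoc]

theorem triExt_mul (A B C : QV) : triExt A (B * C) = conv (triExt.flip B) (triExt.flip C) A := by
  induction B using word_induction with
  | word u =>
    induction C using word_induction with
    | word v =>
      rw [← word_append, triExt_word, triWord_append, triExt_flip_word, triExt_flip_word]
    | add B C hB hC => rw [mul_add, map_add, hB, hC, map_add, conv_add_right, LinearMap.add_apply]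
    | smul c B hB => rw [mul_smul_comm, map_smul, hB, map_smul, conv_smul_right,
        LinearMap.smul_apply]
  | add A B hA hB => rw [add_mul, map_add, hA, hB, map_add, conv_add_left, LinearMap.add_apply]
  | smul c A hA => rw [smul_mul_assoc, map_smul, hA, map_smul, conv_smul_left,
      LinearMap.smul_apply]

theorem one_triExt (A : QV) : triExt 1 A = A := by
  induction A using letter_induction with
  | one => rw [triExt_one, counit_one, one_smul]
  | letter_mul s A ih =>
    rw [triExt_mul, conv_one, LinearMap.flip_apply, LinearMap.flip_apply, ih, triExt_letter]
    rcases s with _ | s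
    · rw [triLetter_zero, counit_one, one_smul]
    · rw [triLetter_succ, map_one, twist_one, add_zero]
  | add A B hA hB => rw [map_add, hA, hB]
  | smul c A hA => rw [map_smul, hA]

theorem isLieDerivation_triExt {x : QV} (hx : x ∈ lieElements) : IsLieDerivation (triExt x) where
  leibniz A B := by
    rw [triExt_mul, conv_primitive (isPrimitive_of_mem hx)]
    simp only [LinearMap.flip_apply, one_triExt]
  letter_mem a := by rw [triExt_letter]; exact triLetter_mem a x

/-- The action on letters commutes with the generator of the translations. By the Leibniz rule,
`shiftDer (adj A_j v_{s+j})` is the sum of `adj (shiftDer A_j) v_{s+j}` and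
`-(s+j-1) adj A_j v_{s+j-1}`. As `shiftDer A_j = (j+1) A_{j+1}`, the first terms add up to
`∑ j adj A_j v_{s+j-1}`, and the total is `-(s-1) (A ▷ v_{s-1})`. -/
theorem shiftDer_triLetter (s : ℕ) (A : QV) :
    shiftDer (triLetter s A) = triExt A (shiftDer (word [s])) := by
  rcases s with _ | s
  · rw [triLetter_zero, map_smul, shiftDer_letter_zero, map_zero, smul_zero]
  have hcomm : coeffMap shiftDer (shift A) = Polynomial.derivative (shift A) := by
    rw [coeffMap_shift (fun _ => rfl), derivative_shift]
  have hder : ∀ P : Polynomial QV, twist (fun j => word [s + 1 + j]) (Polynomial.derivative P) =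
      twist (fun j => (j : ℚ) • word [s + j]) P := fun P => by
    induction P using Polynomial.induction_on' with
    | add P Q hP hQ => simp only [map_add, hP, hQ]
    | monomial j B =>
      have e : B * (j : QV) = (j : ℚ) • B := by rw [← nsmul_eq_mul', Nat.cast_smul_eq_nsmul]
      rw [Polynomial.derivative_monomial, twist_monomial, twist_monomial, e, map_smul,
        LinearMap.smul_apply, map_smul]
      rcases j with _ | j
      · simp
      · rw [Nat.add_sub_cancel, add_assoc s 1 j, add_comm 1 j]
  rw [triLetter_succ, isLieDerivation_shiftDer.map_twist, hcomm, hder, shiftDer_letter_succ,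
    map_smul, triExt_letter]
  have hs : -(s : ℚ) • triLetter s A = -(s : ℚ) • twist (fun j => word [s + j]) (shift A) := by
    rcases s with _ | s
    · simp
    · rfl
  rw [hs]
  generalize shift A = P
  induction P using Polynomial.induction_on' with
  | add P Q hP hQ =>
    rw [map_add, map_add, map_add, smul_add, ← hP, ← hQ]; abel
  | monomial j B =>
    rw [twist_monomial, twist_monomial, twist_monomial, add_right_comm, shiftDer_letter_succ,
      map_smul, map_smul, ← add_smul]
    congr 1
    push_cast
    ring

theorem shiftDer_triExt (A B : QV) : shiftDer (triExt A B) = triExt A (shiftDer B) := by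
  induction B using letter_induction generalizing A with
  | one => rw [triExt_one, map_smul, isLieDerivation_shiftDer.map_one, smul_zero, map_zero]
  | letter_mul s B ih =>
    have h1 : shiftDer ∘ₗ triExt.flip (word [s]) = triExt.flip (shiftDer (word [s])) :=
      LinearMap.ext fun A => by
        simp only [LinearMap.comp_apply, LinearMap.flip_apply, triExt_letter, shiftDer_triLetter]
    have h2 : shiftDer ∘ₗ triExt.flip B = triExt.flip (shiftDer B) :=
      LinearMap.ext fun A => by simp only [LinearMap.comp_apply, LinearMap.flip_apply, ih]
    rw [triExt_mul, isLieDerivation_shiftDer.map_conv, shiftDer_mul, map_add, triExt_mul,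
      triExt_mul, h1, h2]
  | add B C hB hC => rw [map_add, map_add, hB, hC, map_add, map_add]
  | smul c A hA => rw [map_smul, map_smul, hA, map_smul, map_smul]

/-- The rule for `xA ▷ v_s`, from the multiplicativity of the translations and the right action
property of `adj`. -/
theorem triLetter_lie_mul {x : QV} (hx : x ∈ lieElements) (A : QV) (s : ℕ) :
    triLetter s (x * A) = triExt x (triLetter s A) - triLetter s (triExt x A) := by
  have hd := isLieDerivation_triExt hx
  rcases s with _ | s
  · rw [triLetter_zero, triLetter_zero, triLetter_zero, counit_mul, counit_of_mem hx,
      hd.counit_eq_zero, map_smul, triExt_letter, triLetter_zero, counit_of_mem hx]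
    simp
  · rw [triLetter_succ, triLetter_succ, triLetter_succ, map_mul, twist_mul, hd.map_twist,
      coeffMap_shift (fun A => shiftDer_triExt x A), add_sub_cancel_right]
    congr 1
    congr 1
    funext j
    rw [triExt_letter, add_right_comm, triLetter_succ]
    congr 1
    congr 1
    funext i
    rw [show s + 1 + (i + j) = s + j + 1 + i by omega]

/-- The rule `xA ▷ B = x ▷ (A ▷ B) - (x ▷ A) ▷ B` holds for all `B`. -/
theorem triExt_lie_mul {x : QV} (hx : x ∈ lieElements) (A B : QV) :
    triExt (x * A) B = triExt x (triExt A B) - triExt (triExt x A) B := by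
  have hd := isLieDerivation_triExt hx
  induction B using letter_induction generalizing A with
  | one =>
    rw [triExt_one, triExt_one, triExt_one, counit_mul, counit_of_mem hx, hd.counit_eq_zero,
      map_smul, hd.map_one]
    simp
  | letter_mul s B ih =>
    have h1 : triExt.flip (word [s]) ∘ₗ LinearMap.mulLeft ℚ x =
        triExt x ∘ₗ triExt.flip (word [s]) - triExt.flip (word [s]) ∘ₗ triExt x :=
      LinearMap.ext fun A => by
        simp only [LinearMap.comp_apply, LinearMap.flip_apply, LinearMap.mulLeft_apply,
          LinearMap.sub_apply, triExt_letter, triLetter_lie_mul hx]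
    have h2 : triExt.flip B ∘ₗ LinearMap.mulLeft ℚ x =
        triExt x ∘ₗ triExt.flip B - triExt.flip B ∘ₗ triExt x :=
      LinearMap.ext fun A => by
        simp only [LinearMap.comp_apply, LinearMap.flip_apply, LinearMap.mulLeft_apply,
          LinearMap.sub_apply, ih]
    rw [triExt_mul, triExt_mul, triExt_mul, conv_primitive_mul (isPrimitive_of_mem hx), h1, h2,
      hd.map_conv, hd.conv_map, conv_sub_left, conv_sub_right]
    simp only [LinearMap.sub_apply]
    abel
  | add B C hB hC => simp only [map_add, hB, hC]; abel
  | smul c A hA => simp only [map_smul, hA, smul_sub]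

theorem triExt_mem {x y : QV} (hx : x ∈ lieElements) (hy : y ∈ lieElements) :
    triExt x y ∈ lieElements :=
  (isLieDerivation_triExt hx).map_mem hy

/-! ### Uniqueness of the extension -/

/-- The only unital idempotent for the convolution is its unit. It determines `A ▷ 1`. -/
theorem eq_counitOne_of_conv_self {e : QV →ₗ[ℚ] QV} (h1 : e 1 = 1) (h : conv e e = e) :
    e = counitOne := by
  -- `g = e - ε` satisfies `g = -g * g` and `g(1) = 0`, so it vanishes by induction on the length.
  set g := e - counitOne with hg
  have hgg : conv g g = -g := by
    rw [hg, conv_sub_left, conv_sub_right, conv_sub_right, h, conv_counitOne, counitOne_conv,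
      conv_counitOne]
    abel
  have hg1 : g 1 = 0 := by
    rw [hg, LinearMap.sub_apply, h1, counitOne_apply, counit_one, one_smul, sub_self]
  have key : ∀ (n : ℕ) (w : List ℕ), w.length = n → g (word w) = 0 := by
    intro n
    induction n using Nat.strong_induction_on with
    | _ n ih =>
      intro w hw
      rw [← neg_eq_zero, ← LinearMap.neg_apply, ← hgg, conv_word]
      refine List.sum_eq_zero fun z hz => ?_
      obtain ⟨p, hp, rfl⟩ := List.mem_map.mp hz
      have hl := length_of_mem_splits hp
      rcases h1 : p.1 with _ | ⟨a, u⟩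
      · rw [word_nil, hg1, zero_mul]
      · rcases h2 : p.2 with _ | ⟨b, v⟩
        · rw [word_nil, hg1, mul_zero]
        · rw [h1, h2] at hl
          rw [ih (a :: u).length (by simp at hl ⊢; omega) _ rfl, zero_mul]
  refine linearMap_ext_word fun w => ?_
  have := key _ w rfl
  rwa [hg, LinearMap.sub_apply, sub_eq_zero] at this

/-- If `triExt` extends a post-Lie product, it is the only extension. Both agree on Lie elements, as
these act by derivations; then on letters, by induction along the Lie filtration; then everywhere, as
the action on a product is a convolution. -/
theorem IsExtension.eq_triExt {tri : LieV →ₗ[ℚ] LieV →ₗ[ℚ] LieV} {ext : QV →ₗ[ℚ] QV →ₗ[ℚ] QV}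
    (h0 : IsExtension tri triExt) (h : IsExtension tri ext) : ext = triExt := by
  have hder : ∀ x : LieV, IsLieDerivation (ext (lieToQV x)) := fun x =>
    { leibniz := fun A B => by
        rw [h.ext_mul, conv_primitive (isPrimitive_of_mem (lieToQV_mem x))]
        simp only [LinearMap.flip_apply, h.one_ext]
      letter_mem := fun a => by
        rw [← lieToQV_of, h.ext_lie]; exact lieToQV_mem _ }
  have hlie : ∀ x : LieV, ext (lieToQV x) = triExt (lieToQV x) := fun x =>
    (hder x).eq_of_letters (isLieDerivation_triExt (lieToQV_mem x)) fun a => by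
      rw [← lieToQV_of, h.ext_lie, h0.ext_lie]
  have hletter : ∀ (A : QV) (s : ℕ), ext A (word [s]) = triExt A (word [s]) := by
    intro A
    induction A using lie_filtration_induction (fun x hx => isLieDerivation_triExt hx) with
    | one => intro s; rw [h.one_ext, one_triExt]
    | add A B hA hB => intro s; simp only [map_add, LinearMap.add_apply, hA, hB]
    | smul c A hA => intro s; simp only [map_smul, LinearMap.smul_apply, hA]
    | lie_mul x hx A hA hxA =>
      intro s
      obtain ⟨x, rfl⟩ := hx
      change ext (lieToQV x * A) (word [s]) = triExt (lieToQV x * A) (word [s])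
      replace hxA : ∀ s, ext (triExt (lieToQV x) A) (word [s]) =
        triExt (triExt (lieToQV x) A) (word [s]) := hxA
      have e := h.mul_ext x A (FreeLieAlgebra.of ℚ s)
      have e0 := h0.mul_ext x A (FreeLieAlgebra.of ℚ s)
      rw [lieToQV_of, hA s, hlie, hxA s] at e
      rw [lieToQV_of] at e0
      exact e.trans e0.symm
  -- `x ▷ 1` is prescribed for Lie elements `x` only; in general, use the rule for `A ▷ (1 * 1)`
  have hone : ext.flip 1 = counitOne := by
    refine eq_counitOne_of_conv_self (h.one_ext 1) (LinearMap.ext fun A => ?_)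
    rw [← h.ext_mul, mul_one, LinearMap.flip_apply]
  have hflip : ext.flip = triExt.flip := by
    refine LinearMap.ext fun B => ?_
    induction B using letter_induction with
    | one => rw [hone]; exact (triExt_flip_word []).symm
    | letter_mul s B ih =>
      refine LinearMap.ext fun A => ?_
      rw [LinearMap.flip_apply, LinearMap.flip_apply, h.ext_mul, triExt_mul, ih]
      congr 2
      exact LinearMap.ext fun A => hletter A s
    | add A B hA hB => rw [map_add, hA, hB, map_add]
    | smul c A hA => rw [map_smul, hA, map_smul]
  rw [← LinearMap.flip_flip ext, hflip, LinearMap.flip_flip]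

/-! ### The Grossman-Larson product -/

/-- The Grossman-Larson product of `▷_a`. -/
def gl : QV →ₗ[ℚ] QV →ₗ[ℚ] QV := glp triExt

theorem gl_apply (A B : QV) : gl A B = conv LinearMap.id (triExt.flip B) A := rfl

theorem gl_lie {x : QV} (hx : x ∈ lieElements) (B : QV) : gl x B = x * B + triExt x B := by
  rw [gl_apply, conv_primitive (isPrimitive_of_mem hx)]
  simp [one_triExt]

theorem one_gl (B : QV) : gl 1 B = B := by
  rw [gl_apply, conv_one]; simp [one_triExt]

theorem gl_one (A : QV) : gl A 1 = A := by
  rw [gl_apply, ← word_nil, triExt_flip_word, triWord, conv_counitOne, LinearMap.id_apply]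

theorem conv_mulLeft (x : QV) (f g : QV →ₗ[ℚ] QV) (A : QV) :
    conv (LinearMap.mulLeft ℚ x ∘ₗ f) g A = x * conv f g A := by
  simp only [conv, LinearMap.comp_apply]
  induction co.toLinearMap A using TensorProduct.induction_on with
  | zero => simp
  | tmul u v => simp [mul_assoc]
  | add s t hs ht => simp only [map_add, hs, ht, mul_add]

/-- Associativity with a Lie element as first factor; it amounts to the rule for `xA ▷ C`. -/
theorem gl_lie_assoc {x : QV} (hx : x ∈ lieElements) (B C : QV) :
    gl (gl x B) C = gl x (gl B C) := by
  have hd := isLieDerivation_triExt hx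
  have h2 : triExt.flip C ∘ₗ LinearMap.mulLeft ℚ x =
      triExt x ∘ₗ triExt.flip C - triExt.flip C ∘ₗ triExt x :=
    LinearMap.ext fun A => by
      simp only [LinearMap.comp_apply, LinearMap.flip_apply, LinearMap.mulLeft_apply,
        LinearMap.sub_apply, triExt_lie_mul hx]
  rw [gl_lie hx, gl_lie hx, gl_apply, gl_apply, map_add,
    conv_primitive_mul (isPrimitive_of_mem hx), hd.map_conv, hd.conv_map, h2, conv_sub_right,
    ← conv_mulLeft, LinearMap.id_comp, LinearMap.comp_id, LinearMap.comp_id,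
    LinearMap.sub_apply]
  abel

/-- Induction on the first factor of the Grossman-Larson product: Lie elements generate. -/
theorem gl_induction {p : QV → Prop} (one : p 1) (add : ∀ A B, p A → p B → p (A + B))
    (smul : ∀ (c : ℚ) A, p A → p (c • A)) (gl_mul : ∀ x ∈ lieElements, ∀ A, p A → p (gl x A))
    (A : QV) : p A := by
  induction A using lie_filtration_induction (fun x hx => isLieDerivation_triExt hx) with
  | one => exact one
  | add A B hA hB => exact add A B hA hB
  | smul c A hA => exact smul c A hA
  | lie_mul x hx A hA hxA =>
    have h : x * A = gl x A + (-1 : ℚ) • triExt x A := by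
      rw [gl_lie hx, neg_one_smul ℚ, add_neg_cancel_right]
    rw [h]
    exact add _ _ (gl_mul x hx A hA) (smul _ _ hxA)

theorem gl_assoc (A B C : QV) : gl (gl A B) C = gl A (gl B C) := by
  induction A using gl_induction with
  | one => rw [one_gl, one_gl]
  | add A B hA hB => simp only [map_add, LinearMap.add_apply, hA, hB]
  | smul c A hA => simp only [map_smul, LinearMap.smul_apply, hA]
  | gl_mul x hx A hA => rw [gl_lie_assoc hx, gl_lie_assoc hx, hA, gl_lie_assoc hx]

theorem counit_gl (A B : QV) : counit (gl A B) = counit A * counit B := by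
  have h : ∀ x ∈ lieElements, ∀ B, counit (gl x B) = 0 := fun x hx B => by
    rw [gl_lie hx, map_add, counit_mul, counit_of_mem hx,
      (isLieDerivation_triExt hx).counit_eq_zero, zero_mul, add_zero]
  induction A using gl_induction with
  | one => rw [one_gl, counit_one, one_mul]
  | add A B hA hB => simp only [map_add, LinearMap.add_apply, hA, hB, add_mul]
  | smul c A hA => simp only [map_smul, LinearMap.smul_apply, hA, smul_mul_assoc]
  | gl_mul x hx A hA => rw [gl_lie_assoc hx, h x hx, h x hx, zero_mul]

/-- Lie derivations are coderivations of the shuffle coproduct. -/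
theorem IsLieDerivation.co_map {d : QV →ₗ[ℚ] QV} (hd : IsLieDerivation d) (A : QV) :
    co (d A) = TensorProduct.map d LinearMap.id (co A) + TensorProduct.map LinearMap.id d (co A) := by
  induction A using letter_induction with
  | one => simp [hd.map_one, Algebra.TensorProduct.one_def]
  | letter_mul a A ih =>
    rw [hd.leibniz, map_add, map_mul, map_mul, map_mul, ih, co_letter,
      show co (d (word [a])) = _ from isPrimitive_of_mem (hd.letter_mem a)]
    generalize co A = T
    induction T using TensorProduct.induction_on with
    | zero => simp
    | tmul u v =>
      simp only [add_mul, mul_add, Algebra.TensorProduct.tmul_mul_tmul, one_mul, map_add,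
        TensorProduct.map_tmul, LinearMap.id_apply, hd.leibniz, TensorProduct.add_tmul,
        TensorProduct.tmul_add]
      abel
    | add s t hs ht =>
      refine Eq.trans ?_ ((congrArg₂ (· + ·) hs ht).trans ?_) <;>
        simp only [map_add, mul_add] <;> abel
  | add A B hA hB => simp only [map_add, hA, hB]; abel
  | smul c A hA => simp only [map_smul, hA, smul_add]

theorem co_gl_lie {x : QV} (hx : x ∈ lieElements) (B : QV) :
    co (gl x B) = TensorProduct.map₂ gl gl (co x) (co B) := by
  rw [gl_lie hx, map_add, map_mul, (isLieDerivation_triExt hx).co_map,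
    show co x = _ from isPrimitive_of_mem hx]
  induction co B using TensorProduct.induction_on with
  | zero => simp
  | tmul u v =>
    simp only [add_mul, Algebra.TensorProduct.tmul_mul_tmul, one_mul, map_add,
      TensorProduct.map_tmul, LinearMap.id_apply, LinearMap.add_apply,
      TensorProduct.map₂_apply_tmul, one_gl, gl_lie hx, TensorProduct.add_tmul,
      TensorProduct.tmul_add]
    abel
  | add s t hs ht =>
    rw [map_add (TensorProduct.map₂ gl gl _), ← hs, ← ht]
    simp only [map_add, mul_add]
    abel

theorem map₂_assoc {M : Type*} [AddCommGroup M] [Module ℚ M] {μ : M →ₗ[ℚ] M →ₗ[ℚ] M}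
    (h : ∀ a b c, μ (μ a b) c = μ a (μ b c)) (r s t : M ⊗[ℚ] M) :
    TensorProduct.map₂ μ μ (TensorProduct.map₂ μ μ r s) t =
      TensorProduct.map₂ μ μ r (TensorProduct.map₂ μ μ s t) := by
  induction r using TensorProduct.induction_on with
  | zero => simp
  | add r r' hr hr' => simp only [map_add, LinearMap.add_apply, hr, hr']
  | tmul a a' =>
    induction s using TensorProduct.induction_on with
    | zero => simp
    | add r r' hr hr' => simp only [map_add, LinearMap.add_apply, hr, hr']
    | tmul b b' =>
      induction t using TensorProduct.induction_on with
      | zero => simp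
      | add r r' hr hr' => simp only [map_add, hr, hr']
      | tmul c c' => simp only [TensorProduct.map₂_apply_tmul, TensorProduct.map_tmul, h]

theorem co_gl (A B : QV) : co (gl A B) = TensorProduct.map₂ gl gl (co A) (co B) := by
  induction A using gl_induction with
  | one =>
    rw [one_gl, map_one, Algebra.TensorProduct.one_def]
    induction co B using TensorProduct.induction_on with
    | zero => simp
    | tmul u v => simp only [TensorProduct.map₂_apply_tmul, TensorProduct.map_tmul, one_gl]
    | add s t hs ht => rw [map_add, ← hs, ← ht]
  | add A B hA hB => simp only [map_add, LinearMap.add_apply, hA, hB]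
  | smul c A hA => simp only [map_smul, LinearMap.smul_apply, hA]
  | gl_mul x hx A hA =>
    rw [gl_lie_assoc hx, co_gl_lie hx, hA, co_gl_lie hx, map₂_assoc gl_assoc]

/-! ### Hopf algebra laws and duality -/

section Duality

variable {M N M' N' : Type} [AddCommGroup M] [Module ℚ M] [AddCommGroup N] [Module ℚ N]
  [AddCommGroup M'] [Module ℚ M'] [AddCommGroup N'] [Module ℚ N']

/-- The laws of a Hopf algebra, elementwise. -/
structure HopfOps.Laws (H : HopfOps M) : Prop where
  mul_assoc : ∀ a b c, H.mul (H.mul a b) c = H.mul a (H.mul b c)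
  one_mul : ∀ a, H.mul H.one a = a
  mul_one : ∀ a, H.mul a H.one = a
  coassoc : ∀ a, TensorProduct.assoc ℚ M M M (TensorProduct.map H.comul LinearMap.id (H.comul a)) =
    TensorProduct.map LinearMap.id H.comul (H.comul a)
  counit_left : ∀ a, TensorProduct.map H.counit LinearMap.id (H.comul a) = 1 ⊗ₜ[ℚ] a
  counit_right : ∀ a, TensorProduct.map LinearMap.id H.counit (H.comul a) = a ⊗ₜ[ℚ] 1
  comul_one : H.comul H.one = H.one ⊗ₜ[ℚ] H.one
  comul_mul : ∀ a b, H.comul (H.mul a b) =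
    TensorProduct.map₂ H.mul H.mul (H.comul a) (H.comul b)
  counit_one : H.counit H.one = 1
  counit_mul : ∀ a b, H.counit (H.mul a b) = H.counit a * H.counit b
  antipode_left : ∀ a, TensorProduct.lift H.mul
    (TensorProduct.map H.antipode LinearMap.id (H.comul a)) = H.counit a • H.one
  antipode_right : ∀ a, TensorProduct.lift H.mul
    (TensorProduct.map LinearMap.id H.antipode (H.comul a)) = H.counit a • H.one

theorem HopfOps.Laws.isHopfAlgebra {H : HopfOps M} (h : H.Laws) : H.IsHopfAlgebra := by
  let iR : Ring M :=
    { (inferInstance : AddCommGroup M) with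
      mul := fun a b => H.mul a b
      one := H.one
      mul_assoc := h.mul_assoc
      one_mul := h.one_mul
      mul_one := h.mul_one
      left_distrib := fun a b c => map_add (H.mul a) b c
      right_distrib := fun a b c => by
        change H.mul (a + b) c = H.mul a c + H.mul b c
        rw [map_add, LinearMap.add_apply]
      zero_mul := fun a => by
        change H.mul 0 a = 0
        rw [map_zero, LinearMap.zero_apply]
      mul_zero := fun a => map_zero (H.mul a) }
  let iA : Algebra ℚ M := Algebra.ofModule
    (fun r x y => by
      change H.mul (r • x) y = r • H.mul x y
      rw [map_smul, LinearMap.smul_apply])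
    (fun r x y => map_smul (H.mul x) r y)
  have hmul : ∀ s t : M ⊗[ℚ] M, s * t = TensorProduct.map₂ H.mul H.mul s t := by
    intro s t
    induction s using TensorProduct.induction_on with
    | zero => rw [zero_mul, map_zero, LinearMap.zero_apply]
    | add s s' hs hs' => rw [add_mul, hs, hs', map_add, LinearMap.add_apply]
    | tmul a b =>
      induction t using TensorProduct.induction_on with
      | zero => rw [mul_zero, map_zero]
      | add s s' hs hs' => rw [mul_add, hs, hs', map_add]
      | tmul c d =>
        rw [Algebra.TensorProduct.tmul_mul_tmul, TensorProduct.map₂_apply_tmul,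
          TensorProduct.map_tmul]
        rfl
  have hmul' : LinearMap.mul' ℚ M = TensorProduct.lift H.mul := by
    ext a b; rfl
  have hunit : ∀ c : ℚ, algebraMap ℚ M c = c • H.one := fun c => Algebra.algebraMap_eq_smul_one c
  let iC : Coalgebra ℚ M :=
    { comul := H.comul
      counit := H.counit
      coassoc := LinearMap.ext h.coassoc
      rTensor_counit_comp_comul := LinearMap.ext h.counit_left
      lTensor_counit_comp_comul := LinearMap.ext h.counit_right }
  let iB : Bialgebra ℚ M := Bialgebra.mk' ℚ M h.counit_one (fun {a b} => h.counit_mul a b)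
    h.comul_one (fun {a b} => (h.comul_mul a b).trans (hmul _ _).symm)
  let iH : HopfAlgebra ℚ M :=
    { iB with
      antipode := H.antipode
      mul_antipode_rTensor_comul := LinearMap.ext fun a => by
        rw [hmul']
        exact (h.antipode_left a).trans (hunit _).symm
      mul_antipode_lTensor_comul := LinearMap.ext fun a => by
        rw [hmul']
        exact (h.antipode_right a).trans (hunit _).symm }
  refine ⟨M, iR, iH, LinearEquiv.refl ℚ M, fun _ _ => rfl, rfl, fun a => ?_, fun _ => rfl,
    fun _ => rfl⟩
  change H.comul a = TensorProduct.map LinearMap.id LinearMap.id (H.comul a)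
  rw [TensorProduct.map_id, LinearMap.id_apply]

/-- The pairing `(a ⊗ a' ∣ b ⊗ b') = (a ∣ b) (a' ∣ b')`. -/
def prodPairing (B : M →ₗ[ℚ] N →ₗ[ℚ] ℚ) (B' : M' →ₗ[ℚ] N' →ₗ[ℚ] ℚ) :
    M ⊗[ℚ] M' →ₗ[ℚ] N ⊗[ℚ] N' →ₗ[ℚ] ℚ :=
  TensorProduct.dualDistrib ℚ N N' ∘ₗ TensorProduct.map B B'

theorem tensorPairing_eq (B : M →ₗ[ℚ] N →ₗ[ℚ] ℚ) : tensorPairing B = prodPairing B B := rfl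

theorem prodPairing_tmul (B : M →ₗ[ℚ] N →ₗ[ℚ] ℚ) (B' : M' →ₗ[ℚ] N' →ₗ[ℚ] ℚ) (a : M) (a' : M')
    (b : N) (b' : N') : prodPairing B B' (a ⊗ₜ a') (b ⊗ₜ b') = B a b * B' a' b' := rfl

theorem prodPairing_separatingRight {B : M →ₗ[ℚ] N →ₗ[ℚ] ℚ} {B' : M' →ₗ[ℚ] N' →ₗ[ℚ] ℚ}
    (hB : B.SeparatingRight) (hB' : B'.SeparatingRight) {T : N ⊗[ℚ] N'}
    (hT : ∀ a a', prodPairing B B' (a ⊗ₜ a') T = 0) : T = 0 := by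
  -- contract the first factor, then compare coefficients for a basis of `N'`
  let c : M → N ⊗[ℚ] N' →ₗ[ℚ] N' := fun a => TensorProduct.lid ℚ N' ∘ₗ (B a).rTensor N'
  have hc : ∀ a a', ∀ T : N ⊗[ℚ] N', B' a' (c a T) = prodPairing B B' (a ⊗ₜ a') T := by
    intro a a' T
    induction T using TensorProduct.induction_on with
    | zero => simp
    | add s t hs ht => rw [map_add, map_add, hs, ht, map_add]
    | tmul b b' => simp [c, prodPairing_tmul]
  have hc0 : ∀ a, c a T = 0 := fun a => hB' _ fun a' => by rw [hc, hT]
  let b := Module.Basis.ofVectorSpace ℚ N'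
  obtain ⟨z, rfl⟩ := TensorProduct.eq_repr_basis_right b T
  have hz : ∀ i, z i = 0 := fun i => hB _ fun a => by
    have h := hc0 a
    have e : c a (z.sum fun i m => m ⊗ₜ[ℚ] b i) = z.sum fun i m => B a m • b i := by
      rw [Finsupp.sum, map_sum]
      rfl
    rw [e] at h
    classical
    have h' := congrArg (fun v => b.repr v i) h
    simp only [Finsupp.sum, map_sum, map_smul, Module.Basis.repr_self, map_zero,
      Finsupp.coe_zero, Pi.zero_apply, Finsupp.finsetSum_apply, Finsupp.smul_apply,
      smul_eq_mul, Finsupp.single_apply, mul_ite, mul_one, mul_zero, Finset.sum_ite_eq'] at h'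
    split_ifs at h' with hi
    · exact h'
    · rw [Finsupp.notMem_support_iff.mp hi, map_zero]
  have : z = 0 := Finsupp.ext hz
  rw [this, Finsupp.sum_zero_index]

variable {B : M →ₗ[ℚ] N →ₗ[ℚ] ℚ} {H : HopfOps M} {K : HopfOps N}

/-- The operations dual to those of a Hopf algebra satisfy the laws of a Hopf algebra. -/
theorem HopfOps.Laws.dual (h : H.Laws) (hB : B.SeparatingRight)
    (mul_comul : ∀ x y z, B (H.mul x y) z = tensorPairing B (x ⊗ₜ[ℚ] y) (K.comul z))
    (comul_mul : ∀ x y z, B x (K.mul y z) = tensorPairing B (H.comul x) (y ⊗ₜ[ℚ] z))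
    (one_counit : ∀ z, B H.one z = K.counit z) (counit_one : ∀ x, B x K.one = H.counit x)
    (antipode : ∀ x z, B (H.antipode x) z = B x (K.antipode z)) : K.Laws := by
  rw [tensorPairing_eq] at mul_comul comul_mul
  have ext1 : ∀ {a b : N}, (∀ x, B x a = B x b) → a = b := fun {a b} e =>
    sub_eq_zero.mp (hB _ fun x => by rw [map_sub, e, sub_self])
  have sep2 : (prodPairing B B).SeparatingRight := fun T hT =>
    prodPairing_separatingRight hB hB fun a a' => hT _
  have ext2 : ∀ {s t : N ⊗[ℚ] N},
      (∀ x y, prodPairing B B (x ⊗ₜ y) s = prodPairing B B (x ⊗ₜ y) t) → s = t := fun {s t} e =>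
    sub_eq_zero.mp (prodPairing_separatingRight hB hB fun x y => by rw [map_sub, e, sub_self])
  have ext3 : ∀ {s t : N ⊗[ℚ] (N ⊗[ℚ] N)},
      (∀ x y z, prodPairing B (prodPairing B B) (x ⊗ₜ (y ⊗ₜ z)) s =
        prodPairing B (prodPairing B B) (x ⊗ₜ (y ⊗ₜ z)) t) → s = t := fun {s t} e =>
    sub_eq_zero.mp (prodPairing_separatingRight hB sep2 fun x u => by
      induction u using TensorProduct.induction_on with
      | zero => simp
      | add u v hu hv => rw [TensorProduct.tmul_add, map_add, LinearMap.add_apply, hu, hv, add_zero]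
      | tmul y z => rw [map_sub, e, sub_self])
  -- the pairings of triple tensor products are compatible with the associator
  have assoc3 : ∀ (s : (M ⊗[ℚ] M) ⊗[ℚ] M) (t : (N ⊗[ℚ] N) ⊗[ℚ] N),
      prodPairing B (prodPairing B B) (TensorProduct.assoc ℚ M M M s)
        (TensorProduct.assoc ℚ N N N t) = prodPairing (prodPairing B B) B s t := by
    intro s t
    induction s using TensorProduct.induction_on with
    | zero => simp
    | add s s' hs hs' => simp only [map_add, LinearMap.add_apply, hs, hs']
    | tmul p c =>
      induction p using TensorProduct.induction_on with
      | zero => simp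
      | add s s' hs hs' => simp only [TensorProduct.add_tmul, map_add, LinearMap.add_apply, hs, hs']
      | tmul a b =>
        induction t using TensorProduct.induction_on with
        | zero => simp
        | add s s' hs hs' => simp only [map_add, hs, hs']
        | tmul q c' =>
          induction q using TensorProduct.induction_on with
          | zero => simp
          | add s s' hs hs' => simp only [TensorProduct.add_tmul, map_add, hs, hs']
          | tmul a' b' =>
            simp only [TensorProduct.assoc_tmul, prodPairing_tmul]; ring
  have mulL : ∀ (t : M ⊗[ℚ] M) a b c, prodPairing B B t (K.mul a b ⊗ₜ c) =
      prodPairing (prodPairing B B) B (TensorProduct.map H.comul LinearMap.id t)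
        ((a ⊗ₜ b) ⊗ₜ c) := fun t a b c => by
    induction t using TensorProduct.induction_on with
    | zero => simp
    | add s s' hs hs' => simp only [map_add, LinearMap.add_apply, hs, hs']
    | tmul x y =>
      rw [prodPairing_tmul, TensorProduct.map_tmul, prodPairing_tmul, comul_mul]; rfl
  have mulR : ∀ (t : M ⊗[ℚ] M) a b c, prodPairing B B t (a ⊗ₜ K.mul b c) =
      prodPairing B (prodPairing B B) (TensorProduct.map LinearMap.id H.comul t)
        (a ⊗ₜ (b ⊗ₜ c)) := fun t a b c => by
    induction t using TensorProduct.induction_on with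
    | zero => simp
    | add s s' hs hs' => simp only [map_add, LinearMap.add_apply, hs, hs']
    | tmul x y =>
      rw [prodPairing_tmul, TensorProduct.map_tmul, prodPairing_tmul, comul_mul]; rfl
  have comulL : ∀ x y z (t : N ⊗[ℚ] N), prodPairing (prodPairing B B) B ((x ⊗ₜ y) ⊗ₜ z)
      (TensorProduct.map K.comul LinearMap.id t) = prodPairing B B (H.mul x y ⊗ₜ z) t :=
    fun x y z t => by
    induction t using TensorProduct.induction_on with
    | zero => simp
    | add s s' hs hs' => simp only [map_add, hs, hs']
    | tmul a b =>
      rw [prodPairing_tmul, TensorProduct.map_tmul, prodPairing_tmul, mul_comul]; rfl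
  have comulR : ∀ x y z (t : N ⊗[ℚ] N), prodPairing B (prodPairing B B) (x ⊗ₜ (y ⊗ₜ z))
      (TensorProduct.map LinearMap.id K.comul t) = prodPairing B B (x ⊗ₜ H.mul y z) t :=
    fun x y z t => by
    induction t using TensorProduct.induction_on with
    | zero => simp
    | add s s' hs hs' => simp only [map_add, hs, hs']
    | tmul a b =>
      rw [prodPairing_tmul, TensorProduct.map_tmul, prodPairing_tmul, mul_comul]; rfl
  have lift_mul : ∀ x (t : N ⊗[ℚ] N), B x (TensorProduct.lift K.mul t) =
      prodPairing B B (H.comul x) t := fun x t => by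
    induction t using TensorProduct.induction_on with
    | zero => simp
    | add s s' hs hs' => simp only [map_add, hs, hs']
    | tmul a b => rw [TensorProduct.lift.tmul, comul_mul]
  have lift_comul : ∀ (t : M ⊗[ℚ] M) z, prodPairing B B t (K.comul z) =
      B (TensorProduct.lift H.mul t) z := fun t z => by
    induction t using TensorProduct.induction_on with
    | zero => simp
    | add s s' hs hs' => simp only [map_add, LinearMap.add_apply, hs, hs']
    | tmul a b => rw [TensorProduct.lift.tmul, mul_comul]
  have adjoint : ∀ {f g : M →ₗ[ℚ] M} {f' g' : N →ₗ[ℚ] N}, (∀ x z, B (f x) z = B x (f' z)) →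
      (∀ x z, B (g x) z = B x (g' z)) → ∀ s t, prodPairing B B (TensorProduct.map f g s) t =
        prodPairing B B s (TensorProduct.map f' g' t) := fun {f g f' g'} hf hg s t => by
    induction s using TensorProduct.induction_on with
    | zero => simp
    | add s s' hs hs' => simp only [map_add, LinearMap.add_apply, hs, hs']
    | tmul x y =>
      induction t using TensorProduct.induction_on with
      | zero => simp
      | add s s' hs hs' => simp only [map_add, hs, hs']
      | tmul a b => simp only [TensorProduct.map_tmul, prodPairing_tmul, hf, hg]
  have hcl : ∀ x (t : M ⊗[ℚ] M) (_ : t = H.comul x) (z : N), prodPairing B B t (K.one ⊗ₜ z) =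
      B x z := fun x t ht z => by
    have e : ∀ t : M ⊗[ℚ] M, prodPairing B B t (K.one ⊗ₜ z) =
        B (TensorProduct.lid ℚ M (TensorProduct.map H.counit LinearMap.id t)) z := fun t => by
      induction t using TensorProduct.induction_on with
      | zero => simp
      | add s s' hs hs' => simp only [map_add, LinearMap.add_apply, hs, hs']
      | tmul a b => simp [prodPairing_tmul, counit_one]
    rw [e, ht, h.counit_left, TensorProduct.lid_tmul, one_smul]
  have hcr : ∀ x (t : M ⊗[ℚ] M) (_ : t = H.comul x) (z : N), prodPairing B B t (z ⊗ₜ K.one) =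
      B x z := fun x t ht z => by
    have e : ∀ t : M ⊗[ℚ] M, prodPairing B B t (z ⊗ₜ K.one) =
        B (TensorProduct.rid ℚ M (TensorProduct.map LinearMap.id H.counit t)) z := fun t => by
      induction t using TensorProduct.induction_on with
      | zero => simp
      | add s s' hs hs' => simp only [map_add, LinearMap.add_apply, hs, hs']
      | tmul a b => simp [prodPairing_tmul, counit_one, mul_comm]
    rw [e, ht, h.counit_right, TensorProduct.rid_tmul, one_smul]
  refine
    { mul_assoc := fun a b c => ext1 fun x => ?_
      one_mul := fun a => ext1 fun x => ?_
      mul_one := fun a => ext1 fun x => ?_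
      coassoc := fun a => ext3 fun x y z => ?_
      counit_left := fun a => ?_
      counit_right := fun a => ?_
      comul_one := ext2 fun x y => ?_
      comul_mul := fun a b => ext2 fun x y => ?_
      counit_one := ?_
      counit_mul := fun a b => ?_
      antipode_left := fun a => ext1 fun x => ?_
      antipode_right := fun a => ext1 fun x => ?_ }
  · rw [comul_mul, comul_mul, mulL, mulR, ← h.coassoc, ← assoc3]; rfl
  · rw [comul_mul, hcl x _ rfl]
  · rw [comul_mul, hcr x _ rfl]
  · rw [comulR, ← mul_comul, ← h.mul_assoc, mul_comul, ← comulL, ← assoc3]; rfl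
  · apply (TensorProduct.lid ℚ N).injective
    refine ext1 fun x => ?_
    have e : ∀ t : N ⊗[ℚ] N, B x (TensorProduct.lid ℚ N (TensorProduct.map K.counit LinearMap.id t))
        = prodPairing B B (H.one ⊗ₜ x) t := fun t => by
      induction t using TensorProduct.induction_on with
      | zero => simp
      | add s s' hs hs' => simp only [map_add, hs, hs']
      | tmul a b => simp [prodPairing_tmul, one_counit]
    rw [e, ← mul_comul, h.one_mul, TensorProduct.lid_tmul, one_smul]
  · apply (TensorProduct.rid ℚ N).injective
    refine ext1 fun x => ?_
    have e : ∀ t : N ⊗[ℚ] N, B x (TensorProduct.rid ℚ N (TensorProduct.map LinearMap.id K.counit t))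
        = prodPairing B B (x ⊗ₜ H.one) t := fun t => by
      induction t using TensorProduct.induction_on with
      | zero => simp
      | add s s' hs hs' => simp only [map_add, hs, hs']
      | tmul a b => simp [prodPairing_tmul, one_counit, mul_comm]
    rw [e, ← mul_comul, h.mul_one, TensorProduct.rid_tmul, one_smul]
  · rw [← mul_comul, counit_one, h.counit_mul, prodPairing_tmul, counit_one, counit_one]
  · rw [← mul_comul, comul_mul, h.comul_mul]
    -- both sides are the pairing of `x₍₁₎ ⊗ y₍₁₎ ⊗ x₍₂₎ ⊗ y₍₂₎` with `a₍₁₎ ⊗ a₍₂₎ ⊗ b₍₁₎ ⊗ b₍₂₎`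
    let Q : M ⊗[ℚ] M → M ⊗[ℚ] M → N ⊗[ℚ] N → N ⊗[ℚ] N → ℚ := fun u v s t =>
      prodPairing (prodPairing B B) (prodPairing B B)
        (TensorProduct.tensorTensorTensorComm ℚ M M M M (u ⊗ₜ v)) (s ⊗ₜ t)
    have h1 : ∀ u v, prodPairing B B (TensorProduct.map₂ H.mul H.mul u v) (a ⊗ₜ b) =
        Q u v (K.comul a) (K.comul b) := fun u v => by
      induction u using TensorProduct.induction_on with
      | zero => simp [Q]
      | add s s' hs hs' =>
        simp only [Q, map_add, LinearMap.add_apply, TensorProduct.add_tmul] at hs hs' ⊢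
        rw [hs, hs']
      | tmul u1 u2 =>
        induction v using TensorProduct.induction_on with
        | zero => simp [Q]
        | add s s' hs hs' =>
          simp only [Q, map_add, LinearMap.add_apply, TensorProduct.tmul_add] at hs hs' ⊢
          rw [hs, hs']
        | tmul v1 v2 =>
          simp only [Q, TensorProduct.map₂_apply_tmul, TensorProduct.map_tmul, prodPairing_tmul,
            TensorProduct.tensorTensorTensorComm_tmul, mul_comul]
    have h2 : ∀ s t, prodPairing B B (x ⊗ₜ y) (TensorProduct.map₂ K.mul K.mul s t) =
        Q (H.comul x) (H.comul y) s t := fun s t => by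
      induction s using TensorProduct.induction_on with
      | zero => simp [Q]
      | add s s' hs hs' =>
        simp only [Q, map_add, LinearMap.add_apply, TensorProduct.add_tmul] at hs hs' ⊢
        rw [hs, hs']
      | tmul s1 s2 =>
        induction t using TensorProduct.induction_on with
        | zero => simp [Q]
        | add s s' hs hs' =>
          simp only [Q, map_add, TensorProduct.tmul_add] at hs hs' ⊢
          rw [hs, hs']
        | tmul t1 t2 =>
          rw [TensorProduct.map₂_apply_tmul, TensorProduct.map_tmul, prodPairing_tmul, comul_mul,
            comul_mul]
          generalize H.comul x = u
          generalize H.comul y = v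
          induction u using TensorProduct.induction_on with
          | zero => simp [Q]
          | add s s' hs hs' =>
            simp only [Q, map_add, LinearMap.add_apply, TensorProduct.add_tmul, add_mul] at hs hs' ⊢
            rw [hs, hs']
          | tmul u1 u2 =>
            induction v using TensorProduct.induction_on with
            | zero => simp [Q]
            | add s s' hs hs' =>
              simp only [Q, map_add, LinearMap.add_apply, TensorProduct.tmul_add, mul_add]
                at hs hs' ⊢
              rw [hs, hs']
            | tmul v1 v2 =>
              simp only [Q, prodPairing_tmul, TensorProduct.tensorTensorTensorComm_tmul]
              ring
    rw [h1, h2]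
  · rw [← one_counit, counit_one, h.counit_one]
  · rw [← one_counit, comul_mul, h.comul_one, prodPairing_tmul, one_counit, one_counit]
  · rw [lift_mul, ← adjoint (g := LinearMap.id) (g' := LinearMap.id) antipode (fun _ _ => rfl),
      lift_comul, h.antipode_left, map_smul,
      LinearMap.smul_apply, one_counit, map_smul, counit_one, smul_eq_mul, smul_eq_mul, mul_comm]
  · rw [lift_mul, ← adjoint (f := LinearMap.id) (f' := LinearMap.id) (fun _ _ => rfl) antipode,
      lift_comul, h.antipode_right, map_smul,
      LinearMap.smul_apply, one_counit, map_smul, counit_one, smul_eq_mul, smul_eq_mul, mul_comm]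

end Duality

/-! ### Sums over lower indices -/

theorem sum_map_flatMap {α β M : Type*} [AddCommMonoid M] (L : List α) (f : α → List β)
    (g : β → M) : ((L.flatMap f).map g).sum = (L.map fun x => ((f x).map g).sum).sum := by
  induction L with
  | nil => rfl
  | cons a L ih => simp [List.flatMap_cons, ih]

theorem sum_map_comm {α β M : Type*} [AddCommMonoid M] (L : List α) (L' : List β)
    (F : α → β → M) : (L.map fun a => (L'.map fun b => F a b).sum).sum =
      (L'.map fun b => (L.map fun a => F a b).sum).sum := by
  induction L with
  | nil => simp
  | cons a L ih => simp [ih, List.sum_map_add]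

theorem sum_map_sub {α M : Type*} [AddCommGroup M] (L : List α) (F G : α → M) :
    (L.map fun a => F a - G a).sum = (L.map F).sum - (L.map G).sum := by
  induction L with
  | nil => simp
  | cons a L ih => simp only [List.map_cons, List.sum_cons, ih]; abel

theorem sum_below_cons {M : Type*} [AddCommMonoid M] (k : ℕ) (ks : List ℕ) (F : List ℕ → M) :
    ((below (k :: ks)).map F).sum =
      ∑ l ∈ Finset.range (k + 1), ((below ks).map fun ls => F (l :: ls)).sum := by
  rw [below, sum_map_flatMap]
  simp only [List.map_map]
  rfl

theorem sum_below_append {M : Type*} [AddCommMonoid M] (k k' : List ℕ) (F : List ℕ → M) :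
    ((below (k ++ k')).map F).sum =
      ((below k).map fun l => ((below k').map fun l' => F (l ++ l')).sum).sum := by
  induction k generalizing F with
  | nil => simp [below]
  | cons a k ih =>
    rw [List.cons_append, sum_below_cons, sum_below_cons]
    refine Finset.sum_congr rfl fun l _ => ?_
    rw [ih]
    rfl

theorem mem_below {k l : List ℕ} : l ∈ below k ↔ List.Forall₂ (· ≤ ·) l k := by
  induction k generalizing l with
  | nil => simp [below]
  | cons a k ih =>
    simp only [below, List.mem_flatMap, List.mem_range, List.mem_map, ih]
    constructor
    · rintro ⟨b, hb, ls, hls, rfl⟩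
      exact .cons (by omega) hls
    · intro h
      cases h with
      | cons hb hls => exact ⟨_, by omega, _, hls, rfl⟩

theorem length_of_mem_below {k l : List ℕ} (h : l ∈ below k) : l.length = k.length :=
  (mem_below.mp h).length_eq

theorem sum_le_of_mem_below {k l : List ℕ} (h : l ∈ below k) : l.sum ≤ k.sum :=
  (mem_below.mp h).sum_le_sum

theorem mult_nil : mult [] [] = 1 := rfl

theorem mult_cons (a b : ℕ) (k l : List ℕ) : mult (a :: k) (b :: l) = mult₁ a b * mult k l := by
  simp [mult]

theorem mult_append {k l : List ℕ} (h : l.length = k.length) (k' l' : List ℕ) :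
    mult (k ++ k') (l ++ l') = mult k l * mult k' l' := by
  rw [mult, List.zipWith_append h.symm, List.prod_append]
  rfl

theorem wordWt_cons (a : ℕ) (w : List ℕ) : wordWt (a :: w) = letterWt a + wordWt w := by
  simp [wordWt]

theorem wordWt_append (u v : List ℕ) : wordWt (u ++ v) = wordWt u + wordWt v := by
  simp [wordWt]

theorem mult₁_weight {k l : ℕ} (hl : l ≤ k) (h : mult₁ k l ≠ 0) :
    letterWt l + (k - l) = letterWt k := by
  unfold mult₁ at h
  split_ifs at h with h1 h2
  · obtain ⟨rfl, rfl⟩ := h1; rfl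
  · exact absurd rfl h
  · rw [letterWt, letterWt, if_neg (by tauto), if_neg (by tauto)]; omega

/-- The multiplicities are compatible with the weight. -/
theorem mult_weight {k l : List ℕ} (hl : l ∈ below k) (h : mult k l ≠ 0) :
    wordWt l + (k.sum - l.sum) = wordWt k := by
  have hl' := mem_below.mp hl
  induction hl' with
  | nil => rfl
  | @cons b a l k hb hls ih =>
    rw [mult_cons] at h
    have h1 := mult₁_weight hb (left_ne_zero_of_mul h)
    have h2 := ih (mem_below.mpr hls) (right_ne_zero_of_mul h)
    have h3 := hls.sum_le_sum
    rw [wordWt_cons, wordWt_cons, List.sum_cons, List.sum_cons]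
    omega

/-- Translates of words. -/
theorem shift_word (k : List ℕ) : shift (word k) = ((below k).map fun l =>
    mult k l • Polynomial.monomial (k.sum - l.sum) (word l)).sum := by
  induction k with
  | nil => simp [below, word_nil, mult_nil]
  | cons a k ih =>
    rw [word_cons, map_mul, ih, shift_letter, shiftLetter, sum_below_cons, Finset.sum_mul]
    refine Finset.sum_congr rfl fun b hb => ?_
    rw [← List.sum_map_mul_left]
    refine congrArg List.sum (List.map_congr_left fun l hl => ?_)
    have h1 := sum_le_of_mem_below hl
    have h2 := Finset.mem_range.mp hb
    rw [smul_mul_smul_comm, Polynomial.monomial_mul_monomial, mult_cons, ← word_cons,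
      List.sum_cons, List.sum_cons, show a - b + (k.sum - l.sum) = a + k.sum - (b + l.sum) by omega]

/-! ### The free Lie algebra embeds into the free associative algebra -/

/-- The right-normed bracket of the letters of a word. -/
def bracketWord : List ℕ → LieV
  | [] => 0
  | [a] => FreeLieAlgebra.of ℚ a
  | a :: w => ⁅FreeLieAlgebra.of ℚ a, bracketWord w⁆

/-- The linear map given by right-normed brackets; its composition with `Lie(V) → ℚ⟨V⟩` is the
Dynkin operator. -/
def bracketMap : QV →ₗ[ℚ] LieV := wordBasis.constr ℚ fun w => bracketWord w.toList

theorem bracketMap_word (w : List ℕ) : bracketMap (word w) = bracketWord w := by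
  have h : word w = wordBasis (FreeMonoid.ofList w) := (wordBasis_apply _).symm
  rw [bracketMap, h, Module.Basis.constr_basis]
  rfl

theorem bracketMap_one : bracketMap 1 = 0 := bracketMap_word []

/-- Left multiplication by a Lie element becomes a bracket, up to the constant term of `A`. -/
theorem bracketMap_lie_mul (x : LieV) (A : QV) :
    bracketMap (lieToQV x * A) = ⁅x, bracketMap A⁆ + counit A • bracketMap (lieToQV x) := by
  induction x using lie_induction generalizing A with
  | of i =>
    rw [lieToQV_of]
    induction A using word_induction with
    | word w =>
      rw [← word_cons, bracketMap_word, bracketMap_word, bracketMap_word, counit_word]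
      rcases w with _ | ⟨b, w⟩ <;> simp [bracketWord]
    | add A B hA hB => simp only [mul_add, map_add, hA, hB, lie_add, add_smul]; abel
    | smul c A hA =>
      simp only [mul_smul_comm, map_smul, hA, lie_smul, smul_add, smul_smul, smul_eq_mul]
  | lie x y hx hy =>
    have h : ∀ A, bracketMap (lieToQV ⁅x, y⁆ * A) = ⁅⁅x, y⁆, bracketMap A⁆ +
        counit A • (⁅x, bracketMap (lieToQV y)⁆ - ⁅y, bracketMap (lieToQV x)⁆) := fun A => by
      rw [lieToQV_lie, sub_mul, map_sub, mul_assoc, mul_assoc, hx, hy (lieToQV x * A), hy, hx A,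
        counit_mul,
        counit_mul, counit_of_mem (lieToQV_mem x), counit_of_mem (lieToQV_mem y), lie_lie]
      simp only [lie_add, lie_smul, zero_mul, zero_smul, smul_sub]
      abel
    have h1 := h 1
    rw [mul_one, bracketMap_one, lie_zero, counit_one, one_smul, zero_add] at h1
    rw [h, h1]
  | add x y hx hy => simp only [map_add, add_mul, hx, hy, add_lie, smul_add]; abel
  | smul c x hx =>
    simp only [map_smul, smul_mul_assoc, hx, smul_lie, smul_add]
    rw [smul_comm]

/-- The Dynkin operator multiplies a Lie monomial by its number of letters. -/
theorem bracketMap_tree (t : FreeMagma ℕ) : bracketMap (lieToQV (toLie (tree t))) =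
    ((leaves t).length : ℚ) • toLie (tree t) := by
  induction t using FreeMagma.rec with
  | of i => rw [toLie_of, lieToQV_of, bracketMap_word]; simp [bracketWord, leaves]
  | mul t u ht hu =>
    rw [tree_mul, toLie_mul, lieToQV_lie, map_sub, bracketMap_lie_mul, bracketMap_lie_mul, ht, hu,
      counit_of_mem (lieToQV_mem _), counit_of_mem (lieToQV_mem _), leaves, List.length_append]
    rw [lie_smul, lie_smul, ← lie_skew (toLie (tree u)) (toLie (tree t))]
    push_cast
    module

theorem leaves_length_pos (t : FreeMagma ℕ) : 0 < (leaves t).length := by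
  induction t using FreeMagma.rec with
  | of i => simp [leaves]
  | mul t u ht hu => rw [leaves, List.length_append]; omega

/-- `Lie(V) → ℚ⟨V⟩` is injective, as the Dynkin operator has no eigenvalue zero. -/
theorem lieToQV_injective : Function.Injective lieToQV := by
  let E : Module.End ℚ LieV := bracketMap ∘ₗ (lieToQV : LieV →ₗ[ℚ] QV)
  have hE : ∀ x, E x = bracketMap (lieToQV x) := fun _ => rfl
  have hmem : ∀ x, x ∈ ⨆ (μ : ℚ) (_ : μ ≠ 0), E.eigenspace μ := by
    intro x
    induction x using lie_tree_induction with
    | tree t =>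
      have h0 : ((leaves t).length : ℚ) ≠ 0 := by
        exact_mod_cast (leaves_length_pos t).ne'
      refine Submodule.mem_iSup_of_mem _ (Submodule.mem_iSup_of_mem h0 ?_)
      rw [Module.End.mem_eigenspace_iff, hE, bracketMap_tree]
    | add x y hx hy => exact add_mem hx hy
    | smul c x hx => exact Submodule.smul_mem _ c hx
  rw [injective_iff_map_eq_zero]
  intro x hx
  have h0 : x ∈ E.eigenspace 0 := by
    rw [Module.End.mem_eigenspace_iff, hE, hx, map_zero, zero_smul]
  exact Submodule.disjoint_def.mp (E.eigenspaces_iSupIndep 0) x h0 (hmem x)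

/-! ### The post-Lie algebra -/

theorem exists_lieToQV_eq_triExt (x y : LieV) :
    ∃ z, lieToQV z = triExt (lieToQV x) (lieToQV y) :=
  triExt_mem (lieToQV_mem x) (lieToQV_mem y)

/-- The Lie element `x ▷_a y`, as an element of `Lie(V)`. -/
def triLie (x y : LieV) : LieV := (exists_lieToQV_eq_triExt x y).choose

theorem lieToQV_triLie (x y : LieV) : lieToQV (triLie x y) = triExt (lieToQV x) (lieToQV y) :=
  (exists_lieToQV_eq_triExt x y).choose_spec

/-- The post-Lie product `▷_a` on `Lie(V)`. -/
def tri : LieV →ₗ[ℚ] LieV →ₗ[ℚ] LieV :=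
  LinearMap.mk₂ ℚ triLie
    (fun x x' y => lieToQV_injective (by
      simp only [map_add, lieToQV_triLie, LinearMap.add_apply]))
    (fun c x y => lieToQV_injective (by
      simp only [map_smul, lieToQV_triLie, LinearMap.smul_apply]))
    (fun x y y' => lieToQV_injective (by simp only [map_add, lieToQV_triLie]))
    (fun c x y => lieToQV_injective (by simp only [map_smul, lieToQV_triLie]))

theorem lieToQV_tri (x y : LieV) : lieToQV (tri x y) = triExt (lieToQV x) (lieToQV y) :=
  lieToQV_triLie x y

theorem isExtension_triExt : IsExtension tri triExt where
  ext_lie x y := (lieToQV_tri x y).symm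
  ext_one x := (isLieDerivation_triExt (lieToQV_mem x)).map_one
  one_ext := one_triExt
  mul_ext x A _ := triExt_lie_mul (lieToQV_mem x) A _
  ext_mul := triExt_mul

theorem isPostLie_tri : IsPostLie tri where
  tri_lie x y z := lieToQV_injective (by
    have hd := isLieDerivation_triExt (lieToQV_mem x)
    simp only [lieToQV_tri, lieToQV_lie, map_add, map_sub, hd.leibniz]
    abel)
  lie_tri x y z := lieToQV_injective (by
    simp only [lieToQV_tri, lieToQV_lie, map_add, map_sub, LinearMap.sub_apply,
      triExt_lie_mul (lieToQV_mem x), triExt_lie_mul (lieToQV_mem y)]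
    abel)

theorem leaves_relabel (t : FreeMagma ℕ) {l : List ℕ} (h : l.length = (leaves t).length) :
    leaves (relabel t l) = l := by
  induction t using FreeMagma.rec generalizing l with
  | of i =>
    obtain ⟨a, rfl⟩ := List.length_eq_one_iff.mp h
    rfl
  | mul t u ht hu =>
    rw [leaves, List.length_append] at h
    rw [relabel, leaves, ht (by rw [List.length_take]; omega), hu (by rw [List.length_drop]; omega),
      List.take_append_drop]

/-- Translates of Lie monomials. -/
theorem shift_tree (t : FreeMagma ℕ) : shift (lieToQV (toLie (tree t))) =
    ((below (leaves t)).map fun l => mult (leaves t) l •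
      Polynomial.monomial ((leaves t).sum - l.sum) (lieToQV (toLie (tree (relabel t l))))).sum := by
  induction t using FreeMagma.rec with
  | of k =>
    rw [toLie_of, lieToQV_of, shift_word]
    refine congrArg List.sum (List.map_congr_left fun l hl => ?_)
    obtain ⟨a, rfl⟩ := List.length_eq_one_iff.mp (length_of_mem_below hl)
    rw [relabel, List.headD_cons, toLie_of, lieToQV_of]
    rfl
  | mul t u ht hu =>
    have key : ∀ (k k' : List ℕ) (F F' : List ℕ → QV),
        ((below k).map fun l => mult k l • Polynomial.monomial (k.sum - l.sum) (F l)).sum *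
          ((below k').map fun l => mult k' l • Polynomial.monomial (k'.sum - l.sum) (F' l)).sum =
        ((below k).map fun l => ((below k').map fun l' => (mult k l * mult k' l') •
          Polynomial.monomial (k.sum - l.sum + (k'.sum - l'.sum)) (F l * F' l')).sum).sum := by
      intro k k' F F'
      rw [← List.sum_map_mul_right]
      refine congrArg List.sum (List.map_congr_left fun l hl => ?_)
      rw [← List.sum_map_mul_left]
      refine congrArg List.sum (List.map_congr_left fun l' hl' => ?_)
      rw [smul_mul_smul_comm, Polynomial.monomial_mul_monomial]
    rw [tree_mul, toLie_mul, lieToQV_lie, map_sub, map_mul, map_mul, ht, hu, key, key,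
      sum_map_comm (below (leaves u)), leaves, sum_below_append, ← sum_map_sub]
    refine congrArg List.sum (List.map_congr_left fun l hl => ?_)
    rw [← sum_map_sub]
    refine congrArg List.sum (List.map_congr_left fun l' hl' => ?_)
    have h1 := sum_le_of_mem_below hl
    have h2 := sum_le_of_mem_below hl'
    have h3 := length_of_mem_below hl
    rw [mult_append h3, relabel, tree_mul, toLie_mul, lieToQV_lie, List.take_left' h3,
      List.drop_left' h3, map_sub, smul_sub, mul_comm (mult (leaves u) l'),
      add_comm ((leaves u).sum - l'.sum), List.sum_append, List.sum_append,
      show (leaves t).sum - l.sum + ((leaves u).sum - l'.sum) =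
        (leaves t).sum + (leaves u).sum - (l.sum + l'.sum) by omega]

theorem triMagma_tree (t u : FreeMagma ℕ) : triMagma (tree t) (tree u) = triTree t u := by
  have h : ∀ t, tree t = MonoidAlgebra.basis (FreeMagma ℕ) ℚ t := fun t =>
    (MonoidAlgebra.basis_apply _ _).symm
  rw [triMagma, h, Module.Basis.constr_basis, h, Module.Basis.constr_basis]

theorem toLie_add (x y : MQ) : toLie (x + y) = toLie x + toLie y := rfl

theorem toLie_smul (c : ℚ) (x : MQ) : toLie (c • x) = c • toLie x := rfl

theorem toLie_list_sum (L : List MQ) : toLie L.sum = (L.map toLie).sum :=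
  map_list_sum toLieLinear L

/-- On Lie monomials, `triExt` is given by the formula on the free magma. -/
theorem lieToQV_toLie_triTree (t u : FreeMagma ℕ) : lieToQV (toLie (triTree t u)) =
    triExt (lieToQV (toLie (tree t))) (lieToQV (toLie (tree u))) := by
  induction u using FreeMagma.rec with
  | of s =>
    rw [toLie_of, lieToQV_of, triExt_letter]
    rcases s with _ | s
    · rw [triLetter_zero, counit_of_mem (lieToQV_mem _), zero_smul, triTree, if_pos rfl]
      exact map_zero lieToQV
    · rw [triTree, if_neg (Nat.succ_ne_zero s), toLie_list_sum, map_list_sum, triLetter_succ,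
        shift_tree, map_list_sum, List.map_map, List.map_map, List.map_map]
      refine congrArg List.sum (List.map_congr_left fun l _ => ?_)
      simp only [Function.comp_apply]
      rw [toLie_smul, map_smul, map_smul, twist_monomial, adj_of_mem (lieToQV_mem _), tree_mul,
        toLie_mul, lieToQV_lie, toLie_of, lieToQV_of]
  | mul u v hu hv =>
    rw [triTree, toLie_add, map_add, toLie_mul, toLie_mul, lieToQV_lie, lieToQV_lie, hu, hv,
      tree_mul, toLie_mul, lieToQV_lie]
    have hd := isLieDerivation_triExt (lieToQV_mem (toLie (tree t)))
    rw [map_sub, hd.leibniz, hd.leibniz]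
    abel

/-- The map `▷_a` descends from the magma algebra to the free Lie algebra. -/
theorem tri_toLie (x y : MQ) : tri (toLie x) (toLie y) = toLie (triMagma x y) := by
  induction x using tree_induction with
  | tree t =>
    induction y using tree_induction with
    | tree u =>
      apply lieToQV_injective
      rw [lieToQV_tri, triMagma_tree, lieToQV_toLie_triTree]
    | add A B hA hB => rw [toLie_add, map_add, hA, hB, map_add, toLie_add]
    | smul c A hA => rw [toLie_smul, map_smul, hA, map_smul, toLie_smul]
  | add A B hA hB =>
    rw [toLie_add, map_add, LinearMap.add_apply, hA, hB, map_add, LinearMap.add_apply, toLie_add]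
  | smul c A hA =>
    rw [toLie_smul, map_smul, LinearMap.smul_apply, hA, map_smul, LinearMap.smul_apply, toLie_smul]

/-! ### Weight gradings -/

theorem le_letterWt (i : ℕ) : i ≤ letterWt i := by
  unfold letterWt; split_ifs <;> omega

theorem letterWt_pos (i : ℕ) : 0 < letterWt i := by
  unfold letterWt; split_ifs <;> omega

theorem finite_words (n : ℕ) : {w : List ℕ | wordWt w ≤ n}.Finite := by
  induction n with
  | zero =>
    refine (Set.finite_singleton []).subset fun w hw => ?_
    rcases w with _ | ⟨a, w⟩
    · rfl
    · have h1 := letterWt_pos a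
      rw [Set.mem_ofPred_eq, wordWt_cons] at hw
      omega
  | succ n ih =>
    refine ((Set.finite_singleton []).union ((Set.finite_Iic (n + 1)).image2 List.cons ih)).subset
      fun w hw => ?_
    rcases w with _ | ⟨a, w⟩
    · exact Or.inl rfl
    · have h1 := letterWt_pos a
      have h2 := le_letterWt a
      rw [Set.mem_ofPred_eq, wordWt_cons] at hw
      exact Or.inr ⟨a, by simp only [Set.mem_Iic]; omega, w,
        by simp only [Set.mem_ofPred_eq]; omega, rfl⟩

theorem wordWt_leaves_pos (t : FreeMagma ℕ) : 0 < wordWt (leaves t) := by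
  induction t using FreeMagma.rec with
  | of i => simpa [leaves, wordWt] using letterWt_pos i
  | mul t u ht hu => rw [leaves, wordWt_append]; omega

theorem finite_trees (n : ℕ) : {t : FreeMagma ℕ | wordWt (leaves t) ≤ n}.Finite := by
  induction n with
  | zero =>
    refine Set.finite_empty.subset fun t ht => ?_
    have := wordWt_leaves_pos t
    rw [Set.mem_ofPred_eq] at ht
    omega
  | succ n ih =>
    refine (((Set.finite_Iic (n + 1)).image FreeMagma.of).union
      (ih.image2 FreeMagma.mul ih)).subset fun t ht => ?_
    rcases t with i | ⟨t, u⟩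
    · have h : letterWt i ≤ n + 1 := by simpa [leaves, wordWt] using ht
      exact Or.inl ⟨i, (le_letterWt i).trans h, rfl⟩
    · have h1 := wordWt_leaves_pos t
      have h2 := wordWt_leaves_pos u
      rw [Set.mem_ofPred_eq, leaves, wordWt_append] at ht
      exact Or.inr ⟨t, by simp only [Set.mem_ofPred_eq]; omega, u,
        by simp only [Set.mem_ofPred_eq]; omega, rfl⟩

/-- Subspaces `G n` that span are the pieces of a grading if some linear map acts on `G n` as the
scalar `2 ^ n`. -/
theorem isInternal_of_scaling {M : Type*} [AddCommGroup M] [Module ℚ M] {G : ℕ → Submodule ℚ M}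
    (E : Module.End ℚ M) (hE : ∀ n, ∀ x ∈ G n, E x = (2 : ℚ) ^ n • x) (hG : ∀ x, x ∈ ⨆ n, G n) :
    DirectSum.IsInternal G := by
  rw [DirectSum.isInternal_submodule_iff_iSupIndep_and_iSup_eq_top]
  refine ⟨?_, (Submodule.eq_top_iff'.mpr hG)⟩
  have h1 : iSupIndep fun n : ℕ => E.eigenspace ((2 : ℚ) ^ n) :=
    E.eigenspaces_iSupIndep.comp (pow_right_injective₀ (by norm_num) (by norm_num))
  exact h1.mono fun n x hx => Module.End.mem_eigenspace_iff.mpr (hE n x hx)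

theorem tree_mem_lieGrade (t : FreeMagma ℕ) : toLie (tree t) ∈ lieGrade (wordWt (leaves t)) :=
  Submodule.subset_span ⟨t, rfl, rfl⟩

theorem isInternal_lieGrade : DirectSum.IsInternal lieGrade := by
  let E : LieV →ₗ⁅ℚ⁆ LieV :=
    FreeLieAlgebra.lift ℚ fun i => (2 : ℚ) ^ letterWt i • FreeLieAlgebra.of ℚ i
  have htree : ∀ t, E (toLie (tree t)) = (2 : ℚ) ^ wordWt (leaves t) • toLie (tree t) := by
    intro t
    induction t using FreeMagma.rec with
    | of i =>
      rw [toLie_of, FreeLieAlgebra.lift_of_apply]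
      simp [leaves, wordWt]
    | mul t u ht hu =>
      rw [tree_mul, toLie_mul, LieHom.map_lie, ht, hu, smul_lie, lie_smul, smul_smul, leaves,
        wordWt_append, pow_add]
  refine isInternal_of_scaling E (fun n x hx => ?_) fun x => ?_
  · induction hx using Submodule.span_induction with
    | mem x hx => obtain ⟨t, rfl, rfl⟩ := hx; exact htree t
    | zero => simp
    | add x y _ _ hx hy => rw [map_add, hx, hy, smul_add]
    | smul c x _ hx => rw [map_smul, hx, smul_comm]
  · induction x using lie_tree_induction with
    | tree t => exact Submodule.mem_iSup_of_mem _ (tree_mem_lieGrade t)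
    | add x y hx hy => exact add_mem hx hy
    | smul c x hx => exact Submodule.smul_mem _ c hx

theorem finite_lieGrade (n : ℕ) : Module.Finite ℚ (lieGrade n) := by
  refine Module.Finite.span_of_finite ℚ (((finite_trees n).image fun t => toLie (tree t)).subset ?_)
  rintro x ⟨t, ht, rfl⟩
  exact ⟨t, ht.le, rfl⟩

/-- A bilinear map with values in `Q` on pairs of generators has values in `Q` on the spans. -/
theorem bilinear_mem_of_span {M N P : Type*} [AddCommGroup M] [Module ℚ M] [AddCommGroup N]
    [Module ℚ N] [AddCommGroup P] [Module ℚ P] (f : M →ₗ[ℚ] N →ₗ[ℚ] P) {s : Set M} {t : Set N}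
    {Q : Submodule ℚ P} (h : ∀ x ∈ s, ∀ y ∈ t, f x y ∈ Q) {x : M} {y : N}
    (hx : x ∈ Submodule.span ℚ s) (hy : y ∈ Submodule.span ℚ t) : f x y ∈ Q := by
  induction hx using Submodule.span_induction with
  | mem x hx =>
    induction hy using Submodule.span_induction with
    | mem y hy => exact h x hx y hy
    | zero => rw [map_zero]; exact zero_mem _
    | add x y _ _ hx hy => rw [map_add]; exact add_mem hx hy
    | smul c x _ hx => rw [map_smul]; exact Submodule.smul_mem _ c hx
  | zero => rw [map_zero, LinearMap.zero_apply]; exact zero_mem _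
  | add x y _ _ hx hy => rw [map_add, LinearMap.add_apply]; exact add_mem hx hy
  | smul c x _ hx => rw [map_smul, LinearMap.smul_apply]; exact Submodule.smul_mem _ c hx

theorem lie_mem_lieGrade {m n : ℕ} {x y : LieV} (hx : x ∈ lieGrade m) (hy : y ∈ lieGrade n) :
    ⁅x, y⁆ ∈ lieGrade (m + n) := by
  refine bilinear_mem_of_span (LieModule.toEnd ℚ LieV LieV : LieV →ₗ[ℚ] LieV →ₗ[ℚ] LieV) ?_ hx hy
  rintro _ ⟨t, rfl, rfl⟩ _ ⟨u, rfl, rfl⟩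
  have h := tree_mem_lieGrade (.mul t u)
  rw [tree_mul, toLie_mul, leaves, wordWt_append] at h
  exact h

theorem toLie_triTree_mem (t u : FreeMagma ℕ) :
    toLie (triTree t u) ∈ lieGrade (wordWt (leaves t) + wordWt (leaves u)) := by
  induction u using FreeMagma.rec with
  | of s =>
    rw [triTree]
    split_ifs with hs
    · exact zero_mem (lieGrade _)
    · rw [toLie_list_sum, List.map_map]
      refine list_sum_mem fun x hx => ?_
      obtain ⟨l, hl, rfl⟩ := List.mem_map.mp hx
      rw [Function.comp_apply, toLie_smul]
      by_cases h0 : mult (leaves t) l = 0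
      · rw [h0, zero_smul]; exact zero_mem _
      · have h1 := mult_weight hl h0
        have h2 := tree_mem_lieGrade
          (.mul (.of (s + ((leaves t).sum - l.sum))) (relabel t l))
        rw [leaves, leaves_relabel t (length_of_mem_below hl), leaves, List.cons_append,
          List.nil_append, wordWt_cons] at h2
        refine Submodule.smul_mem _ _ ?_
        convert h2 using 2
        rw [leaves, wordWt_cons, letterWt, letterWt, if_neg hs, if_neg (by omega)]
        simp only [wordWt, List.map_nil, List.sum_nil] at h1 ⊢
        omega
  | mul u v hu hv =>
    rw [triTree, toLie_add, toLie_mul, toLie_mul, leaves, wordWt_append]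
    refine add_mem ?_ ?_
    · rw [← add_assoc]
      exact lie_mem_lieGrade hu (tree_mem_lieGrade v)
    · rw [add_left_comm]
      exact lie_mem_lieGrade (tree_mem_lieGrade u) hv

theorem isGradedPostLie_tri : IsGradedPostLie tri lieGrade where
  toIsPostLie := isPostLie_tri
  internal := isInternal_lieGrade
  finite := finite_lieGrade
  lie_mem := lie_mem_lieGrade
  tri_mem hx hy := by
    refine bilinear_mem_of_span tri ?_ hx hy
    rintro _ ⟨t, rfl, rfl⟩ _ ⟨u, rfl, rfl⟩
    rw [tri_toLie, triMagma_tree]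
    exact toLie_triTree_mem t u

/-! ### The weight grading of the free associative algebra -/

theorem word_mem_wtGrade (w : List ℕ) : word w ∈ wtGrade (wordWt w) :=
  Submodule.subset_span ⟨w, rfl, rfl⟩

theorem isInternal_wtGrade : DirectSum.IsInternal wtGrade := by
  let E : Module.End ℚ QV :=
    wordBasis.constr ℚ fun w => (2 : ℚ) ^ wordWt w.toList • word w.toList
  have hE : ∀ w, E (word w) = (2 : ℚ) ^ wordWt w • word w := fun w => by
    have h : word w = wordBasis (FreeMonoid.ofList w) := (wordBasis_apply _).symm
    rw [h, Module.Basis.constr_basis, wordBasis_apply]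
    rfl
  refine isInternal_of_scaling E (fun n x hx => ?_) fun x => ?_
  · induction hx using Submodule.span_induction with
    | mem x hx => obtain ⟨t, rfl, rfl⟩ := hx; exact hE t
    | zero => simp
    | add x y _ _ hx hy => rw [map_add, hx, hy, smul_add]
    | smul c x _ hx => rw [map_smul, hx, smul_comm]
  · induction x using word_induction with
    | word t => exact Submodule.mem_iSup_of_mem _ (word_mem_wtGrade t)
    | add x y hx hy => exact add_mem hx hy
    | smul c x hx => exact Submodule.smul_mem _ c hx

theorem finite_words_eq (n : ℕ) : {w : List ℕ | wordWt w = n}.Finite :=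
  (finite_words n).subset fun _ h => le_of_eq h

theorem finite_wtGrade (n : ℕ) : Module.Finite ℚ (wtGrade n) := by
  refine Module.Finite.span_of_finite ℚ (((finite_words_eq n).image word).subset ?_)
  rintro x ⟨t, ht, rfl⟩
  exact ⟨t, ht, rfl⟩

theorem linearMap_mem_of_span {M P : Type*} [AddCommGroup M] [Module ℚ M] [AddCommGroup P]
    [Module ℚ P] (f : M →ₗ[ℚ] P) {s : Set M} {Q : Submodule ℚ P} (h : ∀ x ∈ s, f x ∈ Q) {x : M}
    (hx : x ∈ Submodule.span ℚ s) : f x ∈ Q :=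
  (Submodule.map_le_iff_le_comap.mp ((Submodule.map_span_le f s Q).mpr h)) hx

theorem linearMap_mem_wtGrade {P : Type*} [AddCommGroup P] [Module ℚ P] (f : QV →ₗ[ℚ] P) {n : ℕ}
    {Q : Submodule ℚ P} (h : ∀ w, wordWt w = n → f (word w) ∈ Q) {x : QV} (hx : x ∈ wtGrade n) :
    f x ∈ Q :=
  linearMap_mem_of_span f (by rintro _ ⟨w, hw, rfl⟩; exact h w hw) hx

theorem bilinear_mem_wtGrade {P : Type*} [AddCommGroup P] [Module ℚ P]
    (f : QV →ₗ[ℚ] QV →ₗ[ℚ] P) {m n : ℕ} {Q : Submodule ℚ P}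
    (h : ∀ u v, wordWt u = m → wordWt v = n → f (word u) (word v) ∈ Q) {x y : QV}
    (hx : x ∈ wtGrade m) (hy : y ∈ wtGrade n) : f x y ∈ Q :=
  bilinear_mem_of_span f
    (by rintro _ ⟨u, hu, rfl⟩ _ ⟨v, hv, rfl⟩; exact h u v hu hv) hx hy

theorem mul_mem_wtGrade {m n : ℕ} {x y : QV} (hx : x ∈ wtGrade m) (hy : y ∈ wtGrade n) :
    x * y ∈ wtGrade (m + n) :=
  bilinear_mem_wtGrade (LinearMap.mul ℚ QV) (fun u v hu hv => by
    rw [LinearMap.mul_apply', ← word_append, ← hu, ← hv, ← wordWt_append]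
    exact word_mem_wtGrade _) hx hy

theorem counit_wtGrade {n : ℕ} {x : QV} (hn : n ≠ 0) (hx : x ∈ wtGrade n) : counit x = 0 := by
  have h := linearMap_mem_wtGrade counit (Q := ⊥) (fun w hw => ?_) hx
  · exact h
  · rw [counit_word, if_neg]
    · exact zero_mem _
    · rintro rfl
      exact hn hw.symm

theorem wordWt_splits {w : List ℕ} {p : List ℕ × List ℕ} (hp : p ∈ splits w) :
    wordWt p.1 + wordWt p.2 = wordWt w := by
  induction w generalizing p with
  | nil =>
    rw [splits, List.mem_singleton] at hp
    rw [hp]; rfl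
  | cons a w ih =>
    simp only [splits, List.mem_append, List.mem_map] at hp
    rcases hp with ⟨q, hq, rfl⟩ | ⟨q, hq, rfl⟩ <;>
      simp only [wordWt_cons] <;> have := ih hq <;> omega

theorem conv_mem_wtGrade {f g : QV →ₗ[ℚ] QV} {s t : ℕ}
    (hf : ∀ w, f (word w) ∈ wtGrade (wordWt w + s)) (hg : ∀ w, g (word w) ∈ wtGrade (wordWt w + t))
    (w : List ℕ) : conv f g (word w) ∈ wtGrade (wordWt w + (s + t)) := by
  rw [conv_word]
  refine list_sum_mem fun x hx => ?_
  obtain ⟨p, hp, rfl⟩ := List.mem_map.mp hx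
  have h := mul_mem_wtGrade (hf p.1) (hg p.2)
  rwa [add_add_add_comm, wordWt_splits hp] at h

theorem adj_mem_wtGrade (l : List ℕ) {n : ℕ} {B : QV} (hB : B ∈ wtGrade n) :
    adj (word l) B ∈ wtGrade (n + wordWt l) := by
  induction l generalizing n B with
  | nil => rw [word_nil, adj_one]; exact hB
  | cons a l ih =>
    rw [word_cons, adj_mul, adj_letter, wordWt_cons, ← add_assoc]
    have ha := word_mem_wtGrade [a]
    have e : wordWt [a] = letterWt a := by simp [wordWt]
    rw [e] at ha
    refine ih (sub_mem (mul_mem_wtGrade hB ha) ?_)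
    rw [add_comm n]
    exact mul_mem_wtGrade ha hB

theorem triLetter_mem_wtGrade (s : ℕ) (w : List ℕ) :
    triLetter s (word w) ∈ wtGrade (wordWt w + letterWt s) := by
  rcases s with _ | s
  · rw [triLetter_zero, counit_word]
    split_ifs with h
    · rw [h, one_smul]; exact word_mem_wtGrade [0]
    · rw [zero_smul]; exact zero_mem _
  · rw [triLetter_succ, shift_word, map_list_sum, List.map_map]
    refine list_sum_mem fun x hx => ?_
    obtain ⟨l, hl, rfl⟩ := List.mem_map.mp hx
    rw [Function.comp_apply, map_smul, twist_monomial]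
    by_cases h0 : mult w l = 0
    · rw [h0, zero_smul]; exact zero_mem _
    · have h1 := mult_weight hl h0
      have h2 := adj_mem_wtGrade l (word_mem_wtGrade [s + 1 + (w.sum - l.sum)])
      have e : wordWt [s + 1 + (w.sum - l.sum)] = s + 1 + (w.sum - l.sum) := by
        simp only [wordWt, List.map_cons, List.map_nil, List.sum_singleton]
        exact if_neg (by omega)
      refine Submodule.smul_mem _ _ ?_
      rw [e] at h2
      convert h2 using 2
      rw [letterWt, if_neg (by omega)]
      omega

theorem triWord_mem_wtGrade (v w : List ℕ) :
    triWord v (word w) ∈ wtGrade (wordWt w + wordWt v) := by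
  induction v generalizing w with
  | nil =>
    rw [triWord, counitOne_apply, counit_word]
    split_ifs with h
    · rw [h, one_smul]; exact word_mem_wtGrade []
    · rw [zero_smul]; exact zero_mem _
  | cons s v ih =>
    rw [triWord, wordWt_cons]
    exact conv_mem_wtGrade (triLetter_mem_wtGrade s) ih w

theorem gl_mem_wtGrade {m n : ℕ} {x y : QV} (hx : x ∈ wtGrade m) (hy : y ∈ wtGrade n) :
    gl x y ∈ wtGrade (m + n) :=
  bilinear_mem_wtGrade gl (fun u v hu hv => by
    have h : conv LinearMap.id (triWord v) (word u) ∈ wtGrade (wordWt u + (0 + wordWt v)) :=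
      conv_mem_wtGrade (fun w => by rw [add_zero]; exact word_mem_wtGrade w)
        (triWord_mem_wtGrade v) u
    rw [zero_add] at h
    rw [gl_apply, triExt_flip_word, ← hu, ← hv]
    exact h) hx hy

/-! ### The pairing -/

theorem pairing_word_left (u : List ℕ) :
    pairing (word u) = wordBasis.coord (FreeMonoid.ofList u) := by
  have h : word u = wordBasis (FreeMonoid.ofList u) := (wordBasis_apply _).symm
  rw [pairing, h, Module.Basis.constr_basis]

theorem pairing_word (u v : List ℕ) : pairing (word u) (word v) = if u = v then 1 else 0 := by
  rw [pairing_word_left, Module.Basis.coord_apply, wordBasis_repr_word]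
  exact if_congr eq_comm rfl rfl

theorem pairing_comm (A B : QV) : pairing A B = pairing B A := by
  induction A using word_induction with
  | word u =>
    induction B using word_induction with
    | word v => rw [pairing_word, pairing_word]; exact if_congr eq_comm rfl rfl
    | add A B hA hB => rw [map_add, hA, hB, map_add, LinearMap.add_apply]
    | smul c A hA => rw [map_smul, hA, map_smul, LinearMap.smul_apply]
  | add A B hA hB => rw [map_add, LinearMap.add_apply, hA, hB, map_add]
  | smul c A hA => rw [map_smul, LinearMap.smul_apply, hA, map_smul]

theorem pairing_separatingRight : pairing.SeparatingRight := fun z hz =>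
  wordBasis.repr.injective (Finsupp.ext fun w => by
    have h := hz (word w.toList)
    rw [pairing_word_left] at h
    rw [map_zero]
    exact h)

theorem pairing_separatingLeft : pairing.SeparatingLeft := fun z hz =>
  pairing_separatingRight z fun x => by rw [pairing_comm]; exact hz x

theorem one_pairing (z : QV) : pairing 1 z = counit z := by
  rw [← word_nil, pairing_word_left]; rfl

theorem pairing_orthogonal {m n : ℕ} {x y : QV} (hmn : m ≠ n) (hx : x ∈ wtGrade m)
    (hy : y ∈ wtGrade n) : pairing x y = 0 :=
  bilinear_mem_wtGrade pairing (Q := ⊥) (fun u v hu hv => by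
    rw [pairing_word, if_neg]
    · exact zero_mem _
    · rintro rfl
      exact hmn (hu.symm.trans hv)) hx hy

/-- The transpose with respect to the pairing of a homogeneous family `f i` (with finitely many
indices of each weight): the word `w` is sent to `∑ (f i ∣ w) e i`, summed over the indices of
the weight of `w`. -/
def transpose {ι T : Type} [AddCommGroup T] [Module ℚ T] {wt : ι → ℕ}
    (hwt : ∀ n, {i | wt i = n}.Finite) (f : ι → QV) (e : ι → T) : QV →ₗ[ℚ] T :=
  wordBasis.constr ℚ fun w =>
    ∑ i ∈ (hwt (wordWt w.toList)).toFinset, pairing (f i) (word w.toList) • e i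

section transpose

variable {ι T : Type} [AddCommGroup T] [Module ℚ T] {wt : ι → ℕ}
  (hwt : ∀ n, {i | wt i = n}.Finite) (f : ι → QV) (e : ι → T)

theorem transpose_word (w : List ℕ) : transpose hwt f e (word w) =
    ∑ i ∈ (hwt (wordWt w)).toFinset, pairing (f i) (word w) • e i := by
  have h : word w = wordBasis (FreeMonoid.ofList w) := (wordBasis_apply _).symm
  rw [transpose, h, Module.Basis.constr_basis, ← h]
  rfl

variable {f e}

/-- The defining property of the transpose, for the functional `ℓ` dual to `e i`. -/
theorem apply_transpose (hf : ∀ i, f i ∈ wtGrade (wt i)) {ℓ : T →ₗ[ℚ] ℚ} {i : ι}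
    (h1 : ℓ (e i) = 1) (h0 : ∀ j ≠ i, ℓ (e j) = 0) (B : QV) :
    ℓ (transpose hwt f e B) = pairing (f i) B := by
  induction B using word_induction with
  | word w =>
    rw [transpose_word, map_sum]
    by_cases hi : wt i = wordWt w
    · rw [Finset.sum_eq_single i]
      · rw [map_smul, h1, smul_eq_mul, mul_one]
      · intro j _ hj
        rw [map_smul, h0 j hj, smul_zero]
      · intro h
        exact absurd ((hwt _).mem_toFinset.mpr hi) h
    · rw [pairing_orthogonal hi (hf i) (word_mem_wtGrade w)]
      refine Finset.sum_eq_zero fun j hj => ?_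
      have hj' : wt j = wordWt w := (hwt _).mem_toFinset.mp hj
      rw [map_smul, h0 j (by rintro rfl; exact hi hj'), smul_zero]
  | add A B hA hB => rw [map_add, map_add, hA, hB, map_add]
  | smul c A hA => rw [map_smul, map_smul, hA, map_smul]

theorem transpose_mem {n : ℕ} {Q : Submodule ℚ T} (he : ∀ i, wt i = n → e i ∈ Q) {B : QV}
    (hB : B ∈ wtGrade n) : transpose hwt f e B ∈ Q :=
  linearMap_mem_wtGrade _ (fun w hw => by
    rw [transpose_word]
    refine sum_mem fun i hi => Submodule.smul_mem _ _ (he i ?_)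
    exact ((hwt _).mem_toFinset.mp hi).trans hw) hB

end transpose

theorem finite_wordPairs (n : ℕ) :
    {p : List ℕ × List ℕ | wordWt p.1 + wordWt p.2 = n}.Finite :=
  ((finite_words n).prod (finite_words n)).subset fun p hp => by
    have hp' : wordWt p.1 + wordWt p.2 = n := hp
    exact ⟨by simp only [Set.mem_ofPred_eq]; omega, by simp only [Set.mem_ofPred_eq]; omega⟩

/-- The coproduct `Δ_a` dual to the Grossman-Larson product. -/
def glCo : QV →ₗ[ℚ] QV ⊗[ℚ] QV :=
  transpose finite_wordPairs (fun p => gl (word p.1) (word p.2)) fun p => word p.1 ⊗ₜ word p.2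

theorem pairing_gl (A B C : QV) :
    pairing (gl A B) C = tensorPairing pairing (A ⊗ₜ[ℚ] B) (glCo C) := by
  induction A using word_induction with
  | word u =>
    induction B using word_induction with
    | word v =>
      refine (apply_transpose finite_wordPairs (i := (u, v)) (fun _ => gl_mem_wtGrade
        (word_mem_wtGrade _) (word_mem_wtGrade _)) ?_ ?_ C).symm
      · rw [tensorPairing_eq, prodPairing_tmul, pairing_word, pairing_word, if_pos rfl, if_pos rfl,
          one_mul]
      · intro p hp
        rw [tensorPairing_eq, prodPairing_tmul, pairing_word, pairing_word]
        by_cases h1 : u = p.1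
        · rw [if_neg (c := v = p.2), mul_zero]
          intro h2
          exact hp (Prod.ext h1.symm h2.symm)
        · rw [if_neg h1, zero_mul]
    | add A B hA hB =>
      rw [TensorProduct.tmul_add, map_add, map_add, LinearMap.add_apply, hA, hB, map_add,
        LinearMap.add_apply]
    | smul c A hA =>
      rw [TensorProduct.tmul_smul, map_smul, map_smul, LinearMap.smul_apply, hA, map_smul,
        LinearMap.smul_apply]
  | add A B hA hB =>
    rw [TensorProduct.add_tmul, map_add, LinearMap.add_apply, map_add, LinearMap.add_apply, hA, hB,
      map_add, LinearMap.add_apply]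
  | smul c A hA =>
    rw [← TensorProduct.smul_tmul', map_smul, LinearMap.smul_apply, map_smul, LinearMap.smul_apply,
      hA, map_smul, LinearMap.smul_apply]

/-- Tensors are determined by their pairings with pairs of words. -/
theorem tensorPairing_ext {s t : QV ⊗[ℚ] QV} (h : ∀ u v : List ℕ,
    tensorPairing pairing (word u ⊗ₜ word v) s = tensorPairing pairing (word u ⊗ₜ word v) t) :
    s = t := by
  refine sub_eq_zero.mp (prodPairing_separatingRight pairing_separatingRight
    pairing_separatingRight fun a b => ?_)
  induction a using word_induction with
  | word u =>
    induction b using word_induction with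
    | word v => rw [map_sub, ← tensorPairing_eq, h, sub_self]
    | add a b ha hb =>
      rw [TensorProduct.tmul_add, map_add, LinearMap.add_apply, ha, hb, add_zero]
    | smul c a ha => rw [TensorProduct.tmul_smul, map_smul, LinearMap.smul_apply, ha, smul_zero]
  | add a b ha hb =>
    rw [TensorProduct.add_tmul, map_add, LinearMap.add_apply, ha, hb, add_zero]
  | smul c a ha => rw [← TensorProduct.smul_tmul', map_smul, LinearMap.smul_apply, ha, smul_zero]

theorem tmul_mem_tensorGrade {m n k : ℕ} {x y : QV} (h : m + n = k) (hx : x ∈ wtGrade m)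
    (hy : y ∈ wtGrade n) : x ⊗ₜ[ℚ] y ∈ tensorGrade wtGrade k :=
  Submodule.mem_iSup_of_mem m (Submodule.mem_iSup_of_mem n (Submodule.mem_iSup_of_mem h
    ⟨⟨x, hx⟩ ⊗ₜ ⟨y, hy⟩, rfl⟩))

theorem glCo_mem {n : ℕ} {x : QV} (hx : x ∈ wtGrade n) : glCo x ∈ tensorGrade wtGrade n :=
  transpose_mem _ (fun _ hp => tmul_mem_tensorGrade hp (word_mem_wtGrade _) (word_mem_wtGrade _)) hx

theorem co_mem {n : ℕ} {x : QV} (hx : x ∈ wtGrade n) : co.toLinearMap x ∈ tensorGrade wtGrade n :=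
  linearMap_mem_wtGrade _ (fun w hw => by
    rw [AlgHom.toLinearMap_apply, co_word]
    refine list_sum_mem fun x hx => ?_
    obtain ⟨p, hp, rfl⟩ := List.mem_map.mp hx
    exact tmul_mem_tensorGrade ((wordWt_splits hp).trans hw) (word_mem_wtGrade _)
      (word_mem_wtGrade _)) hx

/-! ### The shuffle product is dual to the shuffle coproduct -/

theorem shuffle_word (u v : List ℕ) : shuffle (word u) (word v) = shuffleWord u v := by
  have h : ∀ u, word u = wordBasis (FreeMonoid.ofList u) := fun u => (wordBasis_apply _).symm
  rw [shuffle, h u, Module.Basis.constr_basis, h v, Module.Basis.constr_basis]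
  rfl

theorem shuffleWord_mem (u v : List ℕ) : shuffleWord u v ∈ wtGrade (wordWt u + wordWt v) := by
  induction u, v using shuffleWord.induct with
  | case1 w => rw [shuffleWord, show wordWt [] = 0 from rfl, zero_add]; exact word_mem_wtGrade w
  | case2 a u => rw [shuffleWord]; exact word_mem_wtGrade _
  | case3 a u b v h1 h2 =>
    have e : ∀ a, word [a] ∈ wtGrade (letterWt a) := fun a => by
      simpa [wordWt] using word_mem_wtGrade [a]
    rw [shuffleWord]
    refine add_mem ?_ ?_
    · rw [wordWt_cons a u, add_assoc]; exact mul_mem_wtGrade (e a) h1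
    · rw [wordWt_cons b v, add_left_comm]; exact mul_mem_wtGrade (e b) h2

theorem shuffle_mem {m n : ℕ} {x y : QV} (hx : x ∈ wtGrade m) (hy : y ∈ wtGrade n) :
    shuffle x y ∈ wtGrade (m + n) :=
  bilinear_mem_wtGrade shuffle (fun u v hu hv => by
    rw [shuffle_word, ← hu, ← hv]; exact shuffleWord_mem u v) hx hy

theorem pairing_letter_mul (a b : ℕ) (w : List ℕ) (B : QV) :
    pairing (word (a :: w)) (word [b] * B) = if a = b then pairing (word w) B else 0 := by
  induction B using word_induction with
  | word v =>
    rw [← word_cons, pairing_word, pairing_word]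
    split_ifs <;> simp_all
  | add A B hA hB => rw [mul_add, map_add, hA, hB, map_add]; split_ifs <;> simp
  | smul c A hA => rw [mul_smul_comm, map_smul, hA, map_smul]; split_ifs <;> simp

theorem pairing_nil_letter_mul (b : ℕ) (B : QV) : pairing (word []) (word [b] * B) = 0 := by
  rw [word_nil, one_pairing, counit_letter_mul]

theorem pairing_shuffleWord (w u v : List ℕ) : pairing (word w) (shuffleWord u v) =
    ((splits w).map fun p => pairing (word p.1) (word u) * pairing (word p.2) (word v)).sum := by
  induction w generalizing u v with
  | nil =>
    simp only [splits, List.map_cons, List.map_nil, List.sum_singleton]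
    rcases u with _ | ⟨a, u⟩
    · simp [shuffleWord, pairing_word]
    · rcases v with _ | ⟨b, v⟩
      · simp [shuffleWord, pairing_word]
      · simp [shuffleWord, pairing_nil_letter_mul, pairing_word]
  | cons c w ih =>
    simp only [splits, List.map_append, List.sum_append, List.map_map, Function.comp_def]
    rcases u with _ | ⟨a, u⟩
    · have h := ih []
      rcases v with _ | ⟨b, v⟩
      · simp [shuffleWord, pairing_word]
      · have h' := h v
        simp only [shuffleWord, pairing_word] at h' ⊢
        by_cases hcb : c = b <;> simp_all
    · rcases v with _ | ⟨b, v⟩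
      · have h' := ih u []
        have e : shuffleWord u [] = word u := by cases u <;> simp [shuffleWord]
        rw [e] at h'
        simp only [shuffleWord, pairing_word] at h' ⊢
        by_cases hcb : c = a <;> simp_all
      · have h1 := ih u (b :: v)
        have h2 := ih (a :: u) v
        rw [shuffleWord, map_add, pairing_letter_mul, pairing_letter_mul, h1, h2]
        have e : ∀ a w v, pairing (word (c :: w)) (word (a :: v)) =
            if c = a then pairing (word w) (word v) else 0 := fun a w v => by
          rw [word_cons a, pairing_letter_mul]
        simp only [e]
        split_ifs <;> simp

theorem pairing_shuffle (x y z : QV) :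
    pairing x (shuffle y z) = tensorPairing pairing (co x) (y ⊗ₜ[ℚ] z) := by
  induction x using word_induction with
  | word w =>
    induction y using word_induction with
    | word u =>
      induction z using word_induction with
      | word v =>
        rw [shuffle_word, pairing_shuffleWord, co_word, ← LinearMap.flip_apply (tensorPairing pairing),
          map_list_sum, List.map_map]
        rfl
      | add A B hA hB => rw [map_add, map_add, hA, hB, TensorProduct.tmul_add, map_add]
      | smul c A hA => rw [map_smul, map_smul, hA, TensorProduct.tmul_smul, map_smul]
    | add A B hA hB =>
      rw [map_add, LinearMap.add_apply, map_add, hA, hB, TensorProduct.add_tmul, map_add]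
    | smul c A hA =>
      rw [map_smul, LinearMap.smul_apply, map_smul, hA, ← TensorProduct.smul_tmul', map_smul]
  | add A B hA hB => rw [map_add, LinearMap.add_apply, hA, hB, map_add, map_add, LinearMap.add_apply]
  | smul c A hA => rw [map_smul, LinearMap.smul_apply, hA, map_smul, map_smul, LinearMap.smul_apply]

/-! ### The dual pair of Hopf algebras -/

theorem algHom_ext_letter {R : Type*} [Semiring R] [Algebra ℚ R] {F G : QV →ₐ[ℚ] R}
    (h : ∀ a, F (word [a]) = G (word [a])) (A : QV) : F A = G A := by
  induction A using letter_induction with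
  | one => rw [map_one, map_one]
  | letter_mul a A ih => rw [map_mul, map_mul, h, ih]
  | add A B hA hB => rw [map_add, map_add, hA, hB]
  | smul c A hA => rw [map_smul, map_smul, hA]

theorem co_coassoc (A : QV) :
    TensorProduct.assoc ℚ QV QV QV (TensorProduct.map co.toLinearMap LinearMap.id (co A)) =
      TensorProduct.map LinearMap.id co.toLinearMap (co A) := by
  refine algHom_ext_letter (F := (Algebra.TensorProduct.assoc ℚ ℚ ℚ QV QV QV).toAlgHom.comp
    ((Algebra.TensorProduct.map co (AlgHom.id ℚ QV)).comp co))
    (G := (Algebra.TensorProduct.map (AlgHom.id ℚ QV) co).comp co) (fun a => ?_) A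
  simp [co_letter, TensorProduct.add_tmul, TensorProduct.tmul_add, Algebra.TensorProduct.one_def,
    add_assoc]

/-- The counit as an algebra morphism. -/
def counitHom : QV →ₐ[ℚ] ℚ := AlgHom.ofLinearMap counit counit_one counit_mul

theorem co_counit_left (A : QV) :
    TensorProduct.map counit LinearMap.id (co A) = (1 : ℚ) ⊗ₜ[ℚ] A := by
  refine algHom_ext_letter (F := (Algebra.TensorProduct.map counitHom (AlgHom.id ℚ QV)).comp co)
    (G := Algebra.TensorProduct.includeRight) (fun a => ?_) A
  simp [co_letter, counitHom, counit_letter, AriHopf.counit_one]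

theorem co_counit_right (A : QV) :
    TensorProduct.map LinearMap.id counit (co A) = A ⊗ₜ[ℚ] (1 : ℚ) := by
  refine algHom_ext_letter (F := (Algebra.TensorProduct.map (AlgHom.id ℚ QV) counitHom).comp co)
    (G := Algebra.TensorProduct.includeLeft) (fun a => ?_) A
  simp [co_letter, counitHom, counit_letter, AriHopf.counit_one]

theorem gl_add_left (a b c : QV) : gl (a + b) c = gl a c + gl b c := by
  rw [map_add, LinearMap.add_apply]

theorem gl_smul_left (r : ℚ) (a b : QV) : gl (r • a) b = r • gl a b := by
  rw [map_smul, LinearMap.smul_apply]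

theorem gl_zero_left (a : QV) : gl 0 a = 0 := by
  rw [map_zero, LinearMap.zero_apply]

/-- A copy of `ℚ⟨V⟩` carrying the Grossman-Larson product and the shuffle coproduct. -/
def GrossmanLarson : Type := QV

instance : AddCommGroup GrossmanLarson := inferInstanceAs (AddCommGroup QV)

instance : Module ℚ GrossmanLarson := inferInstanceAs (Module ℚ QV)

instance : Ring GrossmanLarson :=
  { (inferInstance : AddCommGroup GrossmanLarson) with
    mul := fun a b => gl a b
    one := (1 : QV)
    mul_assoc := gl_assoc
    one_mul := one_gl
    mul_one := gl_one
    left_distrib := fun a b c => map_add (gl a) b c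
    right_distrib := gl_add_left
    zero_mul := gl_zero_left
    mul_zero := fun a => map_zero (gl a) }

instance : Algebra ℚ GrossmanLarson :=
  Algebra.ofModule gl_smul_left (fun r x y => map_smul (gl x) r y)

instance : Coalgebra ℚ GrossmanLarson where
  comul := co.toLinearMap
  counit := counit
  coassoc := LinearMap.ext co_coassoc
  rTensor_counit_comp_comul := LinearMap.ext co_counit_left
  lTensor_counit_comp_comul := LinearMap.ext co_counit_right

/-- The linear endomorphisms of `ℚ⟨V⟩` with the convolution product
`(f * g)(A) = f(A₍₁₎) ⊛ g(A₍₂₎)`. -/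
abbrev ConvEnd : Type := WithConv (GrossmanLarson →ₗ[ℚ] GrossmanLarson)

/-- The underlying linear map of an element of the convolution algebra. -/
def ConvEnd.toLin (f : ConvEnd) : QV →ₗ[ℚ] QV := f.ofConv

/-- A linear map as an element of the convolution algebra. -/
def ConvEnd.ofLin (f : QV →ₗ[ℚ] QV) : ConvEnd := WithConv.toConv f

/-- The value of an element of the convolution algebra at a word. -/
def ConvEnd.atWord (f : ConvEnd) (w : List ℕ) : QV := f.toLin (word w)

theorem lift_map_co (f g : QV →ₗ[ℚ] QV) (w : List ℕ) :
    TensorProduct.lift gl (TensorProduct.map f g (co (word w))) =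
      ((splits w).map fun p => gl (f (word p.1)) (g (word p.2))).sum := by
  rw [co_word, map_list_sum, map_list_sum, List.map_map, List.map_map]
  rfl

theorem ConvEnd.mul_atWord (f g : ConvEnd) (w : List ℕ) :
    (f * g).atWord w = ((splits w).map fun p => gl (f.atWord p.1) (g.atWord p.2)).sum :=
  lift_map_co f.toLin g.toLin w

theorem ConvEnd.one_atWord (w : List ℕ) :
    (1 : ConvEnd).atWord w = if w = [] then (1 : QV) else 0 := by
  have h : (1 : ConvEnd).atWord w = (counit (word w) • (1 : QV) : QV) :=
    Algebra.algebraMap_eq_smul_one (R := ℚ) (A := GrossmanLarson) (counit (word w))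
  rw [h, counit_word]
  split_ifs <;> simp

/-- The element `1 - id` of the convolution algebra. -/
def oneSubId : ConvEnd := 1 - ConvEnd.ofLin LinearMap.id

theorem oneSubId_nil : oneSubId.atWord [] = 0 := by
  have h : oneSubId.atWord [] = (1 : ConvEnd).atWord [] - word [] := rfl
  rw [h, ConvEnd.one_atWord, if_pos rfl, word_nil, sub_self]

/-- `1 - id` is locally nilpotent for the convolution, as the coproduct is connected. -/
theorem oneSubId_pow (n : ℕ) {w : List ℕ} (hw : w.length < n) : (oneSubId ^ n).atWord w = 0 := by
  induction n generalizing w with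
  | zero => omega
  | succ n ih =>
    rw [pow_succ', ConvEnd.mul_atWord]
    refine List.sum_eq_zero fun x hx => ?_
    obtain ⟨p, hp, rfl⟩ := List.mem_map.mp hx
    have hl := length_of_mem_splits hp
    rcases h1 : p.1 with _ | ⟨a, u⟩
    · rw [oneSubId_nil, map_zero, LinearMap.zero_apply]
    · rw [h1, List.length_cons] at hl
      rw [ih (by omega), map_zero]

/-- The antipode of the Grossman-Larson Hopf algebra: the geometric series `∑ (1 - id)^n` in the
convolution algebra. At a word of length `d`, the terms with `n > d` vanish. -/
def glAntipode : QV →ₗ[ℚ] QV :=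
  wordBasis.constr ℚ fun w =>
    (∑ i ∈ Finset.range (w.toList.length + 1), oneSubId ^ i).atWord w.toList

theorem atWord_sum {ι : Type*} (s : Finset ι) (f : ι → ConvEnd) (w : List ℕ) :
    (∑ i ∈ s, f i).atWord w = ∑ i ∈ s, (f i).atWord w := by
  classical
  induction s using Finset.induction_on with
  | empty => rfl
  | insert a s ha ih =>
    rw [Finset.sum_insert ha, Finset.sum_insert ha, ← ih]; rfl

theorem glAntipode_word {w : List ℕ} {n : ℕ} (hn : w.length < n) :
    glAntipode (word w) = (∑ i ∈ Finset.range n, oneSubId ^ i).atWord w := by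
  have h : word w = wordBasis (FreeMonoid.ofList w) := (wordBasis_apply _).symm
  rw [glAntipode, h, Module.Basis.constr_basis]
  change (∑ i ∈ Finset.range (w.length + 1), oneSubId ^ i).atWord w = _
  rw [atWord_sum, atWord_sum]
  refine Finset.sum_subset (Finset.range_subset_range.mpr hn) fun i _ hi => ?_
  exact oneSubId_pow i (by rw [Finset.mem_range] at hi; omega)

theorem splits_length_le {w : List ℕ} {p : List ℕ × List ℕ} (hp : p ∈ splits w) :
    p.1.length < w.length + 1 ∧ p.2.length < w.length + 1 := by
  have := length_of_mem_splits hp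
  omega

theorem id_eq_one_sub : ConvEnd.ofLin LinearMap.id = 1 - oneSubId := by
  rw [oneSubId, sub_sub_cancel]

theorem glAntipode_mul_id (w : List ℕ) :
    (ConvEnd.ofLin glAntipode * ConvEnd.ofLin LinearMap.id).atWord w =
      (1 : ConvEnd).atWord w := by
  set n := w.length + 1
  have h : (1 : ConvEnd).atWord w =
      ((∑ i ∈ Finset.range n, oneSubId ^ i) * ConvEnd.ofLin LinearMap.id).atWord w := by
    rw [id_eq_one_sub, geom_sum_mul_neg]
    have e : (1 - oneSubId ^ n).atWord w = (1 : ConvEnd).atWord w - (oneSubId ^ n).atWord w := rfl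
    rw [e, oneSubId_pow n (Nat.lt_succ_self _), sub_zero]
  rw [h, ConvEnd.mul_atWord, ConvEnd.mul_atWord]
  refine congrArg List.sum (List.map_congr_left fun p hp => ?_)
  rw [← glAntipode_word (splits_length_le hp).1]
  rfl

theorem id_mul_glAntipode (w : List ℕ) :
    (ConvEnd.ofLin LinearMap.id * ConvEnd.ofLin glAntipode).atWord w =
      (1 : ConvEnd).atWord w := by
  set n := w.length + 1
  have h : (1 : ConvEnd).atWord w =
      (ConvEnd.ofLin LinearMap.id * (∑ i ∈ Finset.range n, oneSubId ^ i)).atWord w := by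
    rw [id_eq_one_sub, mul_neg_geom_sum]
    have e : (1 - oneSubId ^ n).atWord w = (1 : ConvEnd).atWord w - (oneSubId ^ n).atWord w := rfl
    rw [e, oneSubId_pow n (Nat.lt_succ_self _), sub_zero]
  rw [h, ConvEnd.mul_atWord, ConvEnd.mul_atWord]
  refine congrArg List.sum (List.map_congr_left fun p hp => ?_)
  rw [← glAntipode_word (splits_length_le hp).2]
  rfl

theorem lift_map_co_word (f g : QV →ₗ[ℚ] QV) (w : List ℕ) :
    TensorProduct.lift gl (TensorProduct.map f g (co (word w))) =
      (ConvEnd.ofLin f * ConvEnd.ofLin g).atWord w := rfl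

/-- The operations of the Grossman-Larson Hopf algebra. -/
def glOps : HopfOps QV := ⟨gl, 1, co.toLinearMap, counit, glAntipode⟩

theorem glOps_laws : glOps.Laws where
  mul_assoc := gl_assoc
  one_mul := one_gl
  mul_one := gl_one
  coassoc := co_coassoc
  counit_left := co_counit_left
  counit_right := co_counit_right
  comul_one := by
    change co 1 = _
    rw [map_one, Algebra.TensorProduct.one_def]; rfl
  comul_mul := co_gl
  counit_one := counit_one
  counit_mul := counit_gl
  antipode_left a := by
    have e : TensorProduct.lift gl ∘ₗ TensorProduct.map glAntipode LinearMap.id ∘ₗ co.toLinearMap =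
        counitOne := linearMap_ext_word fun w => by
      rw [LinearMap.comp_apply, LinearMap.comp_apply, AlgHom.toLinearMap_apply, lift_map_co_word,
        glAntipode_mul_id, ConvEnd.one_atWord, counitOne_apply, counit_word]
      split_ifs <;> simp
    exact LinearMap.congr_fun e a
  antipode_right a := by
    have e : TensorProduct.lift gl ∘ₗ TensorProduct.map LinearMap.id glAntipode ∘ₗ co.toLinearMap =
        counitOne := linearMap_ext_word fun w => by
      rw [LinearMap.comp_apply, LinearMap.comp_apply, AlgHom.toLinearMap_apply, lift_map_co_word,
        id_mul_glAntipode, ConvEnd.one_atWord, counitOne_apply, counit_word]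
      split_ifs <;> simp
    exact LinearMap.congr_fun e a

theorem one_mem_wtGrade : (1 : QV) ∈ wtGrade 0 := word_mem_wtGrade []

theorem oneSubId_pow_mem (n : ℕ) (w : List ℕ) : (oneSubId ^ n).atWord w ∈ wtGrade (wordWt w) := by
  have h1 : ∀ w, (1 : ConvEnd).atWord w ∈ wtGrade (wordWt w) := fun w => by
    rw [ConvEnd.one_atWord]
    split_ifs with h
    · rw [h]; exact one_mem_wtGrade
    · exact zero_mem _
  induction n generalizing w with
  | zero => rw [pow_zero]; exact h1 w
  | succ n ih =>
    rw [pow_succ', ConvEnd.mul_atWord]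
    refine list_sum_mem fun x hx => ?_
    obtain ⟨p, hp, rfl⟩ := List.mem_map.mp hx
    rw [← wordWt_splits hp]
    refine gl_mem_wtGrade ?_ (ih _)
    have e : oneSubId.atWord p.1 = (1 : ConvEnd).atWord p.1 - word p.1 := rfl
    rw [e]
    exact sub_mem (h1 _) (word_mem_wtGrade _)

theorem glAntipode_word_mem (w : List ℕ) : glAntipode (word w) ∈ wtGrade (wordWt w) := by
  rw [glAntipode_word (Nat.lt_succ_self _), atWord_sum]
  exact sum_mem fun i _ => oneSubId_pow_mem i w

theorem glAntipode_mem {n : ℕ} {x : QV} (hx : x ∈ wtGrade n) : glAntipode x ∈ wtGrade n :=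
  linearMap_mem_wtGrade _ (fun w hw => by rw [← hw]; exact glAntipode_word_mem w) hx

/-- The antipode of the shuffle Hopf algebra with the coproduct `Δ_a`: the transpose of
`glAntipode`. -/
def shuffleAntipode : QV →ₗ[ℚ] QV :=
  transpose finite_words_eq (fun w => glAntipode (word w)) word

theorem shuffleAntipode_mem {n : ℕ} {x : QV} (hx : x ∈ wtGrade n) : shuffleAntipode x ∈ wtGrade n :=
  transpose_mem _ (fun w hw => by rw [← hw]; exact word_mem_wtGrade w) hx

theorem pairing_glAntipode (x z : QV) :
    pairing (glAntipode x) z = pairing x (shuffleAntipode z) := by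
  induction x using word_induction with
  | word w =>
    refine (apply_transpose finite_words_eq (i := w) glAntipode_word_mem ?_ ?_ z).symm
    · rw [pairing_word, if_pos rfl]
    · intro j hj
      rw [pairing_word, if_neg hj.symm]
  | add A B hA hB => simp only [map_add, LinearMap.add_apply, hA, hB]
  | smul c A hA => simp only [map_smul, LinearMap.smul_apply, hA]

/-- The operations of the shuffle Hopf algebra with the coproduct `Δ_a`. -/
def shuffleOps : HopfOps QV := ⟨shuffle, 1, glCo, counit, shuffleAntipode⟩

theorem pairing_one (x : QV) : pairing x 1 = counit x := by
  rw [pairing_comm, one_pairing]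

theorem isGradedDual_ops : IsGradedDual pairing wtGrade wtGrade glOps shuffleOps where
  finite_left := finite_wtGrade
  finite_right := finite_wtGrade
  separatingLeft := pairing_separatingLeft
  separatingRight := pairing_separatingRight
  orthogonal := pairing_orthogonal
  mul_comul := pairing_gl
  comul_mul := pairing_shuffle
  one_counit := one_pairing
  counit_one := pairing_one
  antipode := pairing_glAntipode

theorem shuffleOps_laws : shuffleOps.Laws :=
  glOps_laws.dual pairing_separatingRight pairing_gl pairing_shuffle one_pairing pairing_one
    pairing_glAntipode

theorem isGradedHopfAlgebra_glOps : glOps.IsGradedHopfAlgebra wtGrade where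
  isHopf := glOps_laws.isHopfAlgebra
  internal := isInternal_wtGrade
  mul_mem := gl_mem_wtGrade
  one_mem := one_mem_wtGrade
  comul_mem := co_mem
  counit_eq_zero := counit_wtGrade
  antipode_mem := glAntipode_mem

theorem isGradedHopfAlgebra_shuffleOps : shuffleOps.IsGradedHopfAlgebra wtGrade where
  isHopf := shuffleOps_laws.isHopfAlgebra
  internal := isInternal_wtGrade
  mul_mem := shuffle_mem
  one_mem := one_mem_wtGrade
  comul_mem := glCo_mem
  counit_eq_zero := counit_wtGrade
  antipode_mem := shuffleAntipode_mem

/-! ### The explicit formula for the Grossman-Larson product -/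

theorem sum_map_congr {α M : Type*} [AddCommMonoid M] {L : List α} {F G : α → M}
    (h : ∀ a ∈ L, F a = G a) : (L.map F).sum = (L.map G).sum :=
  congrArg List.sum (List.map_congr_left h)

theorem sum_splits_cons {M : Type*} [AddCommMonoid M] (a : ℕ) (w : List ℕ)
    (F : List ℕ × List ℕ → M) : ((splits (a :: w)).map F).sum =
      ((splits w).map fun p => F (a :: p.1, p.2)).sum +
        ((splits w).map fun p => F (p.1, a :: p.2)).sum := by
  rw [splits, List.map_append, List.sum_append, List.map_map, List.map_map]
  rfl

theorem sum_sections_cons {α M : Type*} [AddCommMonoid M] (L : List α) (Ls : List (List α))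
    (F : List α → M) : ((L :: Ls).sections.map F).sum =
      (L.map fun x => (Ls.sections.map fun s => F (x :: s)).sum).sum := by
  rw [List.sections, sum_map_flatMap, sum_map_comm]
  simp only [List.map_map]
  rfl

theorem sum_of_mem_splits {w : List ℕ} {p : List ℕ × List ℕ} (hp : p ∈ splits w) :
    p.1.sum + p.2.sum = w.sum := by
  induction w generalizing p with
  | nil =>
    rw [splits, List.mem_singleton] at hp
    rw [hp]; rfl
  | cons a w ih =>
    simp only [splits, List.mem_append, List.mem_map] at hp
    rcases hp with ⟨q, hq, rfl⟩ | ⟨q, hq, rfl⟩ <;>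
      simp only [List.sum_cons] <;> have := ih hq <;> omega

/-- Coassociativity of the unshuffling of words. -/
theorem sum_splits_assoc {M : Type*} [AddCommMonoid M] (w : List ℕ)
    (F : List ℕ → List ℕ → List ℕ → M) :
    ((splits w).map fun p => ((splits p.1).map fun q => F q.1 q.2 p.2).sum).sum =
      ((splits w).map fun p => ((splits p.2).map fun q => F p.1 q.1 q.2).sum).sum := by
  induction w generalizing F with
  | nil => simp [splits]
  | cons a w ih =>
    simp only [sum_splits_cons, List.sum_map_add]
    rw [ih fun x y z => F (a :: x) y z, ih fun x y z => F x (a :: y) z,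
      ih fun x y z => F x y (a :: z), add_assoc]

theorem sum_below_cons_list {M : Type*} [AddCommMonoid M] (k : ℕ) (ks : List ℕ) (F : List ℕ → M) :
    ((below (k :: ks)).map F).sum =
      ((List.range (k + 1)).map fun l => ((below ks).map fun ls => F (l :: ls)).sum).sum := by
  rw [below, sum_map_flatMap]
  simp only [List.map_map]
  rfl

theorem smul_sum_map {α M : Type*} [AddCommGroup M] [Module ℚ M] (c : ℚ) (L : List α) (F : α → M) :
    c • (L.map F).sum = (L.map fun x => c • F x).sum := by
  rw [List.smul_sum, List.map_map]; rfl

/-- Unshuffling commutes with lowering the letters. -/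
theorem sum_below_splits {M : Type*} [AddCommGroup M] [Module ℚ M] (k : List ℕ)
    (G : List ℕ → List ℕ → M) :
    ((below k).map fun l => mult k l • ((splits l).map fun p => G p.1 p.2).sum).sum =
      ((splits k).map fun p => ((below p.1).map fun l => ((below p.2).map fun l' =>
        (mult p.1 l * mult p.2 l') • G l l').sum).sum).sum := by
  induction k generalizing G with
  | nil => simp [below, splits, mult_nil]
  | cons a k ih =>
    have h1 : ∀ G : List ℕ → List ℕ → M, ∀ b, ((below k).map fun l =>
        (mult₁ a b * mult k l) • ((splits l).map fun p => G p.1 p.2).sum).sum =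
          ((splits k).map fun p => ((below p.1).map fun l => ((below p.2).map fun l' =>
            (mult₁ a b * (mult p.1 l * mult p.2 l')) • G l l').sum).sum).sum := fun G b => by
      simp only [mul_smul (mult₁ a b), ← smul_sum_map (mult₁ a b), ih]
    simp only [sum_splits_cons, sum_below_cons_list, mult_cons, smul_add, List.sum_map_add]
    congr 1
    · rw [sum_map_comm (splits k)]
      refine sum_map_congr fun b _ => ?_
      rw [h1 fun u v => G (b :: u) v]
      simp only [mul_assoc]
    · rw [sum_map_congr (L := splits k) (G := fun p => ((List.range (a + 1)).map fun b =>
          ((below p.1).map fun l => ((below p.2).map fun l' =>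
            (mult p.1 l * (mult₁ a b * mult p.2 l')) • G l (b :: l')).sum).sum).sum)
          fun p _ => sum_map_comm _ _ _, sum_map_comm (splits k)]
      refine sum_map_congr fun b _ => ?_
      rw [h1 fun u v => G u (b :: v)]
      simp only [mul_left_comm]

theorem antiWord_cons (a : ℕ) (u : List ℕ) : antiWord (a :: u) = -(antiWord u * word [a]) := by
  rw [antiWord, antiWord, List.length_cons, List.reverse_cons, word_append, pow_succ]
  simp

theorem adj_word (l : List ℕ) (v : QV) :
    adj (word l) v = ((splits l).map fun p => antiWord p.1 * v * word p.2).sum := by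
  induction l generalizing v with
  | nil => simp [splits, antiWord, word_nil, adj_one]
  | cons a l ih =>
    rw [word_cons, adj_mul, adj_letter, ih, sum_splits_cons, add_comm, ← List.sum_map_add]
    refine sum_map_congr fun p _ => ?_
    rw [antiWord_cons, word_cons a p.2]
    noncomm_ring

/-- The action of a word on a letter `v_s`, `s ≥ 1`. -/
theorem triLetter_word {s : ℕ} (hs : 0 < s) (k : List ℕ) : triLetter s (word k) =
    ((splits k).map fun p => ((below p.1).map fun l => ((below p.2).map fun l' =>
      (mult p.1 l * mult p.2 l') • (antiWord l *
        word [s + ((p.1.sum + p.2.sum) - (l.sum + l'.sum))] * word l')).sum).sum).sum := by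
  obtain ⟨s, rfl⟩ := Nat.exists_eq_succ_of_ne_zero hs.ne'
  rw [Nat.succ_eq_add_one, triLetter_succ, shift_word, map_list_sum, List.map_map]
  have h := sum_below_splits k fun l l' =>
    antiWord l * word [s + 1 + (k.sum - (l.sum + l'.sum))] * word l'
  refine Eq.trans (sum_map_congr fun l _ => ?_) (h.trans (sum_map_congr fun p hp => ?_))
  · rw [Function.comp_apply, map_smul, twist_monomial, adj_word]
    refine congrArg _ (sum_map_congr fun p hp => ?_)
    rw [sum_of_mem_splits hp]
  · rw [sum_of_mem_splits hp]

/-- As `A ▷ v_0 = ε(A) v_0`, letters `v_0` are constants for the action. -/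
theorem triWord_zero_cons (w : List ℕ) (A : QV) :
    triWord (0 :: w) A = word [0] * triWord w A := by
  have h : triLetter 0 = LinearMap.mulLeft ℚ (word [0]) ∘ₗ counitOne := LinearMap.ext fun B => by
    rw [triLetter_zero, LinearMap.comp_apply, counitOne_apply, LinearMap.mulLeft_apply,
      mul_smul_comm, mul_one]
  rw [triWord, h, conv_mulLeft, counitOne_conv]

theorem triWord_replicate_append (m : ℕ) (w : List ℕ) (A : QV) :
    triWord (List.replicate m 0 ++ w) A = word (List.replicate m 0) * triWord w A := by
  induction m with
  | zero => simp [word_nil]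
  | succ m ih =>
    rw [List.replicate_succ, List.cons_append, triWord_zero_cons, ih, word_cons 0 (List.replicate m 0),
      mul_assoc]

theorem ne_nil_of_mem_sweedler {n : ℕ} {w : List ℕ} {t : List (List ℕ)} (h : t ∈ sweedler n w) :
    t ≠ [] := by
  rcases n with _ | n
  · rw [sweedler, List.mem_singleton] at h
    rw [h]; exact List.cons_ne_nil _ _
  · simp only [sweedler, List.mem_flatMap, List.mem_map] at h
    obtain ⟨p, _, u, _, rfl⟩ := h
    exact List.cons_ne_nil _ _

theorem sum_sweedler_succ {M : Type*} [AddCommMonoid M] (n : ℕ) (w : List ℕ)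
    (F : List (List ℕ) → M) : ((sweedler (n + 1) w).map F).sum =
      ((splits w).map fun p => ((sweedler n p.2).map fun t => F (p.1 :: t)).sum).sum := by
  rw [sweedler, sum_map_flatMap]
  simp only [List.map_map]
  rfl

/-- The counit property of the unshuffling. -/
theorem sum_splits_triWord_nil (Φ : List ℕ → QV) (w : List ℕ) :
    ((splits w).map fun p => Φ p.1 * triWord [] (word p.2)).sum = Φ w := by
  induction w generalizing Φ with
  | nil => simp [splits, triWord, counitOne_apply, counit_word]
  | cons a w ih =>
    rw [sum_splits_cons, ih fun u => Φ (a :: u)]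
    simp [triWord, counitOne_apply, counit_word]

/-- The action on `v_{i_1} v_0^{m_1} ⋯ v_{i_d} v_0^{m_d}`, convolved with an arbitrary function `Φ`.
The generality in `Φ` allows the induction on `d`: the factor belonging to `A₍₃₎`, which is coupled to
`A₍₂₎` through the letter `v_{i_1 + ⋯}`, becomes part of the next `Φ`. -/
theorem sum_splits_triWord (b : List (ℕ × ℕ)) (hb : ∀ p ∈ b, 0 < p.1) (Φ : List ℕ → QV)
    (w : List ℕ) :
    ((splits w).map fun p =>
      Φ p.1 * triWord (b.flatMap fun p => p.1 :: List.replicate p.2 0) (word p.2)).sum =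
    ((sweedler (2 * b.length) w).map fun t => ((t.tail.map below).sections.map fun L =>
      (List.zipWith mult t.tail L).prod • (Φ (t.headD []) * glpBlocks b t.tail L)).sum).sum := by
  induction b generalizing Φ w with
  | nil =>
    rw [List.flatMap_nil, sum_splits_triWord_nil]
    simp [sweedler, glpBlocks]
  | cons p b ih =>
    rw [List.length_cons, mul_add, mul_one, sum_sweedler_succ]
    refine sum_map_congr fun q _ => ?_
    rw [sum_sweedler_succ, List.flatMap_cons, List.cons_append, triWord, conv_word]
    have hp := hb p List.mem_cons_self
    have e : ∀ r : List ℕ × List ℕ, triLetter p.1 (word r.1) *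
        triWord (List.replicate p.2 0 ++ b.flatMap fun p => p.1 :: List.replicate p.2 0)
          (word r.2) = ((splits r.1).map fun s => (((below s.1).map fun l =>
            ((below s.2).map fun l' => (mult s.1 l * mult s.2 l') • (antiWord l *
              word [p.1 + ((s.1.sum + s.2.sum) - (l.sum + l'.sum))] * word l' *
                word (List.replicate p.2 0))).sum).sum *
            triWord (b.flatMap fun p => p.1 :: List.replicate p.2 0) (word r.2))).sum := fun r => by
      rw [triLetter_word hp, triWord_replicate_append, ← mul_assoc, ← List.sum_map_mul_right,
        ← List.sum_map_mul_right]
      refine sum_map_congr fun s _ => ?_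
      simp only [← List.sum_map_mul_right, smul_mul_assoc]
    rw [sum_map_congr fun r _ => e r, sum_splits_assoc (F := fun k k' r => (((below k).map fun l =>
            ((below k').map fun l' => (mult k l * mult k' l') • (antiWord l *
              word [p.1 + ((k.sum + k'.sum) - (l.sum + l'.sum))] * word l' *
                word (List.replicate p.2 0))).sum).sum *
            triWord (b.flatMap fun p => p.1 :: List.replicate p.2 0) (word r))),
      ← List.sum_map_mul_left]
    refine sum_map_congr fun r _ => ?_
    rw [ih (fun x hx => hb x (List.mem_cons_of_mem _ hx)) fun k' => ((below r.1).map fun l =>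
            ((below k').map fun l' => (mult r.1 l * mult k' l') • (antiWord l *
              word [p.1 + ((r.1.sum + k'.sum) - (l.sum + l'.sum))] * word l' *
                word (List.replicate p.2 0))).sum).sum, ← List.sum_map_mul_left]
    refine sum_map_congr fun t ht => ?_
    obtain ⟨k', t, rfl⟩ := List.exists_cons_of_ne_nil (ne_nil_of_mem_sweedler ht)
    simp only [List.headD_cons, List.tail_cons, List.map_cons, sum_sections_cons,
      List.zipWith_cons_cons, List.prod_cons, glpBlocks]
    refine Eq.trans ?_ (sum_map_congr fun x _ => sum_map_comm _ _ _)
    refine Eq.trans ?_ (sum_map_comm _ _ _)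
    simp only [← List.sum_map_mul_left, ← List.sum_map_mul_right, smul_sum_map]
    refine sum_map_congr fun s _ => sum_map_congr fun l _ => sum_map_congr fun l' _ => ?_
    rw [smul_mul_assoc, mul_smul_comm, mul_smul_comm, smul_smul, ← mul_assoc (mult r.1 l),
      mul_comm (List.zipWith mult t s).prod]

/-- The explicit formula for the Grossman-Larson product of two words. -/
theorem gl_blockWord (A : List ℕ) (m₀ : ℕ) (b : List (ℕ × ℕ)) (hb : ∀ p ∈ b, 0 < p.1) :
    gl (word A) (word (blockWord m₀ b)) = glpFormula A m₀ b := by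
  rw [gl_apply, triExt_flip_word, conv_word, glpFormula,
    ← sum_splits_triWord b hb fun u => word u * word (List.replicate m₀ 0)]
  refine sum_map_congr fun p _ => ?_
  rw [blockWord, triWord_replicate_append, LinearMap.id_apply, mul_assoc]

/-! ### The adjoint of the action on a letter -/

theorem pairing_cons (a b : ℕ) (u v : List ℕ) :
    pairing (word (a :: u)) (word (b :: v)) = if a = b then pairing (word u) (word v) else 0 := by
  rw [word_cons b v, pairing_letter_mul]

theorem pairing_nil_cons (b : ℕ) (v : List ℕ) : pairing (word []) (word (b :: v)) = 0 := by
  rw [pairing_word, if_neg (List.cons_ne_nil _ _).symm]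

theorem pairing_cons_nil (a : ℕ) (u : List ℕ) : pairing (word (a :: u)) (word []) = 0 := by
  rw [pairing_word, if_neg (List.cons_ne_nil _ _)]

theorem pairing_antiWord (l w : List ℕ) :
    pairing (antiWord l) (word w) = (-1) ^ l.length * pairing (word l.reverse) (word w) := by
  rw [antiWord, map_smul, LinearMap.smul_apply, smul_eq_mul]

theorem sum_below_reverse {M : Type*} [AddCommMonoid M] (k : List ℕ) (F : List ℕ → M) :
    ((below k.reverse).map F).sum = ((below k).map fun l => F l.reverse).sum := by
  induction k generalizing F with
  | nil => rfl
  | cons a k ih =>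
    rw [List.reverse_cons, sum_below_append, ih, sum_below_cons_list a k,
      sum_map_comm (List.range (a + 1))]
    refine sum_map_congr fun l _ => ?_
    simp [sum_below_cons_list, show below [] = [[]] from rfl]

theorem mult_reverse {k l : List ℕ} (h : l.length = k.length) :
    mult k.reverse l.reverse = mult k l := by
  induction k generalizing l with
  | nil =>
    rw [List.length_nil, List.length_eq_zero_iff] at h
    rw [h]; rfl
  | cons a k ih =>
    obtain ⟨b, l, rfl⟩ := List.exists_cons_of_length_eq_add_one h
    have h' : l.length = k.length := by simpa using h
    rw [List.reverse_cons, List.reverse_cons, mult_append (by simpa using h'), ih h', mult_cons,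
      mult_cons, mult_nil, mul_one, mul_comm]

/-- Lowering the letters of `k` is adjoint to raising the letters of `Q`; only raises by at most
`c` matter if `Φ` vanishes above `c`. -/
theorem sum_below_eq_sum_raise (k Q : List ℕ) (c : ℕ) (Φ : ℕ → ℚ) (hΦ : ∀ d, c < d → Φ d = 0) :
    ((below k).map fun l =>
      mult k l * pairing (word l) (word Q) * Φ (k.sum - l.sum)).sum =
    ((below (List.replicate Q.length c)).map fun q =>
      mult (addIdx Q q) Q * pairing (word k) (word (addIdx Q q)) * Φ q.sum).sum := by
  induction k generalizing Q Φ with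
  | nil =>
    rcases Q with _ | ⟨a, Q⟩
    · simp [below, addIdx]
    · simp [pairing_nil_cons, addIdx, sum_below_cons, List.replicate_succ,
        show below [] = [[]] from rfl]
  | cons x k ih =>
    rcases Q with _ | ⟨a, Q⟩
    · simp [pairing_cons_nil, addIdx, sum_below_cons, show below [] = [[]] from rfl]
    · rw [List.length_cons, List.replicate_succ, sum_below_cons, sum_below_cons]
      have e : ∀ q y, addIdx (a :: Q) (y :: q) = (a + y) :: addIdx Q q := fun _ _ => rfl
      simp only [e, mult_cons, pairing_cons, List.sum_cons]
      by_cases hax : a ≤ x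
      · rw [Finset.sum_eq_single a]
        · have h1 : ∀ l ∈ below k, mult₁ x a * mult k l *
              (if a = a then pairing (word l) (word Q) else 0) * Φ (x + k.sum - (a + l.sum)) =
              mult₁ x a * (mult k l * pairing (word l) (word Q) *
                (fun d => Φ (x - a + d)) (k.sum - l.sum)) := fun l hl => by
            have := sum_le_of_mem_below hl
            rw [if_pos rfl, show x + k.sum - (a + l.sum) = x - a + (k.sum - l.sum) by omega]
            ring
          rw [sum_map_congr h1, List.sum_map_mul_left,
            ih Q (fun d => Φ (x - a + d)) fun d hd => hΦ _ (by omega)]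
          by_cases hc : x - a ≤ c
          · rw [Finset.sum_eq_single (x - a), ← List.sum_map_mul_left]
            · refine sum_map_congr fun q _ => ?_
              rw [if_pos (by omega), show a + (x - a) = x by omega]
              ring
            · intro y _ hy
              refine List.sum_eq_zero fun z hz => ?_
              obtain ⟨q, _, rfl⟩ := List.mem_map.mp hz
              rw [if_neg (by omega), mul_zero, zero_mul]
            · intro h
              exact absurd (Finset.mem_range.mpr (by omega)) h
          · rw [Finset.sum_eq_zero]
            · rw [List.sum_eq_zero, mul_zero]
              intro z hz
              obtain ⟨q, _, rfl⟩ := List.mem_map.mp hz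
              rw [hΦ _ (by omega), mul_zero]
            · intro y hy
              rw [Finset.mem_range] at hy
              refine List.sum_eq_zero fun z hz => ?_
              obtain ⟨q, _, rfl⟩ := List.mem_map.mp hz
              rw [if_neg (by omega), mul_zero, zero_mul]
        · intro y _ hy
          refine List.sum_eq_zero fun z hz => ?_
          obtain ⟨q, _, rfl⟩ := List.mem_map.mp hz
          rw [if_neg hy, mul_zero, zero_mul]
        · intro h
          exact absurd (Finset.mem_range.mpr (by omega)) h
      · rw [Finset.sum_eq_zero, Finset.sum_eq_zero]
        · intro y _
          refine List.sum_eq_zero fun z hz => ?_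
          obtain ⟨q, _, rfl⟩ := List.mem_map.mp hz
          rw [if_neg (by omega), mul_zero, zero_mul]
        · intro y hy
          rw [Finset.mem_range] at hy
          refine List.sum_eq_zero fun z hz => ?_
          obtain ⟨q, _, rfl⟩ := List.mem_map.mp hz
          rw [if_neg (by omega), mul_zero, zero_mul]

/-- The version of `sum_below_eq_sum_raise` for words reversed by `S`. -/
theorem sum_below_antiWord_eq_sum_raise (k P : List ℕ) (c : ℕ) (Φ : ℕ → ℚ)
    (hΦ : ∀ d, c < d → Φ d = 0) :
    ((below k).map fun l =>
      mult k l * pairing (antiWord l) (word P) * Φ (k.sum - l.sum)).sum =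
    ((below (List.replicate P.length c)).map fun p =>
      mult (addIdx P p) P * pairing (word k) (antiWord (addIdx P p)) * Φ p.sum).sum := by
  have h := sum_below_eq_sum_raise k.reverse P c Φ hΦ
  rw [sum_below_reverse, List.sum_reverse] at h
  have h1 : ∀ l ∈ below k, mult k l * pairing (antiWord l) (word P) * Φ (k.sum - l.sum) =
      (-1) ^ k.length * (mult k.reverse l.reverse * pairing (word l.reverse) (word P) *
        Φ (k.sum - l.reverse.sum)) := fun l hl => by
    have hl' := length_of_mem_below hl
    rw [pairing_antiWord, mult_reverse hl', hl', List.sum_reverse]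
    ring
  rw [sum_map_congr h1, List.sum_map_mul_left, h, ← List.sum_map_mul_left]
  refine sum_map_congr fun p _ => ?_
  rw [pairing_comm (word k), pairing_antiWord, pairing_word, pairing_word]
  by_cases e : k.reverse = addIdx P p
  · rw [if_pos e, if_pos (by rw [← e, List.reverse_reverse]), ← e, List.length_reverse]
    ring
  · rw [if_neg e, if_neg fun e' => e (by rw [← e', List.reverse_reverse])]
    ring

/-- Inserting a letter between two words is adjoint to marking a letter. -/
theorem pairing_mul_letter_mul (X : QV) (x : ℕ) (l w : List ℕ) :
    pairing (X * word [x] * word l) (word w) = ((marked w).map fun D =>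
      pairing X (word D.1) * (if x = D.2.1 then 1 else 0) * pairing (word l) (word D.2.2)).sum := by
  induction X using word_induction with
  | word u =>
    rw [← word_append, ← word_append]
    induction w generalizing u with
    | nil => simp [marked, pairing_word]
    | cons a w ih =>
      rw [marked, List.map_cons, List.sum_cons, List.map_map]
      rcases u with _ | ⟨y, u⟩
      · have h : ((marked w).map ((fun D => pairing (word []) (word D.1) *
            (if x = D.2.1 then 1 else 0) * pairing (word l) (word D.2.2)) ∘
              fun p => (a :: p.1, p.2))).sum = 0 := List.sum_eq_zero fun z hz => by
          obtain ⟨D, _, rfl⟩ := List.mem_map.mp hz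
          rw [Function.comp_apply, pairing_nil_cons, zero_mul, zero_mul]
        rw [h, add_zero, List.nil_append, List.singleton_append, pairing_cons, pairing_word [] [],
          if_pos rfl, one_mul, ite_mul, one_mul, zero_mul]
      · rw [pairing_cons_nil, zero_mul, zero_mul, zero_add, List.cons_append, List.cons_append,
          pairing_cons, ih]
        simp only [Function.comp_def, pairing_cons]
        split_ifs with h
        · rfl
        · simp
  | add A B hA hB =>
    rw [add_mul, add_mul, map_add, LinearMap.add_apply, hA, hB, ← List.sum_map_add]
    refine sum_map_congr fun D _ => ?_
    rw [map_add, LinearMap.add_apply]; ring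
  | smul c A hA =>
    rw [smul_mul_assoc, smul_mul_assoc, map_smul, LinearMap.smul_apply, hA, smul_sum_map]
    refine sum_map_congr fun D _ => ?_
    rw [map_smul, LinearMap.smul_apply, smul_eq_mul, smul_eq_mul]; ring

/-- The adjoint of the action on the letter `v_b`, evaluated at a word. -/
def letterAdjoint (b : ℕ) (w : List ℕ) : QV :=
  ((marked w).map fun D => ((shifts D).map fun l =>
    (mult (addIdx D.1 l.1) D.1 * mult (addIdx D.2.2 l.2) D.2.2 *
      (if b = D.2.1 - (l.1.sum + l.2.sum) then 1 else 0)) •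
        shuffle (antiWord (addIdx D.1 l.1)) (word (addIdx D.2.2 l.2))).sum).sum

theorem pairing_sum_left {α : Type*} (L : List α) (F : α → QV) (y : QV) :
    pairing (L.map F).sum y = (L.map fun a => pairing (F a) y).sum := by
  rw [← LinearMap.flip_apply pairing, map_list_sum, List.map_map]; rfl

theorem pairing_sum_right {α : Type*} (x : QV) (L : List α) (F : α → QV) :
    pairing x (L.map F).sum = (L.map fun a => pairing x (F a)).sum := by
  rw [map_list_sum, List.map_map]; rfl

theorem pairing_word_shuffle (w : List ℕ) (x y : QV) : pairing (word w) (shuffle x y) =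
    ((splits w).map fun p => pairing (word p.1) x * pairing (word p.2) y).sum := by
  rw [pairing_shuffle, co_word, ← LinearMap.flip_apply (tensorPairing pairing), map_list_sum,
    List.map_map]
  rfl

theorem sum_map_filter {α M : Type*} [AddCommMonoid M] (L : List α) (p : α → Bool) (F : α → M) :
    ((L.filter p).map F).sum = (L.map fun x => if p x then F x else 0).sum := by
  induction L with
  | nil => rfl
  | cons a L ih =>
    rw [List.filter_cons, List.map_cons, List.sum_cons, ← ih]
    split_ifs <;> simp

theorem sum_map_product {α β M : Type*} [AddCommMonoid M] (L : List α) (L' : List β)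
    (F : α × β → M) : ((L ×ˢ L').map F).sum = (L.map fun a => (L'.map fun b => F (a, b)).sum).sum := by
  rw [show L ×ˢ L' = L.flatMap fun a => L'.map fun b => (a, b) from rfl, sum_map_flatMap]
  simp only [List.map_map]
  rfl

/-- For `b ≥ 1`, the restriction on the shifts is implied by `c - |l| = b`. -/
theorem sum_shifts {b : ℕ} (hb : 0 < b) (D : List ℕ × ℕ × List ℕ) (F : List ℕ → List ℕ → ℚ) :
    ((shifts D).map fun l =>
      (if b = D.2.1 - (l.1.sum + l.2.sum) then 1 else 0) * F l.1 l.2).sum =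
    ((below (List.replicate D.1.length D.2.1)).map fun p =>
      ((below (List.replicate D.2.2.length D.2.1)).map fun q =>
        (if b + (p.sum + q.sum) = D.2.1 then 1 else 0) * F p q).sum).sum := by
  rw [shifts, sum_map_filter, sum_map_product]
  refine sum_map_congr fun p _ => sum_map_congr fun q _ => ?_
  by_cases h : b + (p.sum + q.sum) = D.2.1
  · rw [if_pos h, if_pos (by simp only [decide_eq_true_eq]; omega),
      if_pos (show b = D.2.1 - (p.sum + q.sum) by omega)]
  · rw [if_neg h, if_neg (show ¬ b = D.2.1 - (p.sum + q.sum) by omega)]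
    simp

/-- The adjunction between lowering and raising letters, on both sides of a letter `c`. -/
theorem sum_below_below_eq_sum_raise (b c : ℕ) (k k' P Q : List ℕ) :
    ((below k).map fun l => ((below k').map fun l' => (mult k l * mult k' l') *
      (pairing (antiWord l) (word P) *
        (if b + ((k.sum + k'.sum) - (l.sum + l'.sum)) = c then 1 else 0) *
          pairing (word l') (word Q))).sum).sum =
    ((below (List.replicate P.length c)).map fun p =>
      ((below (List.replicate Q.length c)).map fun q =>
        (if b + (p.sum + q.sum) = c then 1 else 0) *
          (mult (addIdx P p) P * mult (addIdx Q q) Q *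
            (pairing (word k) (antiWord (addIdx P p)) *
              pairing (word k') (word (addIdx Q q))))).sum).sum := by
  -- the two sides are coupled only through the total amount `d + d'` of lowering or raising
  let Φ : ℕ → ℕ → ℚ := fun d d' => if b + (d + d') = c then 1 else 0
  have hΦ : ∀ d d', c < d ∨ c < d' → Φ d d' = 0 := fun d d' h => if_neg (by omega)
  have h := sum_below_antiWord_eq_sum_raise k P c (fun d => ((below k').map fun l' =>
    mult k' l' * pairing (word l') (word Q) * Φ d (k'.sum - l'.sum)).sum) fun d hd =>
      List.sum_eq_zero fun z hz => by
        obtain ⟨l', _, rfl⟩ := List.mem_map.mp hz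
        rw [hΦ _ _ (Or.inl hd), mul_zero]
  refine Eq.trans (sum_map_congr fun l hl => ?_) (h.trans (sum_map_congr fun p _ => ?_))
  · rw [← List.sum_map_mul_left]
    refine sum_map_congr fun l' hl' => ?_
    have h1 := sum_le_of_mem_below hl
    have h2 := sum_le_of_mem_below hl'
    rw [show k.sum + k'.sum - (l.sum + l'.sum) = k.sum - l.sum + (k'.sum - l'.sum) by omega]
    ring
  · rw [sum_below_eq_sum_raise k' Q c (Φ p.sum) fun d hd => hΦ _ _ (Or.inr hd),
      ← List.sum_map_mul_left]
    refine sum_map_congr fun q _ => ?_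
    ring

theorem pairing_triLetter_of_pos {b : ℕ} (hb : 0 < b) (A w : List ℕ) :
    pairing (triLetter b (word A)) (word w) = pairing (word A) (letterAdjoint b w) := by
  have e : ∀ D ∈ marked w, pairing (word A) ((shifts D).map fun l =>
      (mult (addIdx D.1 l.1) D.1 * mult (addIdx D.2.2 l.2) D.2.2 *
        (if b = D.2.1 - (l.1.sum + l.2.sum) then 1 else 0)) •
          shuffle (antiWord (addIdx D.1 l.1)) (word (addIdx D.2.2 l.2))).sum =
      ((splits A).map fun s => ((below s.1).map fun l => ((below s.2).map fun l' =>
        (mult s.1 l * mult s.2 l') * (pairing (antiWord l) (word D.1) *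
          (if b + ((s.1.sum + s.2.sum) - (l.sum + l'.sum)) = D.2.1 then 1 else 0) *
            pairing (word l') (word D.2.2))).sum).sum).sum := fun D _ => by
    simp only [sum_below_below_eq_sum_raise]
    rw [pairing_sum_right]
    simp only [map_smul, pairing_word_shuffle, smul_sum_map]
    rw [sum_map_comm]
    refine sum_map_congr fun s _ => ?_
    rw [← sum_shifts hb D fun p q => mult (addIdx D.1 p) D.1 * mult (addIdx D.2.2 q) D.2.2 *
            (pairing (word s.1) (antiWord (addIdx D.1 p)) *
              pairing (word s.2) (word (addIdx D.2.2 q)))]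
    refine sum_map_congr fun l _ => ?_
    rw [smul_eq_mul]
    ring
  rw [letterAdjoint, pairing_sum_right, sum_map_congr e, triLetter_word hb, pairing_sum_left,
    sum_map_comm]
  refine sum_map_congr fun s _ => ?_
  rw [pairing_sum_left, sum_map_comm]
  refine sum_map_congr fun l _ => ?_
  rw [pairing_sum_left, sum_map_comm]
  refine sum_map_congr fun l' _ => ?_
  rw [map_smul, LinearMap.smul_apply, pairing_mul_letter_mul, smul_sum_map]
  rfl

theorem length_of_mem_marked {w : List ℕ} {D : List ℕ × ℕ × List ℕ} (h : D ∈ marked w) :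
    D.1.length + D.2.2.length + 1 = w.length := by
  induction w generalizing D with
  | nil => simp [marked] at h
  | cons a w ih =>
    rw [marked, List.mem_cons, List.mem_map] at h
    rcases h with rfl | ⟨E, hE, rfl⟩
    · simp
    · have := ih hE
      simp only [List.length_cons]; omega

/-- For `b = 0`, only a block consisting of the single letter `v_0` contributes, since nonempty
shifts leave `c - |l| ≥ 1`. -/
theorem letterAdjoint_zero (w : List ℕ) : letterAdjoint 0 w = if w = [0] then 1 else 0 := by
  by_cases hw : w.length = 1
  · obtain ⟨c, rfl⟩ := List.length_eq_one_iff.mp hw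
    simp [letterAdjoint, marked, shifts, below, addIdx, mult_nil, antiWord, shuffle_word,
      shuffleWord, word_nil, eq_comm]
  · rw [if_neg (by rintro rfl; exact hw rfl), letterAdjoint]
    refine List.sum_eq_zero fun x hx => ?_
    obtain ⟨D, hD, rfl⟩ := List.mem_map.mp hx
    refine List.sum_eq_zero fun y hy => ?_
    obtain ⟨l, hl, rfl⟩ := List.mem_map.mp hy
    have h1 := length_of_mem_marked hD
    have h2 : ¬ (D.1 = [] ∧ D.2.2 = []) := fun h => hw (by rw [← h1, h.1, h.2]; rfl)
    have h3 := (List.mem_filter.mp hl).2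
    simp only [h2, false_or, decide_eq_true_eq] at h3
    rw [if_neg (by omega), mul_zero, zero_smul]

theorem pairing_triLetter_zero (A w : List ℕ) :
    pairing (triLetter 0 (word A)) (word w) = pairing (word A) (letterAdjoint 0 w) := by
  rw [triLetter_zero, letterAdjoint_zero, map_smul, LinearMap.smul_apply, pairing_word]
  simp only [eq_comm (a := w)]
  split_ifs
  · rw [pairing_one, smul_eq_mul, mul_one]
  · rw [map_zero, smul_zero]

/-! ### The explicit formula for the coproduct -/

theorem sum_range_take_drop_cons {M : Type*} [AddCommMonoid M] (a : ℕ) (w : List ℕ)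
    (F : List ℕ → List ℕ → M) :
    ((List.range ((a :: w).length + 1)).map fun i => F ((a :: w).take i) ((a :: w).drop i)).sum =
      F [] (a :: w) +
        ((List.range (w.length + 1)).map fun i => F (a :: w.take i) (w.drop i)).sum := by
  rw [List.length_cons, List.range_succ_eq_map, List.map_cons, List.sum_cons, List.map_map]
  rfl

/-- Multiplication is dual to deconcatenation. -/
theorem pairing_mul (X Y : QV) (w : List ℕ) : pairing (X * Y) (word w) =
    ((List.range (w.length + 1)).map fun i =>
      pairing X (word (w.take i)) * pairing Y (word (w.drop i))).sum := by
  induction X using letter_induction generalizing w with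
  | one =>
    rw [one_mul, ← word_nil]
    rcases w with _ | ⟨a, w⟩
    · simp [pairing_word]
    · rw [sum_range_take_drop_cons (F := fun u v => pairing (word []) (word u) * pairing Y (word v))]
      simp [pairing_nil_cons, pairing_word [] []]
  | letter_mul b X ih =>
    rw [mul_assoc, pairing_comm]
    rcases w with _ | ⟨a, w⟩
    · simp [pairing_nil_letter_mul, pairing_comm _ (word [])]
    · rw [sum_range_take_drop_cons (F := fun u v =>
        pairing (word [b] * X) (word u) * pairing Y (word v)), pairing_letter_mul,
        pairing_comm _ (word []), pairing_nil_letter_mul, zero_mul, zero_add]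
      simp only [pairing_comm (word [b] * X), pairing_letter_mul]
      split_ifs with h
      · rw [pairing_comm, ih]
        refine sum_map_congr fun i _ => ?_
        rw [pairing_comm X]
      · simp
  | add A B hA hB =>
    rw [add_mul, map_add, LinearMap.add_apply, hA, hB, ← List.sum_map_add]
    refine sum_map_congr fun D _ => ?_
    rw [map_add, LinearMap.add_apply]; ring
  | smul c A hA =>
    rw [smul_mul_assoc, map_smul, LinearMap.smul_apply, hA, smul_sum_map]
    refine sum_map_congr fun D _ => ?_
    rw [map_smul, LinearMap.smul_apply, smul_eq_mul, smul_eq_mul]; ring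

/-- If `f` and `g` have adjoints `φ` and `γ` then the adjoint of `conv f g` is obtained from `φ` and
`γ` by deconcatenation and shuffle. -/
theorem pairing_conv {f g : QV →ₗ[ℚ] QV} {φ γ : List ℕ → QV}
    (hf : ∀ A w, pairing (f (word A)) (word w) = pairing (word A) (φ w))
    (hg : ∀ A w, pairing (g (word A)) (word w) = pairing (word A) (γ w)) (A w : List ℕ) :
    pairing (conv f g (word A)) (word w) = pairing (word A)
      ((List.range (w.length + 1)).map fun i => shuffle (φ (w.take i)) (γ (w.drop i))).sum := by
  rw [conv_word, pairing_sum_left, pairing_sum_right]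
  simp only [pairing_mul, pairing_word_shuffle, hf, hg]
  exact sum_map_comm _ _ _

/-- The adjoint of the action on the word `B`, evaluated at a word. -/
def wordAdjoint : List ℕ → List ℕ → QV
  | [], w => if w = [] then 1 else 0
  | b :: B, w => ((List.range (w.length + 1)).map fun i =>
      shuffle (letterAdjoint b (w.take i)) (wordAdjoint B (w.drop i))).sum

theorem pairing_triWord (B A w : List ℕ) :
    pairing (triWord B (word A)) (word w) = pairing (word A) (wordAdjoint B w) := by
  induction B generalizing A w with
  | nil =>
    rw [triWord, wordAdjoint, counitOne_apply, map_smul, LinearMap.smul_apply, one_pairing,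
      counit_word w]
    split_ifs
    · rw [pairing_one, smul_eq_mul, mul_one]
    · rw [map_zero, smul_zero]
  | cons b B ih =>
    rw [triWord]
    refine pairing_conv (fun A w => ?_) ih A w
    rcases b.eq_zero_or_pos with rfl | hb
    · exact pairing_triLetter_zero A w
    · exact pairing_triLetter_of_pos hb A w

/-- A sequence of nonempty words with nonempty concatenation is determined by its first word and the
remaining ones. -/
theorem sum_blockings_cons {M : Type*} [AddCommMonoid M] (a : ℕ) (w : List ℕ)
    (F : List (List ℕ) → M) : ((blockings (a :: w)).map F).sum =
      ((List.range (w.length + 1)).map fun i =>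
        ((blockings (w.drop i)).map fun B => F ((a :: w.take i) :: B)).sum).sum := by
  induction w generalizing a F with
  | nil => simp [blockings]
  | cons b w ih =>
    rw [sum_range_take_drop_cons (F := fun u v => ((blockings v).map fun B => F ((a :: u) :: B)).sum),
      ih b fun B => F ([a] :: B), blockings, sum_map_flatMap, ih, ← List.sum_map_add]
    refine sum_map_congr fun i _ => ?_
    rw [← List.sum_map_add]
    refine sum_map_congr fun B _ => ?_
    simp

/-- The contribution of a sequence of blocks to the adjoint of the action on a word `B`; there is one
block for each letter of `B`. -/
def blockAdjoint : List (List ℕ) → List ℕ → QV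
  | [], [] => 1
  | u :: U, b :: B => shuffle (letterAdjoint b u) (blockAdjoint U B)
  | _, _ => 0

theorem letterAdjoint_nil (b : ℕ) : letterAdjoint b [] = 0 := rfl

theorem sum_blockings_blockAdjoint (B w : List ℕ) :
    ((blockings w).map fun U => blockAdjoint U B).sum = wordAdjoint B w := by
  induction B generalizing w with
  | nil =>
    rcases w with _ | ⟨a, w⟩
    · simp [blockings, blockAdjoint, wordAdjoint]
    · rw [sum_blockings_cons]
      simp [blockAdjoint, wordAdjoint]
  | cons b B ih =>
    rcases w with _ | ⟨a, w⟩
    · simp [blockings, blockAdjoint, wordAdjoint, letterAdjoint_nil]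
    · rw [sum_blockings_cons, wordAdjoint, sum_range_take_drop_cons (F := fun u v =>
        shuffle (letterAdjoint b u) (wordAdjoint B v)), letterAdjoint_nil, map_zero,
        LinearMap.zero_apply, zero_add]
      refine sum_map_congr fun i _ => ?_
      simp only [blockAdjoint]
      rw [← ih, map_list_sum, List.map_map]
      rfl

theorem shuffle_assoc (x y z : QV) : shuffle (shuffle x y) z = shuffle x (shuffle y z) :=
  shuffleOps_laws.mul_assoc x y z

theorem shuffle_one (x : QV) : shuffle x 1 = x := shuffleOps_laws.mul_one x

/-- The sum over the marked letters and the shifts in a given sequence of blocks. The initial value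
`X` of the iterated shuffle product is arbitrary, for the induction. -/
theorem sum_sections_coprod (U : List (List ℕ)) (B : List ℕ) (X : QV) :
    ((U.map marked).sections.map fun D => ((D.map shifts).sections.map fun L =>
      (coprodCoeff D L * pairing (word B) (coprodRight D L)) •
        (List.zipWith (fun d l => shuffle (antiWord (addIdx d.1 l.1)) (word (addIdx d.2.2 l.2)))
          D L).foldl (fun x y => shuffle x y) X).sum).sum = shuffle X (blockAdjoint U B) := by
  induction U generalizing B X with
  | nil =>
    rcases B with _ | ⟨b, B⟩
    · simp [coprodCoeff, coprodRight, blockAdjoint, shuffle_one, pairing_word]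
    · simp [coprodCoeff, coprodRight, blockAdjoint, pairing_cons_nil]
  | cons u U ih =>
    rw [List.map_cons, sum_sections_cons]
    simp only [List.map_cons, sum_sections_cons]
    rcases B with _ | ⟨b, B⟩
    · rw [blockAdjoint, map_zero]
      · refine List.sum_eq_zero fun x hx => ?_
        obtain ⟨d, _, rfl⟩ := List.mem_map.mp hx
        refine List.sum_eq_zero fun x hx => ?_
        obtain ⟨D, _, rfl⟩ := List.mem_map.mp hx
        refine List.sum_eq_zero fun x hx => ?_
        obtain ⟨l, _, rfl⟩ := List.mem_map.mp hx
        refine List.sum_eq_zero fun x hx => ?_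
        obtain ⟨L, _, rfl⟩ := List.mem_map.mp hx
        rw [coprodRight, List.zipWith_cons_cons, pairing_nil_cons, mul_zero, zero_smul]
      all_goals simp
    · have e : ∀ d D l L, (coprodCoeff (d :: D) (l :: L) *
          pairing (word (b :: B)) (coprodRight (d :: D) (l :: L))) =
          (mult (addIdx d.1 l.1) d.1 * mult (addIdx d.2.2 l.2) d.2.2 *
            (if b = d.2.1 - (l.1.sum + l.2.sum) then 1 else 0)) *
              (coprodCoeff D L * pairing (word B) (coprodRight D L)) := fun d D l L => by
        rw [coprodCoeff, coprodRight, List.zipWith_cons_cons, List.zipWith_cons_cons,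
          List.prod_cons, pairing_cons, coprodCoeff, coprodRight]
        split_ifs <;> ring
      rw [blockAdjoint, ← shuffle_assoc, letterAdjoint, map_list_sum, List.map_map,
        ← LinearMap.flip_apply shuffle, map_list_sum, List.map_map]
      refine sum_map_congr fun d _ => ?_
      rw [sum_map_comm, Function.comp_apply, Function.comp_apply, map_list_sum, List.map_map,
        map_list_sum, List.map_map]
      refine sum_map_congr fun l _ => ?_
      simp only [e, mul_smul _ (coprodCoeff _ _ * _), ← smul_sum_map, List.zipWith_cons_cons,
        List.foldl_cons, ih]
      rw [Function.comp_apply, Function.comp_apply, map_smul, map_smul]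
      rfl

theorem tensorPairing_sum {α : Type*} (x : QV ⊗[ℚ] QV) (L : List α) (F : α → QV ⊗[ℚ] QV) :
    tensorPairing pairing x (L.map F).sum =
      (L.map fun a => tensorPairing pairing x (F a)).sum := by
  rw [map_list_sum, List.map_map]; rfl

theorem glCo_word (w : List ℕ) : glCo (word w) = coprodFormula w := by
  refine tensorPairing_ext fun A B => ?_
  rw [← pairing_gl, gl_apply, triExt_flip_word,
    pairing_conv (f := LinearMap.id) (φ := word) (fun _ _ => by rw [LinearMap.id_apply])
      (pairing_triWord B),
    pairing_sum_right, coprodFormula, decompositions, tensorPairing_sum, sum_map_flatMap]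
  refine sum_map_congr fun i _ => ?_
  rw [← sum_blockings_blockAdjoint, sum_map_flatMap, map_list_sum, List.map_map,
    pairing_sum_right]
  refine sum_map_congr fun U _ => ?_
  rw [Function.comp_apply, ← sum_sections_coprod, List.map_map, pairing_sum_right]
  refine sum_map_congr fun D _ => ?_
  rw [Function.comp_apply, tensorPairing_sum, pairing_sum_right]
  refine sum_map_congr fun L _ => ?_
  have e : ∀ x y, tensorPairing pairing (word A ⊗ₜ[ℚ] word B) (x ⊗ₜ[ℚ] y) =
    pairing (word A) x * pairing (word B) y := fun _ _ => rfl
  rw [map_smul, map_smul, e, smul_eq_mul, smul_eq_mul, coprodLeft]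
  ring

end

end AriHopf

theorem theorem5p20 :
    -- the map `▷_a` descends from the magma algebra to `Lie(V)`
    ∃ tri : LieV →ₗ[ℚ] LieV →ₗ[ℚ] LieV,
      (∀ x y : MQ, tri (toLie x) (toLie y) = toLie (triMagma x y)) ∧
      IsGradedPostLie tri lieGrade ∧
    -- the extension of `▷_a` to `ℚ⟨V⟩` exists and is unique
    ∃ ext : QV →ₗ[ℚ] QV →ₗ[ℚ] QV,
      IsExtension tri ext ∧ (∀ ext', IsExtension tri ext' → ext' = ext) ∧
    -- the coproduct `Δ_a` dual to the Grossman-Larson product exists and is unique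
    ∃ Δ : QV →ₗ[ℚ] QV ⊗[ℚ] QV,
      (∀ A B C : QV, pairing (glp ext A B) C = tensorPairing pairing (A ⊗ₜ[ℚ] B) (Δ C)) ∧
      (∀ Δ' : QV →ₗ[ℚ] QV ⊗[ℚ] QV,
        (∀ A B C : QV, pairing (glp ext A B) C = tensorPairing pairing (A ⊗ₜ[ℚ] B) (Δ' C)) →
          Δ' = Δ) ∧
    -- the dual pair of graded Hopf algebras
      (∃ S S' : QV →ₗ[ℚ] QV,
        HopfOps.IsGradedHopfAlgebra ⟨shuffle, 1, Δ, counit, S⟩ wtGrade ∧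
        HopfOps.IsGradedHopfAlgebra ⟨glp ext, 1, co.toLinearMap, counit, S'⟩ wtGrade ∧
        IsGradedDual pairing wtGrade wtGrade
          ⟨glp ext, 1, co.toLinearMap, counit, S'⟩ ⟨shuffle, 1, Δ, counit, S⟩) ∧
    -- the explicit formulas
      (∀ (A : List ℕ) (m₀ : ℕ) (b : List (ℕ × ℕ)), (∀ p ∈ b, 0 < p.1) →
        glp ext (word A) (word (blockWord m₀ b)) = glpFormula A m₀ b) ∧
      (∀ k : List ℕ, Δ (word k) = coprodFormula k) := by
  refine ⟨tri, tri_toLie, isGradedPostLie_tri, triExt, isExtension_triExt,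
    fun ext' h => isExtension_triExt.eq_triExt h, glCo, pairing_gl, fun Δ' h => ?_,
    ⟨shuffleAntipode, glAntipode, isGradedHopfAlgebra_shuffleOps, isGradedHopfAlgebra_glOps,
      isGradedDual_ops⟩, gl_blockWord, glCo_word⟩
  exact LinearMap.ext fun C => tensorPairing_ext fun u v => by rw [← h, ← pairing_gl]; rfl
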